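/- Let $e_{pq}$ ($1\le p,q\le 3$) be the generators of the complexification $\mathfrak{sl}_3(\mathbb C)$ of $\mathfrak{su}_3$, with $[e_{pq},e_{rs}]=\delta_{qr}e_{ps}-\delta_{sp}e_{rq}$ and $e_{11}+e_{22}+e_{33}=0$; put $h_1=e_{11}-e_{22}$, $h_2=e_{22}-e_{33}$. For positive integers $p,q$ let $[p,q]$ be the finite-dimensional irreducible representation with a highest-weight vector $v$ such that $h_1v=(p-1)v$, $h_2v=(q-1)v$. In $U(\mathfrak{sl}_3)^{\otimes 2}$ put $e^{(1)}_{pq}=e_{pq}\otimes 1$, $e^{(2)}_{pq}=1\otimes e_{pq}$ and, with summation over repeated indices, \[T^{(a_1,\dots,a_\mu)}=e^{(a_1)}_{i_2i_1}e^{(a_2)}_{i_3i_2}\cdots e^{(a_\mu)}_{i_1i_\mu},\qquad \overline T^{(a_1,\dots,a_\mu)}=e^{(a_1)}_{i_1i_2}e^{(a_2)}_{i_2i_3}\cdots e^{(a_\mu)}_{i_\mu i_1},\qquad l_a=\tfrac12\bigl(\overline T^{(a,a,a)}+T^{(a,a,a)}\bigr),\] \[X=\tfrac12\bigl(T^{(1,1,2)}-T^{(1,2,2)}\bigr)+\tfrac13(l_1-l_2),\qquad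 Y=\tfrac12\bigl(T^{(1,1,2,2)}+\overline T^{(1,1,2,2)}\bigr)-\tfrac1{12}\bigl(T^{(1,2)}\bigr)^2-\tfrac5{12}T^{(1,1)}T^{(2,2)}-2T^{(1,2)}.\] These commute with the diagonal action of $\mathfrak{sl}_3$. For $\mathbf m=(m_1,m_2,m_1',m_2',m_1'',m_2'')\in\mathbb Z_{>0}^6$ let $M_{\mathbf m}\subset[m_1,m_2]\otimes[m_1',m_2']$ be the space of highest-weight vectors of weight $(m_1'',m_2'')$ (that is, killed by the diagonal $e_{ij}$, $i<j$, and with diagonal $h_1,h_2$ acting by $m_1''-1,m_2''-1$), let $d_{\mathbf m}=\dim M_{\mathbf m}$ be the Littlewood--Richardson coefficient, and let $X_{\mathbf m},Y_{\mathbf m}$ be the operators by which $X,Y$ act on $M_{\mathbf m}$. For $\mathbf m\in\mathbb Q^6$ put $\ell=\frac13(m_1+2m_2+m'_1+2m'_2-m''_1-2m''_2)$, $n=\frac13(2m_1+m_2+2m'_1+m'_2-2m''_1-m''_2)$ and consider the pair of $3\times3$ squares \[\left[\begin{array}{ccc|ccc} m_1 & m'_1 & m''_2 & m_1+\ell-n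 & m'_1+\ell-n & m''_2+\ell-n\\ m'_1+m'_2-\ell & m_1+m_2-\ell & n & m'_1+m'_2-n & m_1+m_2-n & \ell\\ m_2+n-\ell & m'_2+n-\ell & m''_1+n-\ell & m_2 & m'_2 & m''_1 \end{array}\right].\] Consider the following operations on pairs of squares: a permutation of the lines, simultaneously in both squares; a permutation of the columns, simultaneously in both squares; transposition of both squares; exchange of the two squares. Then: (i) For each of these operations there is a unique linear automorphism $\mathbf m\mapsto\mathbf m'$ of $\mathbb Q^6$ such that the pair of squares of $\mathbf m'$ is obtained from that of $\mathbf m$ by the operation. (ii) The group $G$ generated by these automorphisms has order $144$ and is isomorphic to $\bigl((S_3\times S_3)\rtimes\mathbb Z/2\bigr)\times\mathbb Z/2$, where the two factors $S_3$ correspond to the permutations of lines and of columns, the first $\mathbb Z/2$, which exchanges them, to the transposition, and the last $\mathbb Z/2$ to the exchange of the squares. (iii) There is a homomorphism $\operatorname{sgn}:G\to\{\pm1\}$ equal to the signature of $\sigma$ on the permutation $\sigma$ of the lines or of the columns and to $1$ on the transposition and on the exchange (thus $\operatorname{sgn}$ is $-1$ to the number of transpositions of lines and columns), such that for all $g\in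 G$ and $\mathbf m\in\mathbb Z_{>0}^6$, with $\mathbf m'=g\,\mathbf m$: if $d_{\mathbf m}\neq0$ then $\mathbf m'\in\mathbb Z_{>0}^6$; and whenever $\mathbf m'\in\mathbb Z_{>0}^6$, one has $d_{\mathbf m'}=d_{\mathbf m}$ and the pair $(X_{\mathbf m},Y_{\mathbf m})$ is simultaneously conjugate to $(\operatorname{sgn}(g)X_{\mathbf m'},Y_{\mathbf m'})$, i.e. there is a linear isomorphism $P:M_{\mathbf m}\to M_{\mathbf m'}$ with $PX_{\mathbf m}P^{-1}=\operatorname{sgn}(g)X_{\mathbf m'}$ and $PY_{\mathbf m}P^{-1}=Y_{\mathbf m'}$. -/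

import Mathlib

open scoped TensorProduct

noncomputable section

namespace MissingLabel

/-! ### The Lie algebra and the polarised traces -/

/-- The complexification of `su(3)`. -/
abbrev sl3 : Type := LieAlgebra.SpecialLinear.sl (Fin 3) ℂ

/-- The universal enveloping algebra of `sl3`. -/
abbrev U : Type := UniversalEnvelopingAlgebra ℂ sl3

/-- The generators `e_{pq}`, with `[e_{pq}, e_{rs}] = δ_{qr} e_{ps} - δ_{sp} e_{rq}` and
`e_{11} + e_{22} + e_{33} = 0`: the matrix units made traceless. -/
def e (p q : Fin 3) : sl3 :=
  ⟨Matrix.single p q 1 - (if p = q then (1 / 3 : ℂ) else 0) • (1 : Matrix (Fin 3) (Fin 3) ℂ), by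
    change Matrix.trace (Matrix.single p q 1 - (if p = q then (1 / 3 : ℂ) else 0) •
      (1 : Matrix (Fin 3) (Fin 3) ℂ)) = 0
    by_cases h : p = q
    · subst h
      simp [Matrix.trace_single_eq_same]
    · simp [h, Matrix.trace_single_eq_of_ne]⟩

/-- The Cartan generators `h₁ = e₁₁ - e₂₂` (at `k = 0`) and `h₂ = e₂₂ - e₃₃` (at `k = 1`). -/
def h (k : Fin 2) : sl3 := e k.castSucc k.castSucc - e k.succ k.succ

/-- The image of `x` in the copy number `a` of `U` in `U ⊗ U`: `x ⊗ 1` for `a = 0` and `1 ⊗ x`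
for `a = 1`. -/
def copy (a : Fin 2) (x : sl3) : U ⊗[ℂ] U :=
  if a = 0 then UniversalEnvelopingAlgebra.ι ℂ x ⊗ₜ[ℂ] 1
  else 1 ⊗ₜ[ℂ] UniversalEnvelopingAlgebra.ι ℂ x

/-- The diagonal embedding on `sl3`. -/
def diag (x : sl3) : U ⊗[ℂ] U := copy 0 x + copy 1 x

/-- The `3 × 3` matrix `(e_{pq}^{(a)})_{p,q}`, with entries in `U ⊗ U`. -/
def eMat (a : Fin 2) : Matrix (Fin 3) (Fin 3) (U ⊗[ℂ] U) := Matrix.of fun p q => copy a (e p q)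

/-- The polarised trace
`T^{(a₁,…,a_μ)} = ∑ e_{i₂i₁}^{(a₁)} e_{i₃i₂}^{(a₂)} ⋯ e_{i₁i_μ}^{(a_μ)}`
(the superscripts are `0`, `1` instead of `1`, `2`). -/
def T (as : List (Fin 2)) : U ⊗[ℂ] U :=
  Matrix.trace (as.map fun a => (eMat a).transpose).prod

/-- The polarised trace
`∑ e_{i₁i₂}^{(a₁)} e_{i₂i₃}^{(a₂)} ⋯ e_{i_μi₁}^{(a_μ)}`. -/
def Tbar (as : List (Fin 2)) : U ⊗[ℂ] U :=
  Matrix.trace (as.map eMat).prod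

/-- The cubic Casimir element
`L = ½ ∑ (e_{i₁i₂} e_{i₂i₃} e_{i₃i₁} + e_{i₂i₁} e_{i₃i₂} e_{i₁i₃})` in the copy number `a`. -/
def cubicCasimir (a : Fin 2) : U ⊗[ℂ] U :=
  (1 / 2 : ℂ) • (Tbar [a, a, a] + T [a, a, a])

/-- The missing label operator `X`. -/
def X : U ⊗[ℂ] U :=
  (1 / 2 : ℂ) • (T [0, 0, 1] - T [0, 1, 1]) + (1 / 3 : ℂ) • (cubicCasimir 0 - cubicCasimir 1)

/-- The missing label operator `Y`. -/
def Y : U ⊗[ℂ] U :=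
  (1 / 2 : ℂ) • (T [0, 0, 1, 1] + Tbar [0, 0, 1, 1]) - (1 / 12 : ℂ) • T [0, 1] ^ 2
    - (5 / 12 : ℂ) • (T [0, 0] * T [1, 1]) - (2 : ℂ) • T [0, 1]

/-! ### `X` and `Y` commute with the diagonal embedding -/

lemma e_lie (a b r s : Fin 3) :
    ⁅e a b, e r s⁆ = (if b = r then e a s else 0) - (if s = a then e r b else 0) := by
  have key : ∀ i j : Fin 3, (e i j).val = Matrix.single i j 1
      - (if i = j then (1 / 3 : ℂ) else 0) • (1 : Matrix (Fin 3) (Fin 3) ℂ) := fun _ _ => rfl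
  apply Subtype.ext
  rw [LieAlgebra.SpecialLinear.sl_bracket]
  have h1 : (e a b).val * (e r s).val - (e r s).val * (e a b).val
      = Matrix.single a b (1 : ℂ) * Matrix.single r s 1
        - Matrix.single r s 1 * Matrix.single a b 1 := by
    rw [key, key]
    generalize (if a = b then (1 / 3 : ℂ) else 0) = c
    generalize (if r = s then (1 / 3 : ℂ) else 0) = d
    simp only [sub_mul, mul_sub, smul_mul_assoc, mul_smul_comm, one_mul, mul_one, smul_sub]
    rw [smul_comm c d]
    abel
  rw [h1]
  have h2 : ((if b = r then e a s else 0) - (if s = a then e r b else 0) : sl3).val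
      = (if b = r then (e a s).val else 0) - (if s = a then (e r b).val else 0) := by
    split_ifs <;> rfl
  rw [h2]
  by_cases h3 : b = r <;> by_cases h4 : s = a
  · subst h3 h4
    simp [key]
  · subst h3
    simp [key, h4, Ne.symm h4, Matrix.single_mul_single_of_ne]
  · subst h4
    simp [key, h3, Ne.symm h3, Matrix.single_mul_single_of_ne]
  · simp [h3, h4, Matrix.single_mul_single_of_ne]

lemma copy_add (a : Fin 2) (x y : sl3) : copy a (x + y) = copy a x + copy a y := by
  unfold copy; split_ifs <;> simp [TensorProduct.add_tmul, TensorProduct.tmul_add]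

lemma copy_sub (a : Fin 2) (x y : sl3) : copy a (x - y) = copy a x - copy a y := by
  unfold copy; split_ifs <;> simp [TensorProduct.sub_tmul, TensorProduct.tmul_sub]

lemma diag_sub (x y : sl3) : diag (x - y) = diag x - diag y := by
  simp only [diag, copy_sub]; abel

lemma diag_comm_copy (a : Fin 2) (x y : sl3) :
    diag x * copy a y - copy a y * diag x = copy a ⁅x, y⁆ := by
  fin_cases a <;>
    simp [diag, copy, add_mul, mul_add, TensorProduct.sub_tmul, TensorProduct.tmul_sub,
      LieRing.of_associative_ring_bracket]

/-- Entries transform under the diagonal `e_{ab}` as the `e_{rs}` do. -/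
def Covariant (A : Matrix (Fin 3) (Fin 3) (U ⊗[ℂ] U)) : Prop :=
  ∀ a b r s, diag (e a b) * A r s - A r s * diag (e a b)
    = (if b = r then A a s else 0) - (if s = a then A r b else 0)

lemma copy_zero (a : Fin 2) : copy a 0 = 0 := by
  unfold copy; split_ifs <;> simp

lemma covariant_eMat (c : Fin 2) : Covariant (eMat c) := by
  intro a b r s
  simp only [eMat, Matrix.of_apply, diag_comm_copy, e_lie, copy_sub]
  congr 1 <;> split_ifs <;> simp [copy_zero]

lemma covariant_one : Covariant 1 := by
  intro a b r s
  simp only [Matrix.one_apply]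
  by_cases h1 : b = r <;> by_cases h2 : s = a <;> by_cases h3 : r = s <;> by_cases h4 : a = b <;>
    simp_all [eq_comm]

lemma Covariant.mul {A B : Matrix (Fin 3) (Fin 3) (U ⊗[ℂ] U)} (hA : Covariant A)
    (hB : Covariant B) : Covariant (A * B) := by
  intro a b r s
  have h1 : ∀ j, diag (e a b) * (A r j * B j s) - A r j * B j s * diag (e a b)
      = ((if b = r then A a j * B j s else 0) - (if j = a then A r b * B j s else 0))
        + ((if b = j then A r j * B a s else 0) - (if s = a then A r j * B j b else 0)) := by
    intro j
    have e1 : diag (e a b) * (A r j * B j s) - A r j * B j s * diag (e a b)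
      = (diag (e a b) * A r j - A r j * diag (e a b)) * B j s
        + A r j * (diag (e a b) * B j s - B j s * diag (e a b)) := by noncomm_ring
    rw [e1, hA, hB, sub_mul, mul_sub]
    simp only [ite_mul, mul_ite, zero_mul, mul_zero]
  simp only [Matrix.mul_apply, Finset.mul_sum, Finset.sum_mul]
  rw [← Finset.sum_sub_distrib, Finset.sum_congr rfl fun j _ => h1 j]
  simp only [Finset.sum_add_distrib, Finset.sum_sub_distrib, Finset.sum_ite_eq,
    Finset.sum_ite_eq', Finset.mem_univ, if_true]
  split_ifs <;> (try simp only [Finset.sum_const_zero]) <;> abel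

lemma Covariant.trace {A : Matrix (Fin 3) (Fin 3) (U ⊗[ℂ] U)} (hA : Covariant A) (a b : Fin 3) :
    Commute (diag (e a b)) A.trace := by
  rw [commute_iff_eq, ← sub_eq_zero]
  simp only [Matrix.trace, Matrix.diag_apply, Finset.mul_sum, Finset.sum_mul]
  rw [← Finset.sum_sub_distrib, Finset.sum_congr rfl fun j _ => hA a b j j]
  simp [Finset.sum_sub_distrib]

lemma commute_Tbar (as : List (Fin 2)) (a b : Fin 3) : Commute (diag (e a b)) (Tbar as) := by
  refine Covariant.trace ?_ a b
  induction as with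
  | nil => exact covariant_one
  | cons c as ih => simpa using (covariant_eMat c).mul ih

/-- Entries transform under the diagonal `e_{ab}` as the `e_{sr}` do. -/
def Contravariant (A : Matrix (Fin 3) (Fin 3) (U ⊗[ℂ] U)) : Prop :=
  ∀ a b r s, diag (e a b) * A r s - A r s * diag (e a b)
    = (if b = s then A r a else 0) - (if r = a then A b s else 0)

lemma Contravariant.mul {A B : Matrix (Fin 3) (Fin 3) (U ⊗[ℂ] U)} (hA : Contravariant A)
    (hB : Contravariant B) : Contravariant (A * B) := by
  intro a b r s
  have h1 : ∀ j, diag (e a b) * (A r j * B j s) - A r j * B j s * diag (e a b)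
      = ((if b = j then A r a * B j s else 0) - (if r = a then A b j * B j s else 0))
        + ((if b = s then A r j * B j a else 0) - (if j = a then A r j * B b s else 0)) := by
    intro j
    have e1 : diag (e a b) * (A r j * B j s) - A r j * B j s * diag (e a b)
      = (diag (e a b) * A r j - A r j * diag (e a b)) * B j s
        + A r j * (diag (e a b) * B j s - B j s * diag (e a b)) := by noncomm_ring
    rw [e1, hA, hB, sub_mul, mul_sub]
    simp only [ite_mul, mul_ite, zero_mul, mul_zero]
  simp only [Matrix.mul_apply, Finset.mul_sum, Finset.sum_mul]
  rw [← Finset.sum_sub_distrib, Finset.sum_congr rfl fun j _ => h1 j]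
  simp only [Finset.sum_add_distrib, Finset.sum_sub_distrib, Finset.sum_ite_eq,
    Finset.sum_ite_eq', Finset.mem_univ, if_true]
  split_ifs <;> (try simp only [Finset.sum_const_zero]) <;> abel

lemma Contravariant.trace {A : Matrix (Fin 3) (Fin 3) (U ⊗[ℂ] U)} (hA : Contravariant A)
    (a b : Fin 3) : Commute (diag (e a b)) A.trace := by
  rw [commute_iff_eq, ← sub_eq_zero]
  simp only [Matrix.trace, Matrix.diag_apply, Finset.mul_sum, Finset.sum_mul]
  rw [← Finset.sum_sub_distrib, Finset.sum_congr rfl fun j _ => hA a b j j]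
  simp [Finset.sum_sub_distrib]

lemma commute_T (as : List (Fin 2)) (a b : Fin 3) : Commute (diag (e a b)) (T as) := by
  refine Contravariant.trace ?_ a b
  induction as with
  | nil =>
    intro a b r s
    simp only [List.map_nil, List.prod_nil, Matrix.one_apply]
    by_cases h1 : b = s <;> by_cases h2 : r = a <;> by_cases h3 : r = s <;>
      by_cases h4 : b = a <;> simp_all [eq_comm]
  | cons c as ih =>
    have hc : Contravariant (eMat c).transpose := fun a b r s => by
      simpa only [Matrix.transpose_apply] using covariant_eMat c a b s r
    simpa using hc.mul ih

lemma commute_X (a b : Fin 3) : Commute (diag (e a b)) X := by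
  have hT := fun as => commute_T as a b
  have hB := fun as => commute_Tbar as a b
  exact (((hT _).sub_right (hT _)).smul_right _).add_right
    ((((((hB _).add_right (hT _)).smul_right _)).sub_right
      (((hB _).add_right (hT _)).smul_right _)).smul_right _)

lemma commute_Y (a b : Fin 3) : Commute (diag (e a b)) Y := by
  have hT := fun as => commute_T as a b
  have hB := fun as => commute_Tbar as a b
  exact (((((hT _).add_right (hB _)).smul_right _).sub_right
    (((hT _).pow_right 2).smul_right _)).sub_right
    (((hT _).mul_right (hT _)).smul_right _)).sub_right ((hT _).smul_right _)

/-! ### Representations and the multiplicity space -/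

/-- `V` is the finite-dimensional irreducible representation `[p, q]`: it has a highest weight
vector `v` with `h₁ v = (p - 1) v` and `h₂ v = (q - 1) v`. -/
structure IsIrrep (p q : ℚ) (V : Type*) [AddCommGroup V] [Module ℂ V] [LieRingModule sl3 V]
    [LieModule ℂ sl3 V] : Prop where
  finiteDimensional : FiniteDimensional ℂ V
  irreducible : LieModule.IsIrreducible ℂ sl3 V
  exists_highestWeight : ∃ v : V, v ≠ 0 ∧ (∀ i j : Fin 3, i < j → ⁅e i j, v⁆ = 0) ∧
    ⁅h 0, v⁆ = ((p : ℂ) - 1) • v ∧ ⁅h 1, v⁆ = ((q : ℂ) - 1) • v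

section

variable (V V' : Type*) [AddCommGroup V] [Module ℂ V] [LieRingModule sl3 V] [LieModule ℂ sl3 V]
  [AddCommGroup V'] [Module ℂ V'] [LieRingModule sl3 V'] [LieModule ℂ sl3 V']

/-- The action of `U ⊗ U` on `V ⊗ V'`. -/
def act : U ⊗[ℂ] U →ₐ[ℂ] Module.End ℂ (V ⊗[ℂ] V') :=
  Module.endTensorEndAlgHom.comp
    (Algebra.TensorProduct.map
      (UniversalEnvelopingAlgebra.lift ℂ (LieModule.toEnd ℂ sl3 V))
      (UniversalEnvelopingAlgebra.lift ℂ (LieModule.toEnd ℂ sl3 V')))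

/-- The multiplicity space of `[p, q]` in `V ⊗ V'`: the highest weight vectors of weight `(p, q)`
for the diagonal action. -/
def multSpace (p q : ℚ) : Submodule ℂ (V ⊗[ℂ] V') where
  carrier := {w | (∀ i j : Fin 3, i < j → act V V' (diag (e i j)) w = 0) ∧
    act V V' (diag (h 0)) w = ((p : ℂ) - 1) • w ∧ act V V' (diag (h 1)) w = ((q : ℂ) - 1) • w}
  add_mem' := by
    rintro x y ⟨hx, hx0, hx1⟩ ⟨hy, hy0, hy1⟩
    exact ⟨fun i j hij => by rw [map_add, hx i j hij, hy i j hij, add_zero],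
      by rw [map_add, hx0, hy0, smul_add], by rw [map_add, hx1, hy1, smul_add]⟩
  zero_mem' := by simp
  smul_mem' := by
    rintro c x ⟨hx, hx0, hx1⟩
    exact ⟨fun i j hij => by rw [map_smul, hx i j hij, smul_zero],
      by rw [map_smul, hx0, smul_comm], by rw [map_smul, hx1, smul_comm]⟩

/-- The multiplicity of `[p, q]` in `V ⊗ V'`. -/
def multiplicity (p q : ℚ) : ℕ := Module.finrank ℂ (multSpace V V' p q)

variable {V V'} in
lemma act_mem_multSpace {Z : U ⊗[ℂ] U} (hZ : ∀ a b, Commute (diag (e a b)) Z) {p q : ℚ}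
    {w : V ⊗[ℂ] V'} (hw : w ∈ multSpace V V' p q) : act V V' Z w ∈ multSpace V V' p q := by
  have hh : ∀ k, Commute (diag (h k)) Z := fun k => by
    rw [h, diag_sub]; exact (hZ _ _).sub_left (hZ _ _)
  have comm : ∀ D, Commute D Z → act V V' D (act V V' Z w) = act V V' Z (act V V' D w) := by
    intro D hD
    have := congrArg (act V V') hD.eq
    rw [map_mul, map_mul] at this
    exact LinearMap.congr_fun this w
  obtain ⟨h1, h2, h3⟩ := hw
  exact ⟨fun i j hij => by rw [comm _ (hZ _ _), h1 i j hij, map_zero],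
    by rw [comm _ (hh _), h2, map_smul], by rw [comm _ (hh _), h3, map_smul]⟩

/-- The operator by which `X` acts on the multiplicity space. -/
def physX (p q : ℚ) : Module.End ℂ (multSpace V V' p q) :=
  (act V V' X).restrict fun _ hw => act_mem_multSpace commute_X hw

/-- The operator by which `Y` acts on the multiplicity space. -/
def physY (p q : ℚ) : Module.End ℂ (multSpace V V' p q) :=
  (act V V' Y).restrict fun _ hw => act_mem_multSpace commute_Y hw

end

/-! ### The two magic squares and their symmetries -/

/-- The parameters `𝐦 = (m₁, m₂, m'₁, m'₂, m''₁, m''₂)`, in this order. -/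
abbrev Params : Type := Fin 6 → ℚ

/-- All six parameters are positive integers. -/
def IsDominant (m : Params) : Prop := ∀ i, ∃ k : ℕ, 0 < k ∧ m i = k

/-- `ℓ = (m₁ + 2m₂ + m'₁ + 2m'₂ - m''₁ - 2m''₂) / 3`. -/
def ell (m : Params) : ℚ := (m 0 + 2 * m 1 + m 2 + 2 * m 3 - m 4 - 2 * m 5) / 3

/-- `n = (2m₁ + m₂ + 2m'₁ + m'₂ - 2m''₁ - m''₂) / 3`. -/
def en (m : Params) : ℚ := (2 * m 0 + m 1 + 2 * m 2 + m 3 - 2 * m 4 - m 5) / 3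

/-- A left square (index `0`) and a right square (index `1`). -/
abbrev Arrangement : Type := Fin 2 → Matrix (Fin 3) (Fin 3) ℚ

/-- The two magic squares made of 18 linear forms in `𝐦`. -/
def squares (m : Params) : Arrangement :=
  ![!![m 0, m 2, m 5;
       m 2 + m 3 - ell m, m 0 + m 1 - ell m, en m;
       m 1 + en m - ell m, m 3 + en m - ell m, m 4 + en m - ell m],
    !![m 0 + ell m - en m, m 2 + ell m - en m, m 5 + ell m - en m;
       m 2 + m 3 - en m, m 0 + m 1 - en m, ell m;
       m 1, m 3, m 4]]

/-- Permutation of the lines, simultaneously in the two squares. -/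
def permLines (σ : Equiv.Perm (Fin 3)) (A : Arrangement) : Arrangement :=
  fun s => (A s).submatrix (σ⁻¹ : Equiv.Perm (Fin 3)) id

/-- Permutation of the columns, simultaneously in the two squares. -/
def permColumns (σ : Equiv.Perm (Fin 3)) (A : Arrangement) : Arrangement :=
  fun s => (A s).submatrix id (σ⁻¹ : Equiv.Perm (Fin 3))

/-- Transposition, simultaneously in the two squares. -/
def transposeBoth (A : Arrangement) : Arrangement := fun s => (A s).transpose

/-- Exchange of the two squares. -/
def exchange (A : Arrangement) : Arrangement := ![A 1, A 0]

/-- The elementary operations, with their sign: `-1` to the number of transpositions of lines and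
of columns. -/
inductive IsMove : (Arrangement → Arrangement) → ℤˣ → Prop
  | lines (σ : Equiv.Perm (Fin 3)) : IsMove (permLines σ) (Equiv.Perm.sign σ)
  | columns (σ : Equiv.Perm (Fin 3)) : IsMove (permColumns σ) (Equiv.Perm.sign σ)
  | transpose : IsMove transposeBoth 1
  | exchange : IsMove exchange 1

/-- The transformation `φ` of the parameters corresponds to the operation `μ` on the squares. -/
def Realizes (φ : Params ≃ₗ[ℚ] Params) (μ : Arrangement → Arrangement) : Prop :=
  ∀ m, squares (φ m) = μ (squares m)

/-- The group of transformations of the parameters generated by those that correspond to the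
elementary operations. -/
def symmetryGroup : Subgroup (Params ≃ₗ[ℚ] Params) :=
  Subgroup.closure {φ | ∃ μ s, IsMove μ s ∧ Realizes φ μ}

/-- The cyclic group of order two. -/
abbrev C2 : Type := Multiplicative (ZMod 2)

/-- The non-trivial element of the cyclic group of order two. -/
abbrev C2.gen : C2 := Multiplicative.ofAdd 1

/-- The symmetric group on three letters. -/
abbrev S3 : Type := Equiv.Perm (Fin 3)

/-- The action of the cyclic group of order two on `S3 × S3` by exchange of the factors. -/
def swapAction : C2 →* MulAut (S3 × S3) where
  toFun z := if z = 1 then 1 else MulEquiv.prodComm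
  map_one' := rfl
  map_mul' := by
    have hsq : (MulEquiv.prodComm : MulAut (S3 × S3)) * MulEquiv.prodComm = 1 := by
      ext x <;> rfl
    have hcases : ∀ z : C2, z = 1 ∨ z = C2.gen := by decide
    have hg : C2.gen ≠ 1 := by decide
    have hgg : C2.gen * C2.gen = 1 := by decide
    intro x y
    rcases hcases x with rfl | rfl <;> rcases hcases y with rfl | rfl <;>
      simp [hg, hgg, hsq]

/-- The group `((S₃ × S₃) ⋊ ℤ/2) × ℤ/2`. -/
abbrev ModelGroup : Type := ((S3 × S3) ⋊[swapAction] C2) × C2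

end MissingLabel

end

open scoped TensorProduct

noncomputable section

namespace MissingLabel

/-! The multiplicity space is given an explicit basis in which `X` and `Y` are tridiagonal with
visibly symmetric coefficients. The two squares are then recognised as a table of the same data.

An irreducible representation of highest weight `(p, q)` is isomorphic to `Pol.model p q`, the forms
of degree `p` in a vector `x` and `q` in a covector `ξ` with `ξ x = 0`
(`IsIrrep.exists_equiv_model`). Contracting the second factor of a highest weight vector of `model p
q ⊗ model p' q'` with the lowest functional loses nothing (`Pol.eq_zero_of_contract_lowest`). The
result is a polynomial of known weight whose nilpotency orders under `e 0 1` and `e 1 2` are bounded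
by means of `p'` and `q'`. Modulo `ξ x = 0` such polynomials are spanned by the monomials with
exponents `α₀ - t, κ₁, β₀ + t` in `x` and `α₁ - t, κ₂, β₂ + t` in `ξ`, where `κ₁ κ₂ = 0` and `t`
runs over the integers such that all `αᵢ - t` and `βᵢ + t` are nonnegative (`Pol.contract_mem_span`,
`Pol.IsLabel.exists_index`). Conversely each of these monomials is the contraction of a product of
eight elementary covariants (`Pol.exists_contract_eq_mon`).

Up to Casimir elements, `X` and `Y` are the mixed traces `mixedCubic` and `mixedQuartic` (`X_eq`,
`Y_eq`). Contraction turns these into differential operators in `x` and `ξ`, computed on Laurent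
monomials in `transportedCubic_laurent` and `transportedQuartic_laurent`. Their coefficients are
symmetric in the three numbers `αᵢ - t`, symmetric in the three numbers `βᵢ + t`, and involve `κ₁,
κ₂` only through the sum. Exchanging `α` with `β` and `t` with `-t` changes the sign of `X` and
preserves `Y`. This is the content of `Pol.exists_isLadder`, `IsLadder.comp` and `IsLadder.swap`. By
`IsLadder.exists_equiv` the coefficients determine the pair of operators up to conjugation.

Numbering lines, columns and the components of `α, β` by residues modulo `3`, the entry of the
square `s` in line `r` and column `c` is `α (c - r) + β (c + r) + 1 + κ s` (`isLabel_iff`). An even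
permutation of the lines is a translation `r ↦ r + k` and permutes `α` and `β` separately. An odd
one is a reflection `r ↦ k - r` and exchanges `α` with `β`, whence the sign. The transposition
replaces `c - r` by its opposite, and the exchange of the squares permutes `κ`. Hence every
operation carries labels to labels (`permutesLabels_operation`), and `exists_equiv_transformation`
follows.

The structure of the group rests on two facts: the pairs of squares of parameters are exactly the
pairs satisfying `IsMagic`, a condition stable under all operations (`squares_readout`), and one
such pair has 18 distinct entries, so that only the identity fixes it. -/

/-! ### Coefficients of the tridiagonal operators -/

/-- The second elementary symmetric function of three numbers. -/
def esymm2 (A : Fin 3 → ℂ) : ℂ := ((∑ i, A i) ^ 2 - ∑ i, A i ^ 2) / 2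

/-- Auxiliary function: `xDiag` is its antisymmetrisation. -/
def xHalf (A B : Fin 3 → ℂ) (k : ℂ) : ℂ :=
  -(∑ i, A i) ^ 3 / 108 + (∑ i, A i) * (∑ i, A i ^ 2) / 12 + (∏ i, A i) / 2
    + (∑ i, B i) * ((∑ i, A i ^ 2) / 6 - (∑ i, A i) ^ 2 / 18) + k * (∑ i, A i) ^ 2 / 6
    + (∑ i, A i ^ 2) / 4 + (∑ i, A i) ^ 2 / 12 + (k ^ 2 / 6 + k / 2 + 1 / 3) * ∑ i, A i

/-- Diagonal coefficient of `X`. -/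
def xDiag (A B : Fin 3 → ℂ) (k : ℂ) : ℂ := xHalf A B k - xHalf B A k

/-- Auxiliary function: the part of `yDiag` to be symmetrised. -/
def yHalf (A B : Fin 3 → ℂ) (k : ℂ) : ℂ :=
  -esymm2 A ^ 2 / 12 - k * (∑ i, A i) * esymm2 A / 6 - (∑ i, A i) * esymm2 A / 6 - (∏ i, A i) / 2
    - k ^ 2 * ((∑ i, A i) ^ 2 / 12 + esymm2 A / 6) - k * ((∑ i, A i) ^ 2 / 6 + esymm2 A / 2)
    - esymm2 A / 3 - (k ^ 3 / 6 + 2 * k ^ 2 / 3 + 2 * k / 3) * (∑ i, A i)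
    - (∏ i, A i) * (∑ i, B i) / 3 - k * esymm2 A * (∑ i, B i) / 6

/-- Diagonal coefficient of `Y`. -/
def yDiag (A B : Fin 3 → ℂ) (k : ℂ) : ℂ :=
  yHalf A B k + yHalf B A k + esymm2 A * esymm2 B / 6
    - (k ^ 2 / 6 + k / 3) * (∑ i, A i) * (∑ i, B i)
    - (k ^ 4 / 12 + k ^ 3 / 2 + 11 / 12 * k ^ 2 + k / 2)

/-- Off-diagonal coefficient of `Y`. -/
def yOff (A B : Fin 3 → ℂ) (k : ℂ) : ℂ :=
  -(∏ i, A i) * ((∑ i, A i) + 2 * (∑ i, B i) + 3 * k + 6) / 3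

/-! ### Eigenvalues of the Casimir elements -/

/-- Eigenvalue of `∑ e_{ij} e_{ji}` on a vector of highest weight `l`. -/
def quadEigenvalue (l : Fin 3 → ℂ) : ℂ := l 0 ^ 2 + l 1 ^ 2 + l 2 ^ 2 + 2 * (l 0 - l 2)

/-- Eigenvalue of `∑ e_{ik} e_{ki}` on a vector of highest weight `l`, for fixed `i`. -/
def sqEigenvalue (l : Fin 3 → ℂ) (i : Fin 3) : ℂ := l i ^ 2 + ∑ k, if i < k then l i - l k else 0

/-- Eigenvalue of `∑ e_{ij} e_{jk} e_{ki}` on a vector of highest weight `l`. -/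
def cubicEigenvalue (l : Fin 3 → ℂ) : ℂ :=
  (∑ i, l i * sqEigenvalue l i) + 2 * sqEigenvalue l 0 - 2 * sqEigenvalue l 2

/-- The scalar by which `∑ e_{ij}^{(1)} e_{ji}^{(2)}` acts on a multiplicity space. -/
def mixedEigenvalue (l l' n : Fin 3 → ℂ) : ℂ :=
  (quadEigenvalue n - quadEigenvalue l - quadEigenvalue l') / 2

/-- The scalar by which the sum of the two mixed cubic traces acts on a multiplicity space. -/
def mixedCubicEigenvalue (l l' n : Fin 3 → ℂ) : ℂ :=
  (cubicEigenvalue n - cubicEigenvalue l - cubicEigenvalue l' + 6 * mixedEigenvalue l l' n) / 3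

/-- The scalar by which `X` differs from a mixed cubic trace on a multiplicity space. -/
def xShift (l l' n : Fin 3 → ℂ) : ℂ :=
  -mixedCubicEigenvalue l l' n / 2 + (cubicEigenvalue l - cubicEigenvalue l'
    - 3 / 2 * (quadEigenvalue l - quadEigenvalue l')) / 3

/-- The scalar by which `Y` differs from a mixed quartic trace on a multiplicity space. -/
def yShift (l l' n : Fin 3 → ℂ) : ℂ :=
  -(3 / 2) * mixedCubicEigenvalue l l' n + 5 / 2 * mixedEigenvalue l l' n
    - mixedEigenvalue l l' n ^ 2 / 12 - 5 / 12 * (quadEigenvalue l * quadEigenvalue l')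

/-- The `e_{ii}`-eigenvalues of a vector of `h`-weight `(p, q)`. -/
def diagWeight (p q : ℂ) : Fin 3 → ℂ := ![(2 * p + q) / 3, (q - p) / 3, -(p + 2 * q) / 3]

/-! ### Operators on Laurent monomials in the coordinates of a flag -/

/-- Entries of the square of a matrix of operators. -/
def sqEntry {W : Type*} [AddCommGroup W] [Module ℂ W] (E : Fin 3 → Fin 3 → Module.End ℂ W)
    (i j : Fin 3) : Module.End ℂ W := ∑ k, E i k * E k j

/-- The mixed cubic trace, transported to the weight space of the first factor. -/
def transportedCubic {W : Type*} [AddCommGroup W] [Module ℂ W]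
    (E : Fin 3 → Fin 3 → Module.End ℂ W) (l : Fin 3 → ℂ) : Module.End ℂ W :=
  (∑ i, l i • sqEntry E i i) - sqEntry E 1 0 * E 0 1 - sqEntry E 2 1 * E 1 2
    - sqEntry E 2 0 * E 0 2

/-- The mixed quartic trace, transported to the weight space of the first factor. -/
def transportedQuartic {W : Type*} [AddCommGroup W] [Module ℂ W]
    (E : Fin 3 → Fin 3 → Module.End ℂ W) (l : Fin 3 → ℂ) : Module.End ℂ W :=
  (∑ i, sqEigenvalue l i • sqEntry E i i) - (l 0 + l 1 + 2) • (sqEntry E 1 0 * E 0 1)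
    - (l 1 + l 2 + 1) • (sqEntry E 2 1 * E 1 2) + sqEntry E 2 0 * (E 1 2 * E 0 1)
    - (l 0 + l 2 + 1) • (sqEntry E 2 0 * E 0 2)

/-- Derivations of a field acting on the coordinates of a flag (a vector `x` and a covector `ξ`
with `ξ x = 0`) as the traceless matrix units do. -/
structure IsFlagAction {K : Type*} [Field K] [Algebra ℂ K] (D : Fin 3 → Fin 3 → Derivation ℂ K K)
    (x ξ : Fin 3 → K) : Prop where
  x_ne : ∀ i, x i ≠ 0
  ξ_ne : ∀ i, ξ i ≠ 0
  incidence : x 0 * ξ 0 + x 1 * ξ 1 + x 2 * ξ 2 = 0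
  map_x : ∀ i j k, D i j (x k) = (if j = k then x i else 0) - (if i = j then (1 / 3 :
      ℂ) • x k else 0)
  map_ξ : ∀ i j k, D i j (ξ k) = (if i = j then (1 / 3 : ℂ) • ξ k else 0) - (if i =
      k then ξ j else 0)

namespace IsFlagAction

variable {K : Type*} [Field K] [Algebra ℂ K] {D : Fin 3 → Fin 3 → Derivation ℂ K K}
    {x ξ : Fin 3 → K}

/-- Laurent monomials in the coordinates of a flag. -/
def laurent (x ξ : Fin 3 → K) (a b : Fin 3 → ℤ) : K :=
  x 0 ^ a 0 * x 1 ^ a 1 * x 2 ^ a 2 * (ξ 0 ^ b 0 * ξ 1 ^ b 1 * ξ 2 ^ b 2)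

lemma derivation_zpow (d : Derivation ℂ K K) {y : K} (hy : y ≠ 0) (n : ℤ) :
    d (y ^ n) = (n : ℂ) • (y ^ n * (d y / y)) := by
  rw [Derivation.leibniz_zpow, zpow_sub_one₀ hy, ← Int.cast_smul_eq_zsmul ℂ]
  simp only [smul_eq_mul, div_eq_mul_inv]
  congr 1
  ring

lemma map_laurent (H : IsFlagAction D x ξ) (i j : Fin 3) (r : K) (a b : Fin 3 → ℤ) :
    D i j (r * laurent x ξ a b) = (D i j r + ((a j : ℂ) • (x i / x j) - (b i : ℂ) • (ξ j / ξ i)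
      - if i = j then ((1 / 3 : ℂ) * (a 0 + a 1 + a 2 - b 0 - b 1 - b 2)) • 1 else 0) * r)
      * laurent x ξ a b := by
  have hx := H.x_ne
  have hξ := H.ξ_ne
  simp only [laurent, Derivation.leibniz, derivation_zpow _ (hx _), derivation_zpow _ (hξ _),
    H.map_x, H.map_ξ, Algebra.smul_def]
  have := hx 0; have := hx 1; have := hx 2; have := hξ 0; have := hξ 1; have := hξ 2
  fin_cases i <;> fin_cases j <;> simp <;> field_simp <;> ring

/-- The derivations as linear operators. -/
def ops (D : Fin 3 → Fin 3 → Derivation ℂ K K) (i j : Fin 3) : Module.End ℂ K := (D i j : K →ₗ[ℂ] K)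

lemma laurent_add (H : IsFlagAction D x ξ) (a b a' b' : Fin 3 → ℤ) :
    laurent x ξ (a + a') (b + b') = laurent x ξ a' b' * laurent x ξ a b := by
  simp only [laurent, Pi.add_apply, zpow_add₀ (H.x_ne _), zpow_add₀ (H.ξ_ne _)]
  ring

lemma ops_laurent (H : IsFlagAction D x ξ) (i j : Fin 3) (a b : Fin 3 → ℤ) :
    ops D i j (laurent x ξ a b) = ((a j : K) * (x i / x j) - (b i : K) * (ξ j / ξ i)
      - if i = j then ((a 0 + a 1 + a 2 - b 0 - b 1 - b 2 : K)) / 3 else 0) * laurent x ξ a b := by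
  have := H.map_laurent i j 1 a b
  rw [one_mul, Derivation.map_one_eq_zero, zero_add, mul_one] at this
  refine this.trans ?_
  congr 1
  split_ifs
  · simp only [Algebra.smul_def, map_mul, map_sub, map_add, map_div₀, map_one, map_ofNat,
      map_intCast]
    ring
  · simp [Algebra.smul_def]

lemma laurent_shift_x (H : IsFlagAction D x ξ) (i j : Fin 3) (a b : Fin 3 → ℤ) :
    laurent x ξ (a + Pi.single i 1 - Pi.single j 1) b = x i / x j * laurent x ξ a b := by
  rw [show b = b + 0 from (add_zero b).symm, add_sub_assoc, H.laurent_add, add_zero]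
  congr 1
  fin_cases i <;> fin_cases j <;>
    simp [laurent, H.x_ne, div_eq_mul_inv] <;> ring

lemma laurent_shift_ξ (H : IsFlagAction D x ξ) (i j : Fin 3) (a b : Fin 3 → ℤ) :
    laurent x ξ a (b + Pi.single j 1 - Pi.single i 1) = ξ j / ξ i * laurent x ξ a b := by
  rw [show a = a + 0 from (add_zero a).symm, add_sub_assoc, H.laurent_add, add_zero]
  congr 1
  fin_cases i <;> fin_cases j <;>
    simp [laurent, H.ξ_ne, div_eq_mul_inv] <;> ring

/-- Multiplier by which a traceless matrix unit acts on a Laurent monomial. -/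
def unitMul (x ξ : Fin 3 → K) (i j : Fin 3) (a b : Fin 3 → ℤ) : K :=
  (a j : K) * (x i / x j) - (b i : K) * (ξ j / ξ i)
    - if i = j then ((a 0 + a 1 + a 2 - b 0 - b 1 - b 2 : ℤ) : K) / 3 else 0

/-- The inner unit produces shifted monomials, so the multiplier of the outer unit is evaluated at
the shifted exponents. -/
lemma ops_ops_laurent (H : IsFlagAction D x ξ) (i j k l : Fin 3) (a b : Fin 3 → ℤ) :
    ops D i j (ops D k l (laurent x ξ a b)) =
      (a l * (x k / x l) * unitMul x ξ i j (a + Pi.single k 1 - Pi.single l 1) b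
        - b k * (ξ l / ξ k) * unitMul x ξ i j a (b + Pi.single l 1 - Pi.single k 1)
        - (if k = l then ((a 0 + a 1 + a 2 - b 0 - b 1 - b 2 : ℤ) : K) / 3 else 0)
          * unitMul x ξ i j a b) * laurent x ξ a b := by
  have hE : ∀ a b, ops D i j (laurent x ξ a b) = unitMul x ξ i j a b * laurent x ξ a b := by
    intro a b; rw [H.ops_laurent]; simp [unitMul]
  have h2 : ops D k l (laurent x ξ a b) =
      (a l : ℂ) • laurent x ξ (a + Pi.single k 1 - Pi.single l 1) b
      - (b k : ℂ) • laurent x ξ a (b + Pi.single l 1 - Pi.single k 1)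
      - (if k = l then ((a 0 + a 1 + a 2 - b 0 - b 1 - b 2 : ℤ) : ℂ) / 3 else 0)
        • laurent x ξ a b := by
    rw [H.ops_laurent, H.laurent_shift_x, H.laurent_shift_ξ]
    split_ifs <;> simp only [Algebra.smul_def, map_intCast, map_div₀, map_ofNat, map_zero] <;>
      push_cast <;> ring
  rw [h2, map_sub, map_sub, map_smul, map_smul, map_smul, hE, hE, hE, H.laurent_shift_x,
    H.laurent_shift_ξ]
  split_ifs <;> simp only [Algebra.smul_def, map_intCast, map_div₀, map_ofNat, map_zero] <;>
    push_cast <;> ring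

/-- Multiplier by which an entry of the squared matrix acts on a Laurent monomial, in terms of
constants which only depend on the bidegree. -/
def sqMulAux (x ξ : Fin 3 → K) (P Q G : K) (i j : Fin 3) (a b : Fin 3 → ℤ) : K :=
  P * a j * (x i / x j) + Q * b i * (ξ j / ξ i)
    - x i * ξ j * (a 0 * b 0 / (x 0 * ξ 0) + a 1 * b 1 / (x 1 * ξ 1) + a 2 * b 2 / (x 2 * ξ 2))
    + if i = j then G else 0

/-- Multiplier by which an entry of the squared matrix acts on a Laurent monomial. -/
def sqMul (x ξ : Fin 3 → K) (i j : Fin 3) (a b : Fin 3 → ℤ) : K :=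
  sqMulAux x ξ
    (a 0 + a 1 + a 2 + 2 - 2 * ((a 0 + a 1 + a 2 - b 0 - b 1 - b 2) / 3))
    (b 0 + b 1 + b 2 - 1 + 2 * ((a 0 + a 1 + a 2 - b 0 - b 1 - b 2) / 3))
    (b 0 + b 1 + b 2 + ((a 0 + a 1 + a 2 - b 0 - b 1 - b 2) / 3) ^ 2) i j a b

lemma sqEntry_laurent (H : IsFlagAction D x ξ) (i j : Fin 3) (a b : Fin 3 → ℤ) :
    sqEntry (ops D) i j (laurent x ξ a b) = sqMul x ξ i j a b * laurent x ξ a b := by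
  have hx0 := H.x_ne 0; have hx1 := H.x_ne 1; have hx2 := H.x_ne 2
  have hξ0 := H.ξ_ne 0; have hξ1 := H.ξ_ne 1; have hξ2 := H.ξ_ne 2
  have : CharZero K := charZero_of_injective_algebraMap (algebraMap ℂ K).injective
  simp only [sqEntry, LinearMap.sum_apply, Module.End.mul_apply, H.ops_ops_laurent,
      ← Finset.sum_mul]
  congr 1
  simp only [sqMul, sqMulAux, unitMul, Fin.sum_univ_three, Pi.add_apply, Pi.sub_apply]
  -- Differentiating `x` by the inner unit and `ξ` by the outer one gives `a j * b i * x k * ξ k /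
  -- (x j * ξ i)`, up to sign. Summed over the middle index `k`, this vanishes by incidence.
  linear_combination (norm := skip) (-(a j * b i : K) / (x j * ξ i)) * H.incidence
  fin_cases i <;> fin_cases j <;> simp <;> field_simp <;> ring

lemma ops_laurent_of_ne (H : IsFlagAction D x ξ) {k l : Fin 3} (hkl : k ≠ l) (a b : Fin 3 → ℤ) :
    ops D k l (laurent x ξ a b) =
      (a l : ℂ) • laurent x ξ (a + Pi.single k 1 - Pi.single l 1) b
      - (b k : ℂ) • laurent x ξ a (b + Pi.single l 1 - Pi.single k 1) := by
  rw [H.ops_laurent, H.laurent_shift_x, H.laurent_shift_ξ]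
  simp [Algebra.smul_def, hkl]
  ring

lemma sqEntry_ops_laurent (H : IsFlagAction D x ξ) (i j : Fin 3) {k l : Fin 3} (hkl : k ≠ l)
    (a b : Fin 3 → ℤ) :
    sqEntry (ops D) i j (ops D k l (laurent x ξ a b)) =
      (a l * (x k / x l) * sqMul x ξ i j (a + Pi.single k 1 - Pi.single l 1) b
        - b k * (ξ l / ξ k) * sqMul x ξ i j a (b + Pi.single l 1 - Pi.single k 1))
          * laurent x ξ a b := by
  rw [H.ops_laurent_of_ne hkl, map_sub, map_smul, map_smul, H.sqEntry_laurent, H.sqEntry_laurent,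
    H.laurent_shift_x, H.laurent_shift_ξ]
  simp only [Algebra.smul_def, map_intCast]
  ring

lemma sqEntry_ops_ops_laurent (H : IsFlagAction D x ξ) (i j : Fin 3) {k l k' l' : Fin 3}
    (hkl : k ≠ l) (hkl' : k' ≠ l') (a b : Fin 3 → ℤ) :
    sqEntry (ops D) i j (ops D k' l' (ops D k l (laurent x ξ a b))) =
      (a l * (x k / x l) *
        (((a + Pi.single k 1 - Pi.single l 1 : Fin 3 → ℤ) l' : K) * (x k' / x l')
          * sqMul x ξ i j (a + Pi.single k 1 - Pi.single l 1 + Pi.single k' 1 - Pi.single l' 1) b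
        - b k' * (ξ l' / ξ k') * sqMul x ξ i j (a + Pi.single k 1 - Pi.single l 1)
          (b + Pi.single l' 1 - Pi.single k' 1))
        - b k * (ξ l / ξ k) *
        (a l' * (x k' / x l')
          * sqMul x ξ i j (a + Pi.single k' 1 - Pi.single l' 1) (b + Pi.single l 1 - Pi.single k 1)
        - ((b + Pi.single l 1 - Pi.single k 1 : Fin 3 → ℤ) k' : K) * (ξ l' / ξ k') * sqMul x ξ i j a
          (b + Pi.single l 1 - Pi.single k 1 + Pi.single l' 1 - Pi.single k' 1)))
          * laurent x ξ a b := by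
  rw [H.ops_laurent_of_ne hkl, map_sub, map_smul, map_smul, map_sub, map_smul, map_smul,
    H.sqEntry_ops_laurent _ _ hkl', H.sqEntry_ops_laurent _ _ hkl',
    H.laurent_shift_x, H.laurent_shift_ξ]
  simp only [Algebra.smul_def, map_intCast, Pi.add_apply, Pi.sub_apply]
  push_cast
  ring

/-- The ratio `x₂ ξ₂ / (x₀ ξ₀)`. -/
def ratio (x ξ : Fin 3 → K) : K := x 2 * ξ 2 / (x 0 * ξ 0)

/-- A combination of `u` and of its products with `ratio x ξ` and its inverse. -/
def threeTerm (x ξ : Fin 3 → K) (r s t : ℂ) (u : K) : K :=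
  r • ((ratio x ξ)⁻¹ * u) + s • u + t • (ratio x ξ * u)

/-- The exponents of a Laurent monomial, and the constants with which the squared matrix acts. -/
structure Exponents (a b : Fin 3 → ℤ) (a0 a1 a2 b0 b1 b2 P Q G : ℂ) : Prop where
  a0_eq : a0 = a 0
  a1_eq : a1 = a 1
  a2_eq : a2 = a 2
  b0_eq : b0 = b 0
  b1_eq : b1 = b 1
  b2_eq : b2 = b 2
  P_eq : P = a0 + a1 + a2 + 2 - 2 * ((a0 + a1 + a2 - b0 - b1 - b2) / 3)
  Q_eq : Q = b0 + b1 + b2 - 1 + 2 * ((a0 + a1 + a2 - b0 - b1 - b2) / 3)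
  G_eq : G = b0 + b1 + b2 + ((a0 + a1 + a2 - b0 - b1 - b2) / 3) ^ 2
  disjoint : a 1 = 0 ∨ b 1 = 0

/-! ### Entries of the squared matrix as three-term operators -/

variable {a b : Fin 3 → ℤ} {a0 a1 a2 b0 b1 b2 P Q G : ℂ}

/-- The constants depend only on the total degrees, which the units preserve. The same `P`, `Q`, `G`
thus serve for all shifted exponents, and can stay opaque in the identities below. -/
lemma sqMul_eq_sqMulAux (h : Exponents a b a0 a1 a2 b0 b1 b2 P Q G) (i j : Fin 3)
    {a' b' : Fin 3 → ℤ} (ha : a' 0 + a' 1 + a' 2 = a 0 + a 1 + a 2)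
    (hb : b' 0 + b' 1 + b' 2 = b 0 + b 1 + b 2) :
    sqMul x ξ i j a' b' = sqMulAux x ξ (algebraMap ℂ K P) (algebraMap ℂ K Q) (algebraMap ℂ K G)
      i j a' b' := by
  have ha' : (a' 0 + a' 1 + a' 2 : K) = a 0 + a 1 + a 2 := by exact_mod_cast congrArg _ ha
  have hb' : (b' 0 + b' 1 + b' 2 : K) = b 0 + b 1 + b 2 := by exact_mod_cast congrArg _ hb
  rw [sqMul, h.P_eq, h.Q_eq, h.G_eq, h.a0_eq, h.a1_eq, h.a2_eq, h.b0_eq, h.b1_eq, h.b2_eq]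
  simp only [map_add, map_sub, map_mul, map_div₀, map_pow, map_ofNat, map_intCast, map_one,
    sub_sub, ← add_assoc, ha', hb']

lemma mul_eq_threeTerm {m u : K} {r s t : ℂ}
    (hm : m = algebraMap ℂ K r * (x 0 * ξ 0 / (x 2 * ξ 2)) + algebraMap ℂ K s
      + algebraMap ℂ K t * (x 2 * ξ 2 / (x 0 * ξ 0))) : m * u = threeTerm x ξ r s t u := by
  simp only [hm, threeTerm, ratio, Algebra.smul_def, inv_div]
  ring

/-- Eliminates `ξ 1`. Keeping the product `s = x 1 * ξ 1` as a nonzero quantity allows denominators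
to be cleared before incidence is substituted. -/
lemma exists_ξ_one_eq (H : IsFlagAction D x ξ) :
    ∃ s, s ≠ 0 ∧ ξ 1 = s / x 1 ∧ s = -(x 0 * ξ 0 + x 2 * ξ 2) := by
  refine ⟨x 1 * ξ 1, mul_ne_zero (H.x_ne 1) (H.ξ_ne 1), ?_, ?_⟩
  · rw [mul_div_cancel_left₀ _ (H.x_ne 1)]
  · linear_combination H.incidence

/-- Only the term `a 1 * b 1 / (x 1 * ξ 1)` could spoil the three-term form, since `x 1 * ξ 1 = -(x
0 * ξ 0 + x 2 * ξ 2)` is not a monomial. The condition `disjoint` removes it. -/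
lemma sqEntry_zero_zero (H : IsFlagAction D x ξ) (h : Exponents a b a0 a1 a2 b0 b1 b2 P Q G) :
    sqEntry (ops D) 0 0 (laurent x ξ a b) = threeTerm x ξ
      (-a2 * b2)
      (-a0 * b0 + a0 * P + b0 * Q + G)
      0
      (laurent x ξ a b) := by
  have hx0 := H.x_ne 0
  have hx1 := H.x_ne 1
  have hx2 := H.x_ne 2
  have hξ0 := H.ξ_ne 0
  have hξ2 := H.ξ_ne 2
  obtain ⟨s, hs, hξ1, hsum⟩ := H.exists_ξ_one_eq
  rw [H.sqEntry_laurent]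
  apply mul_eq_threeTerm
  rw [sqMul_eq_sqMulAux h _ _ ?_ ?_]
  · simp only [sqMulAux, h.a0_eq, h.a1_eq, h.a2_eq, h.b0_eq, h.b1_eq, h.b2_eq, Pi.add_apply,
      Pi.sub_apply, map_add,
      map_sub, map_mul, map_neg, map_pow, map_ofNat, map_intCast, map_zero]
    rcases h.disjoint with h1 | h1 <;> rw [h1, hξ1] <;> simp <;> field_simp <;> subst hsum <;>
      ring
  all_goals simp <;> ring

lemma sqEntry_one_one (H : IsFlagAction D x ξ) (h : Exponents a b a0 a1 a2 b0 b1 b2 P Q G) :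
    sqEntry (ops D) 1 1 (laurent x ξ a b) = threeTerm x ξ
      (a2 * b2)
      (a0 * b0 + a1 * P + a2 * b2 + b1 * Q + G)
      (a0 * b0)
      (laurent x ξ a b) := by
  have hx0 := H.x_ne 0
  have hx1 := H.x_ne 1
  have hx2 := H.x_ne 2
  have hξ0 := H.ξ_ne 0
  have hξ2 := H.ξ_ne 2
  obtain ⟨s, hs, hξ1, hsum⟩ := H.exists_ξ_one_eq
  rw [H.sqEntry_laurent]
  apply mul_eq_threeTerm
  rw [sqMul_eq_sqMulAux h _ _ ?_ ?_]
  · simp only [sqMulAux, h.a0_eq, h.a1_eq, h.a2_eq, h.b0_eq, h.b1_eq, h.b2_eq, Pi.add_apply,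
      Pi.sub_apply, map_add,
      map_sub, map_mul, map_neg, map_pow, map_ofNat, map_intCast, map_zero]
    rcases h.disjoint with h1 | h1 <;> rw [h1, hξ1] <;> simp <;> field_simp <;> subst hsum <;>
      ring
  all_goals simp <;> ring

lemma sqEntry_two_two (H : IsFlagAction D x ξ) (h : Exponents a b a0 a1 a2 b0 b1 b2 P Q G) :
    sqEntry (ops D) 2 2 (laurent x ξ a b) = threeTerm x ξ
      0
      (-a2 * b2 + a2 * P + b2 * Q + G)
      (-a0 * b0)
      (laurent x ξ a b) := by
  have hx0 := H.x_ne 0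
  have hx1 := H.x_ne 1
  have hx2 := H.x_ne 2
  have hξ0 := H.ξ_ne 0
  have hξ2 := H.ξ_ne 2
  obtain ⟨s, hs, hξ1, hsum⟩ := H.exists_ξ_one_eq
  rw [H.sqEntry_laurent]
  apply mul_eq_threeTerm
  rw [sqMul_eq_sqMulAux h _ _ ?_ ?_]
  · simp only [sqMulAux, h.a0_eq, h.a1_eq, h.a2_eq, h.b0_eq, h.b1_eq, h.b2_eq, Pi.add_apply,
      Pi.sub_apply, map_add,
      map_sub, map_mul, map_neg, map_pow, map_ofNat, map_intCast, map_zero]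
    rcases h.disjoint with h1 | h1 <;> rw [h1, hξ1] <;> simp <;> field_simp <;> subst hsum <;>
      ring
  all_goals simp <;> ring

/-- The inner unit can make both exponents of index `1` nonzero, but the term with denominator `x 1
* ξ 1` then carries the same product in its numerator. The other such term has the factor `a 1 * b 1
= 0`. -/
lemma sqEntry_one_zero_ops (H : IsFlagAction D x ξ) (h : Exponents a b a0 a1 a2 b0 b1 b2 P Q G) :
    sqEntry (ops D) 1 0 (ops D 0 1 (laurent x ξ a b)) = threeTerm x ξ
      (-a1 * a2 * b2 - a2 * b0 * b2)
      (-a0 * a1 * b0 + a0 * a1 * P - a0 * b0 ^ 2 + a0 * b0 * P + a0 * b0 + a1 * P - a2 * b0 * b2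
       - b0 * b1 * Q - b0 * Q)
      (-a0 * b0 ^ 2 + a0 * b0 * P + a0 * b0)
      (laurent x ξ a b) := by
  have hx0 := H.x_ne 0
  have hx1 := H.x_ne 1
  have hx2 := H.x_ne 2
  have hξ0 := H.ξ_ne 0
  have hξ2 := H.ξ_ne 2
  obtain ⟨s, hs, hξ1, hsum⟩ := H.exists_ξ_one_eq
  rw [H.sqEntry_ops_laurent 1 0 (show (0 : Fin 3) ≠ 1 by decide)]
  apply mul_eq_threeTerm
  rw [sqMul_eq_sqMulAux h _ _ ?_ ?_, sqMul_eq_sqMulAux h _ _ ?_ ?_]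
  · simp only [sqMulAux, h.a0_eq, h.a1_eq, h.a2_eq, h.b0_eq, h.b1_eq, h.b2_eq, Pi.add_apply,
      Pi.sub_apply, map_add,
      map_sub, map_mul, map_neg, map_pow, map_ofNat, map_intCast, map_zero]
    rcases h.disjoint with h1 | h1 <;> rw [h1, hξ1] <;> simp <;> field_simp <;> subst hsum <;>
      ring
  all_goals simp <;> ring

lemma sqEntry_two_one_ops (H : IsFlagAction D x ξ) (h : Exponents a b a0 a1 a2 b0 b1 b2 P Q G) :
    sqEntry (ops D) 2 1 (ops D 1 2 (laurent x ξ a b)) = threeTerm x ξ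
      (a2 ^ 2 * b2 - a2 * b2 * Q - a2 * b2)
      (a0 * a2 * b0 + a1 * a2 * P + a2 ^ 2 * b2 + a2 * b1 * b2 - a2 * b2 * Q - a2 * b2 + a2 * P
       - b1 * b2 * Q - b1 * Q)
      (a0 * a2 * b0 + a0 * b0 * b1)
      (laurent x ξ a b) := by
  have hx0 := H.x_ne 0
  have hx1 := H.x_ne 1
  have hx2 := H.x_ne 2
  have hξ0 := H.ξ_ne 0
  have hξ2 := H.ξ_ne 2
  obtain ⟨s, hs, hξ1, hsum⟩ := H.exists_ξ_one_eq
  rw [H.sqEntry_ops_laurent 2 1 (show (1 : Fin 3) ≠ 2 by decide)]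
  apply mul_eq_threeTerm
  rw [sqMul_eq_sqMulAux h _ _ ?_ ?_, sqMul_eq_sqMulAux h _ _ ?_ ?_]
  · simp only [sqMulAux, h.a0_eq, h.a1_eq, h.a2_eq, h.b0_eq, h.b1_eq, h.b2_eq, Pi.add_apply,
      Pi.sub_apply, map_add,
      map_sub, map_mul, map_neg, map_pow, map_ofNat, map_intCast, map_zero]
    rcases h.disjoint with h1 | h1 <;> rw [h1, hξ1] <;> simp <;> field_simp <;> subst hsum <;>
      ring
  all_goals simp <;> ring

lemma sqEntry_two_zero_ops (H : IsFlagAction D x ξ) (h : Exponents a b a0 a1 a2 b0 b1 b2 P Q G) :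
    sqEntry (ops D) 2 0 (ops D 0 2 (laurent x ξ a b)) = threeTerm x ξ
      (-a2 ^ 2 * b2 + a2 * b2 * Q + a2 * b2)
      (-a0 * a2 * b0 + a0 * a2 * P + a2 * b0 * b2 + a2 * P - b0 * b2 * Q - b0 * Q)
      (a0 * b0 ^ 2 - a0 * b0 * P - a0 * b0)
      (laurent x ξ a b) := by
  have hx0 := H.x_ne 0
  have hx1 := H.x_ne 1
  have hx2 := H.x_ne 2
  have hξ0 := H.ξ_ne 0
  have hξ2 := H.ξ_ne 2
  obtain ⟨s, hs, hξ1, hsum⟩ := H.exists_ξ_one_eq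
  rw [H.sqEntry_ops_laurent 2 0 (show (0 : Fin 3) ≠ 2 by decide)]
  apply mul_eq_threeTerm
  rw [sqMul_eq_sqMulAux h _ _ ?_ ?_, sqMul_eq_sqMulAux h _ _ ?_ ?_]
  · simp only [sqMulAux, h.a0_eq, h.a1_eq, h.a2_eq, h.b0_eq, h.b1_eq, h.b2_eq, Pi.add_apply,
      Pi.sub_apply, map_add,
      map_sub, map_mul, map_neg, map_pow, map_ofNat, map_intCast, map_zero]
    rcases h.disjoint with h1 | h1 <;> rw [h1, hξ1] <;> simp <;> field_simp <;> subst hsum <;>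
      ring
  all_goals simp <;> ring

lemma sqEntry_two_zero_ops_ops (H : IsFlagAction D x ξ) (h :
    Exponents a b a0 a1 a2 b0 b1 b2 P Q G) :
    sqEntry (ops D) 2 0 (ops D 1 2 (ops D 0 1 (laurent x ξ a b))) = threeTerm x ξ
      (-a1 * a2 ^ 2 * b2 + a1 * a2 * b2 * Q + a1 * a2 * b2 - a2 ^ 2 * b0 * b2 + a2 * b0 * b2 * Q
       + a2 * b0 * b2)
      (-a0 * a1 * a2 * b0 + a0 * a1 * a2 * P - a0 * a2 * b0 ^ 2 + a0 * a2 * b0 * P + a0 * a2 *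
       b0 + a1 * a2 * P - a2 ^ 2 * b0 * b2 - a2 * b0 * b1 * b2 + a2 * b0 * b2 * Q + b0 * b1 * b2
       * Q + b0 * b1 * Q + b0 * b2 * Q + b0 * Q)
      (-a0 * a2 * b0 ^ 2 + a0 * a2 * b0 * P + a0 * a2 * b0 - a0 * b0 ^ 2 * b1 - a0 * b0 ^ 2 + a0
       * b0 * b1 * P + a0 * b0 * b1 + a0 * b0 * P + a0 * b0)
      (laurent x ξ a b) := by
  have hx0 := H.x_ne 0
  have hx1 := H.x_ne 1
  have hx2 := H.x_ne 2
  have hξ0 := H.ξ_ne 0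
  have hξ2 := H.ξ_ne 2
  obtain ⟨s, hs, hξ1, hsum⟩ := H.exists_ξ_one_eq
  rw [H.sqEntry_ops_ops_laurent 2 0 (show (0 : Fin 3) ≠ 1 by decide) (show (1 : Fin 3) ≠ 2 by
      decide)]
  apply mul_eq_threeTerm
  rw [sqMul_eq_sqMulAux h _ _ ?_ ?_, sqMul_eq_sqMulAux h _ _ ?_ ?_, sqMul_eq_sqMulAux h _ _ ?_
      ?_, sqMul_eq_sqMulAux h _ _ ?_ ?_]
  · simp only [sqMulAux, h.a0_eq, h.a1_eq, h.a2_eq, h.b0_eq, h.b1_eq, h.b2_eq, Pi.add_apply,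
      Pi.sub_apply, map_add,
      map_sub, map_mul, map_neg, map_pow, map_ofNat, map_intCast, map_zero]
    rcases h.disjoint with h1 | h1 <;> rw [h1, hξ1] <;> simp <;> field_simp <;> subst hsum <;>
      ring
  all_goals simp <;> ring

end IsFlagAction

/-! ### Tridiagonal form of the transported traces -/

namespace IsFlagAction
variable {K : Type*} [Field K] [Algebra ℂ K] {D : Fin 3 → Fin 3 → Derivation ℂ K K}
    {x ξ : Fin 3 → K}

/-- The weights of two irreducible representations and of a highest weight vector in their tensor
product, in terms of the exponents of a monomial in the invariants. -/
structure Weights (α β : Fin 3 → ℤ) (κ₁ κ₂ : ℤ) (l l' n : Fin 3 → ℂ) : Prop where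
  left : l = diagWeight (α 0 + β 0 + κ₁) (α 1 + β 2 + κ₂)
  right : l' = diagWeight (α 1 + β 1 + κ₁) (α 2 + β 0 + κ₂)
  total : n = diagWeight (α 0 + β 1 + κ₂) (α 2 + β 2 + κ₁)
  disjoint : κ₁ = 0 ∨ κ₂ = 0

/-- Only `α 0, α 1, β 0, β 2` occur in the monomial; `α 2` and `β 1` enter through the weights. Once
the scalar `xShift` is added, the six numbers appear through symmetric functions of `α` and of `β`
alone. This is the source of all the symmetries. -/
theorem transportedCubic_laurent (H : IsFlagAction D x ξ) {α β : Fin 3 → ℤ} {κ₁ κ₂ : ℤ}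
    {l l' n : Fin 3 → ℂ} (hw : Weights α β κ₁ κ₂ l l' n) :
    transportedCubic (ops D) l' (laurent x ξ ![α 0, κ₁, β 0] ![α 1, κ₂, β 2])
      + xShift l l' n • laurent x ξ ![α 0, κ₁, β 0] ![α 1, κ₂, β 2] =
    threeTerm x ξ (-∏ i, (β i : ℂ)) (xDiag (fun i => α i) (fun i => β i) (κ₁ + κ₂))
      (∏ i, (α i : ℂ)) (laurent x ξ ![α 0, κ₁, β 0] ![α 1, κ₂, β 2]) := by
  have h : Exponents ![α 0, κ₁, β 0] ![α 1, κ₂, β 2] (α 0) κ₁ (β 0) (α 1) κ₂ (β 2) _ _ _ :=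
    ⟨rfl, rfl, rfl, rfl, rfl, rfl, rfl, rfl, rfl, hw.disjoint⟩
  simp only [transportedCubic, Fin.sum_univ_three, LinearMap.add_apply, LinearMap.sub_apply,
    Module.End.mul_apply, LinearMap.smul_apply, H.sqEntry_zero_zero h, H.sqEntry_one_one h,
    H.sqEntry_two_two h, H.sqEntry_one_zero_ops h, H.sqEntry_two_one_ops h,
    H.sqEntry_two_zero_ops h]
  generalize laurent x ξ ![α 0, κ₁, β 0] ![α 1, κ₂, β 2] = u
  simp only [threeTerm]
  generalize (ratio x ξ)⁻¹ * u = u'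
  generalize ratio x ξ * u = u''
  obtain ⟨hl, hl', hn, hκ⟩ := hw
  subst hl hl' hn
  simp only [xShift, xDiag, xHalf, Fin.prod_univ_three, mixedCubicEigenvalue, mixedEigenvalue,
    cubicEigenvalue, quadEigenvalue, sqEigenvalue, diagWeight, Fin.sum_univ_three]
  -- The coefficients on the right contain only `κ₁ + κ₂`. The relation `κ₁ * κ₂ = 0` is used by
  -- checking a polynomial identity in each of the two cases.
  rcases hκ with rfl | rfl
  · match_scalars <;> simp <;> ring
  · match_scalars <;> simp <;> ring

theorem transportedQuartic_laurent (H : IsFlagAction D x ξ) {α β : Fin 3 → ℤ} {κ₁ κ₂ : ℤ}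
    {l l' n : Fin 3 → ℂ} (hw : Weights α β κ₁ κ₂ l l' n) :
    transportedQuartic (ops D) l' (laurent x ξ ![α 0, κ₁, β 0] ![α 1, κ₂, β 2])
      + yShift l l' n • laurent x ξ ![α 0, κ₁, β 0] ![α 1, κ₂, β 2] =
    threeTerm x ξ (yOff (fun i => β i) (fun i => α i) (κ₁ + κ₂))
      (yDiag (fun i => α i) (fun i => β i) (κ₁ + κ₂))
      (yOff (fun i => α i) (fun i => β i) (κ₁ + κ₂))
      (laurent x ξ ![α 0, κ₁, β 0] ![α 1, κ₂, β 2]) := by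
  have h : Exponents ![α 0, κ₁, β 0] ![α 1, κ₂, β 2] (α 0) κ₁ (β 0) (α 1) κ₂ (β 2) _ _ _ :=
    ⟨rfl, rfl, rfl, rfl, rfl, rfl, rfl, rfl, rfl, hw.disjoint⟩
  simp only [transportedQuartic, Fin.sum_univ_three, LinearMap.add_apply, LinearMap.sub_apply,
    Module.End.mul_apply, LinearMap.smul_apply, H.sqEntry_zero_zero h, H.sqEntry_one_one h,
    H.sqEntry_two_two h, H.sqEntry_one_zero_ops h, H.sqEntry_two_one_ops h,
    H.sqEntry_two_zero_ops h, H.sqEntry_two_zero_ops_ops h]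
  generalize laurent x ξ ![α 0, κ₁, β 0] ![α 1, κ₂, β 2] = u
  simp only [threeTerm]
  generalize (ratio x ξ)⁻¹ * u = u'
  generalize ratio x ξ * u = u''
  obtain ⟨hl, hl', hn, hκ⟩ := hw
  subst hl hl' hn
  simp only [yShift, yDiag, yHalf, yOff, esymm2, Fin.prod_univ_three, mixedCubicEigenvalue,
    mixedEigenvalue,
    cubicEigenvalue, quadEigenvalue, sqEigenvalue, diagWeight, Fin.sum_univ_three]
  rcases hκ with rfl | rfl
  · match_scalars <;> simp <;> ring
  · match_scalars <;> simp <;> ring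

end IsFlagAction

/-! ### Traces in `U ⊗ U` -/

lemma copy_mul_copy_sub (a : Fin 2) (x y : sl3) :
    copy a x * copy a y - copy a y * copy a x = copy a ⁅x, y⁆ := by
  fin_cases a <;>
    simp [copy, TensorProduct.sub_tmul, TensorProduct.tmul_sub, LieRing.of_associative_ring_bracket]

lemma copy_commute (x y : sl3) : Commute (copy 0 x) (copy 1 y) := by
  simp [commute_iff_eq, copy]

lemma e_trace : e 0 0 + e 1 1 + e 2 2 = 0 := by
  apply Subtype.ext
  change (e 0 0).1 + (e 1 1).1 + (e 2 2).1 = 0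
  ext i j
  fin_cases i <;> fin_cases j <;> simp [e, Matrix.single_apply] <;> norm_num

lemma eMat_trace (a : Fin 2) : (eMat a).trace = 0 := by
  simp only [Matrix.trace, Matrix.diag_apply, Fin.sum_univ_three, eMat, Matrix.of_apply,
    ← copy_add, e_trace, copy_zero]

lemma eMat_comm (a : Fin 2) (i j k l : Fin 3) : eMat a i j * eMat a k l =
    eMat a k l * eMat a i j + ((if j = k then eMat a i l else 0)
      - (if l = i then eMat a k j else 0)) := by
  rw [← sub_eq_iff_eq_add']
  simp only [eMat, Matrix.of_apply, copy_mul_copy_sub, e_lie, copy_sub]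
  congr 1 <;> split_ifs <;> simp [copy_zero]

/-- Transposing a product of matrices with noncommuting entries also reverses the factors. Putting
them back costs a commutator for each of the three middle indices, hence `3`; its diagonal part is
the trace, which is zero. -/
lemma eMat_transpose_mul (a : Fin 2) : (eMat a).transpose * (eMat a).transpose =
    (eMat a * eMat a - (3 : ℂ) • eMat a).transpose := by
  ext i j
  have h : ∀ k, eMat a k i * eMat a j k = eMat a j k * eMat a k i
      + ((if i = j then eMat a k k else 0) - eMat a j i) := fun k => by
    rw [eMat_comm]; simp
  have ht := eMat_trace a
  simp only [Matrix.trace, Matrix.diag_apply] at ht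
  simp only [Matrix.mul_apply, Matrix.transpose_apply, Matrix.sub_apply, Matrix.smul_apply, h,
    Finset.sum_add_distrib, Finset.sum_sub_distrib]
  split_ifs with hij
  · rw [ht]
    simp [ofNat_smul_eq_nsmul, sub_eq_add_neg]
  · simp [ofNat_smul_eq_nsmul, sub_eq_add_neg]

lemma trace_transpose_mul {R : Type*} [Ring R] (A B : Matrix (Fin 3) (Fin 3) R) :
    (A.transpose * B.transpose).trace = (A * B).trace := by
  simp only [Matrix.trace, Matrix.diag_apply, Matrix.mul_apply, Matrix.transpose_apply]
  exact Finset.sum_comm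

lemma trace_mul_comm_of_commute {R : Type*} [Ring R] {A B : Matrix (Fin 3) (Fin 3) R}
    (h : ∀ i j k l, Commute (A i j) (B k l)) : (A * B).trace = (B * A).trace := by
  simp only [Matrix.trace, Matrix.diag_apply, Matrix.mul_apply]
  rw [Finset.sum_comm]
  exact Finset.sum_congr rfl fun i _ => Finset.sum_congr rfl fun j _ => h _ _ _ _

/-- The entry of `B` moves past the last entry of `A`, and the two entries of `A` keep their order.
In that order the indices are chained as in a product of transposes, to which `eMat_transpose_mul`
applies. -/
lemma trace_mul_mul_of_commute {R : Type*} [Ring R] {A B : Matrix (Fin 3) (Fin 3) R}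
    (h : ∀ i j k l, Commute (A i j) (B k l)) :
    (A * B * A).trace = (A.transpose * A.transpose * B.transpose).trace := by
  simp only [Matrix.trace, Matrix.diag_apply, Matrix.mul_apply, Matrix.transpose_apply,
    Finset.sum_mul]
  have e1 : ∀ i j k, A i k * B k j * A j i = A i k * A j i * B k j := fun i j k => by
    rw [mul_assoc, ← (h j i k j).eq, ← mul_assoc]
  simp only [e1]
  rw [Finset.sum_comm, Finset.sum_congr rfl fun j _ => Finset.sum_comm, Finset.sum_comm]

/-- The diagonal matrix `(e_{pq}^{(1)} + e_{pq}^{(2)})`. -/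
def diagMat : Matrix (Fin 3) (Fin 3) (U ⊗[ℂ] U) := eMat 0 + eMat 1

lemma diagMat_apply (i j : Fin 3) : diagMat i j = diag (e i j) := rfl

/-- The mixed quadratic trace. -/
def mixedQuad : U ⊗[ℂ] U := (eMat 0 * eMat 1).trace

/-- The mixed cubic trace. -/
def mixedCubic : U ⊗[ℂ] U := (eMat 0 * eMat 0 * eMat 1).trace

/-- The mixed quartic trace. -/
def mixedQuartic : U ⊗[ℂ] U := (eMat 0 * eMat 0 * (eMat 1 * eMat 1)).trace

lemma eMat_commute (i j k l : Fin 3) : Commute (eMat 0 i j) (eMat 1 k l) := copy_commute _ _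

lemma trace_diagMat_sq : (diagMat * diagMat).trace =
    (eMat 0 * eMat 0).trace + (eMat 1 * eMat 1).trace + (2 : ℂ) • mixedQuad := by
  simp only [diagMat, mixedQuad, add_mul, mul_add, Matrix.trace_add]
  rw [← trace_mul_comm_of_commute eMat_commute, two_smul]
  abel

lemma trace_eMat_zero_one_zero : (eMat 0 * eMat 1 * eMat 0).trace =
    mixedCubic - (3 : ℂ) • mixedQuad := by
  rw [trace_mul_mul_of_commute eMat_commute, eMat_transpose_mul, trace_transpose_mul, sub_mul,
    Matrix.trace_sub, smul_mul_assoc, Matrix.trace_smul, mixedCubic, mixedQuad]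

lemma trace_eMat_one_zero_one : (eMat 1 * eMat 0 * eMat 1).trace =
    (eMat 0 * (eMat 1 * eMat 1)).trace - (3 : ℂ) • mixedQuad := by
  rw [trace_mul_mul_of_commute fun i j k l => (eMat_commute k l i j).symm, eMat_transpose_mul,
    trace_transpose_mul, sub_mul, Matrix.trace_sub, smul_mul_assoc, Matrix.trace_smul, mixedQuad,
    trace_mul_comm_of_commute eMat_commute,
    trace_mul_comm_of_commute (A := eMat 0) (B := eMat 1 * eMat 1)]
  intro i j k l
  rw [Matrix.mul_apply]
  exact Commute.sum_right _ _ _ fun m _ => (eMat_commute _ _ _ _).mul_right (eMat_commute _ _ _ _)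

/-- Of the eight words in the expansion, those of types `010` and `101` cannot be brought to
standard form by commuting the two copies alone. Each costs `3` times `mixedQuad`, hence the `6`. -/
lemma trace_diagMat_cube : (diagMat * diagMat * diagMat).trace =
    (eMat 0 * eMat 0 * eMat 0).trace + (eMat 1 * eMat 1 * eMat 1).trace
      + (3 : ℂ) • (mixedCubic + (eMat 0 * (eMat 1 * eMat 1)).trace) - (6 : ℂ) • mixedQuad := by
  have h1 : (eMat 1 * eMat 0 * eMat 0).trace = mixedCubic := by
    rw [mul_assoc, ← trace_mul_comm_of_commute, mixedCubic]
    intro i j k l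
    rw [Matrix.mul_apply]
    exact Commute.sum_left _ _ _ fun m _ => (eMat_commute _ _ _ _).mul_left (eMat_commute _ _ _ _)
  have h2 : (eMat 1 * eMat 1 * eMat 0).trace = (eMat 0 * (eMat 1 * eMat 1)).trace := by
    rw [← trace_mul_comm_of_commute]
    intro i j k l
    rw [Matrix.mul_apply]
    exact Commute.sum_right _ _ _ fun m _ =>
      (eMat_commute _ _ _ _).mul_right (eMat_commute _ _ _ _)
  have h3 := trace_eMat_zero_one_zero
  have h4 := trace_eMat_one_zero_one
  have h5 : (eMat 0 * eMat 0 * eMat 1).trace = mixedCubic := rfl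
  simp only [diagMat, add_mul, mul_add, Matrix.trace_add, h1, h2, h3, h4, h5,
    mul_assoc (eMat 0) (eMat 1) (eMat 1)]
  module

lemma T_pair (a b : Fin 2) : T [a, b] = (eMat a * eMat b).trace := by
  simp [T, trace_transpose_mul]

lemma T_triple (a b : Fin 2) : T [a, a, b] =
    (eMat a * eMat a * eMat b).trace - (3 : ℂ) • (eMat a * eMat b).trace := by
  simp only [T, List.map_cons, List.map_nil, List.prod_cons, List.prod_nil, mul_one]
  rw [← mul_assoc, eMat_transpose_mul, trace_transpose_mul, sub_mul, Matrix.trace_sub,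
    smul_mul_assoc, Matrix.trace_smul]

lemma T_triple' : T [0, 1, 1] =
    (eMat 0 * (eMat 1 * eMat 1)).trace - (3 : ℂ) • mixedQuad := by
  simp only [T, List.map_cons, List.map_nil, List.prod_cons, List.prod_nil, mul_one]
  rw [eMat_transpose_mul, trace_transpose_mul, mul_sub, Matrix.trace_sub,
    mul_smul_comm, Matrix.trace_smul, mixedQuad]

lemma T_quartic : T [0, 0, 1, 1] = mixedQuartic
    - (3 : ℂ) • (mixedCubic + (eMat 0 * (eMat 1 * eMat 1)).trace) + (9 : ℂ) • mixedQuad := by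
  simp only [T, List.map_cons, List.map_nil, List.prod_cons, List.prod_nil, mul_one]
  rw [eMat_transpose_mul, ← mul_assoc, eMat_transpose_mul, trace_transpose_mul]
  simp only [sub_mul, mul_sub, Matrix.trace_sub, smul_mul_assoc, mul_smul_comm, Matrix.trace_smul,
    mixedQuartic, mixedCubic, mixedQuad]
  module

lemma Tbar_quartic : Tbar [0, 0, 1, 1] = mixedQuartic := by
  simp [Tbar, mixedQuartic, mul_assoc]

lemma cubicCasimir_eq (a : Fin 2) : cubicCasimir a =
    (eMat a * eMat a * eMat a).trace - (3 / 2 : ℂ) • (eMat a * eMat a).trace := by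
  have : Tbar [a, a, a] = (eMat a * eMat a * eMat a).trace := by simp [Tbar, mul_assoc]
  rw [cubicCasimir, this, T_triple]
  module

/-- `X` differs from the mixed cubic trace by a combination of Casimir elements. -/
lemma X_eq : X = mixedCubic
    - (1 / 6 : ℂ) • ((diagMat * diagMat * diagMat).trace - (eMat 0 * eMat 0 * eMat 0).trace
      - (eMat 1 * eMat 1 * eMat 1).trace + (6 : ℂ) • mixedQuad)
    + (1 / 3 : ℂ) • ((eMat 0 * eMat 0 * eMat 0).trace - (eMat 1 * eMat 1 * eMat 1).trace
      - (3 / 2 : ℂ) • ((eMat 0 * eMat 0).trace - (eMat 1 * eMat 1).trace)) := by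
  have h5 : (eMat 0 * eMat 0 * eMat 1).trace = mixedCubic := rfl
  have h6 : (eMat 0 * eMat 1).trace = mixedQuad := rfl
  rw [X, T_triple, T_triple', cubicCasimir_eq, cubicCasimir_eq, trace_diagMat_cube, h5, h6]
  module

/-- `Y` differs from the mixed quartic trace by a polynomial in the Casimir elements. -/
lemma Y_eq : Y = mixedQuartic
    - (1 / 2 : ℂ) • ((diagMat * diagMat * diagMat).trace - (eMat 0 * eMat 0 * eMat 0).trace
      - (eMat 1 * eMat 1 * eMat 1).trace + (6 : ℂ) • mixedQuad)
    + (5 / 2 : ℂ) • mixedQuad - (1 / 12 : ℂ) • (mixedQuad * mixedQuad)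
    - (5 / 12 : ℂ) • ((eMat 0 * eMat 0).trace * (eMat 1 * eMat 1).trace) := by
  have h6 : (eMat 0 * eMat 1).trace = mixedQuad := rfl
  rw [Y, T_quartic, Tbar_quartic, T_pair, T_pair, T_pair, trace_diagMat_cube, h6, sq]
  module

/-! ### Casimir elements on highest weight vectors -/

section Casimir

variable {W : Type*} [AddCommGroup W] [Module ℂ W]

/-- The operators satisfy the commutation relations of the matrix units. -/
def IsMatrixUnits (E : Fin 3 → Fin 3 → Module.End ℂ W) : Prop :=
  ∀ i j k l, E i j * E k l = E k l * E i j + ((if j = k then E i l else 0)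
    - (if l = i then E k j else 0))

/-- `w` is a highest weight vector; the eigenvalues of the `E i i` are the `l i`. -/
structure IsHighest (E : Fin 3 → Fin 3 → Module.End ℂ W) (l : Fin 3 → ℂ) (w : W) : Prop where
  raise : ∀ i j, i < j → E i j w = 0
  weight : ∀ i, E i i w = l i • w

variable {E : Fin 3 → Fin 3 → Module.End ℂ W} {l : Fin 3 → ℂ} {w : W}

lemma IsMatrixUnits.apply (hE : IsMatrixUnits E) (i j k l : Fin 3) (w : W) :
    E i j (E k l w) = E k l (E i j w) + ((if j = k then E i l w else 0)
      - (if l = i then E k j w else 0)) := by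
  have := congrArg (fun f : Module.End ℂ W => f w) (hE i j k l)
  simp only [Module.End.mul_apply, LinearMap.add_apply, LinearMap.sub_apply] at this
  rw [this]
  split_ifs <;> simp

lemma sqEntry_apply (E : Fin 3 → Fin 3 → Module.End ℂ W) (i j : Fin 3) (w : W) :
    sqEntry E i j w = E i 0 (E 0 j w) + E i 1 (E 1 j w) + E i 2 (E 2 j w) := by
  simp [sqEntry, Fin.sum_univ_three]

/-- The entries of the square of the matrix of units satisfy the same commutation rule with the
units as the units themselves. The centrality of the quadratic and cubic traces is deduced from it.
-/
lemma IsMatrixUnits.sqEntry_apply_apply (hE : IsMatrixUnits E) (i j k l : Fin 3) (w : W) :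
    sqEntry E i j (E k l w) = E k l (sqEntry E i j w) + ((if j = k then sqEntry E i l w else 0)
      - (if l = i then sqEntry E k j w else 0)) := by
  simp only [sqEntry_apply, map_add]
  rw [hE.apply 0 j k l, hE.apply 1 j k l, hE.apply 2 j k l]
  simp only [map_add, map_sub]
  rw [hE.apply i 0 k l, hE.apply i 1 k l, hE.apply i 2 k l]
  fin_cases k <;> fin_cases l <;> simp <;> split_ifs <;> (try simp) <;> abel

/-- For `k < i` the operator `E k i` raises and kills `w`. For `k > i` commuting `E i k` past `E k
i` leaves `l i - l k`. -/
lemma IsHighest.sqEntry_diag (hw : IsHighest E l w) (hE : IsMatrixUnits E) (i : Fin 3) :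
    sqEntry E i i w = sqEigenvalue l i • w := by
  have h01 := hw.raise 0 1 (by decide)
  have h02 := hw.raise 0 2 (by decide)
  have h12 := hw.raise 1 2 (by decide)
  have h := hw.weight
  rw [sqEntry_apply, sqEigenvalue]
  fin_cases i
  · simp only [Fin.zero_eta, h, map_smul, hE.apply 0 1 1 0, hE.apply 0 2 2 0, h01, h02]
    simp [Fin.sum_univ_three, h]; module
  · simp only [Fin.mk_one, h, map_smul, hE.apply 1 2 2 1, h01, h12]
    simp [Fin.sum_univ_three, h]; module
  · simp only [Fin.reduceFinMk, h, map_smul, h02, h12]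
    simp [Fin.sum_univ_three, h]; module

lemma IsHighest.sqEntry_raise (hw : IsHighest E l w) (hE : IsMatrixUnits E) {i j : Fin 3}
    (hij : i < j) : sqEntry E i j w = 0 := by
  have h01 := hw.raise 0 1 (by decide)
  have h02 := hw.raise 0 2 (by decide)
  have h12 := hw.raise 1 2 (by decide)
  have h := hw.weight
  rw [sqEntry_apply]
  fin_cases i <;> fin_cases j <;> simp at hij ⊢
  · simp [h, h01, hE.apply 0 2 2 1, h02]
  · simp [h, h02, h12]
  · simp [h, h02, h12]

lemma IsHighest.quad (hw : IsHighest E l w) (hE : IsMatrixUnits E) :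
    ∑ i, sqEntry E i i w = quadEigenvalue l • w := by
  simp only [hw.sqEntry_diag hE, ← Finset.sum_smul]
  congr 1
  simp [sqEigenvalue, quadEigenvalue, Fin.sum_univ_three]
  ring

lemma IsHighest.cubic (hw : IsHighest E l w) (hE : IsMatrixUnits E) :
    ∑ i, ∑ j, sqEntry E i j (E j i w) = cubicEigenvalue l • w := by
  have h01 := hw.raise 0 1 (by decide)
  have h02 := hw.raise 0 2 (by decide)
  have h12 := hw.raise 1 2 (by decide)
  simp only [Fin.sum_univ_three, h01, h02, h12, hw.weight, map_smul, map_zero, hw.sqEntry_diag hE,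
    hE.sqEntry_apply_apply 0 1 1 0, hE.sqEntry_apply_apply 0 2 2 0,
    hE.sqEntry_apply_apply 1 2 2 1, hw.sqEntry_raise hE (show (0 : Fin 3) < 1 by decide),
    hw.sqEntry_raise hE (show (0 : Fin 3) < 2 by decide),
    hw.sqEntry_raise hE (show (1 : Fin 3) < 2 by decide)]
  simp [hw.sqEntry_diag hE, cubicEigenvalue, Fin.sum_univ_three]
  module

end Casimir

/-! ### Modules over `sl3` -/

lemma sl3_eq_sum (x : sl3) : x = ∑ i, ∑ j, x.1 i j • e i j := by
  have ht : Matrix.trace x.1 = 0 := x.2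
  rw [Matrix.trace_fin_three] at ht
  have hv : ∀ f : Fin 3 → Fin 3 → sl3, (∑ i, ∑ j, f i j).1 = ∑ i, ∑ j, (f i j).1 := by
    intro f
    let g : sl3 →+ Matrix (Fin 3) (Fin 3) ℂ := AddMonoidHom.mk' (fun y => y.1) fun _ _ => rfl
    have hg : ∀ y, y.1 = g y := fun _ => rfl
    simp only [hg, map_sum]
  have hs : ∀ (c : ℂ) (y : sl3), (c • y).1 = c • y.1 := fun _ _ => rfl
  apply Subtype.ext
  rw [hv]
  ext i j
  simp only [hs, Fin.sum_univ_three, e]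
  fin_cases i <;> fin_cases j <;> simp [Matrix.single_apply] <;> linear_combination (1 / 3) * ht

section

variable {V : Type*} [AddCommGroup V] [Module ℂ V] [LieRingModule sl3 V] [LieModule ℂ sl3 V]

/-- A subspace which is stable under the generators is a Lie submodule. -/
def lieSubmoduleOfStable (N : Submodule ℂ V) (hN : ∀ i j, ∀ v ∈ N, ⁅e i j, v⁆ ∈ N) :
    LieSubmodule ℂ sl3 V where
  __ := N
  lie_mem := by
    intro x v hv
    rw [sl3_eq_sum x]
    simp only [sum_lie, smul_lie]
    exact N.sum_mem fun i _ => N.sum_mem fun j _ => N.smul_mem _ (hN i j v hv)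

variable (V) in
/-- The operators by which the generators act. -/
def units (i j : Fin 3) : Module.End ℂ V := LieModule.toEnd ℂ sl3 V (e i j)

lemma units_apply (i j : Fin 3) (v : V) : units V i j v = ⁅e i j, v⁆ := rfl

lemma isMatrixUnits_units : IsMatrixUnits (units V) := by
  intro i j k l
  apply LinearMap.ext
  intro v
  have := leibniz_lie (e i j) (e k l) v
  rw [e_lie, sub_lie] at this
  simp only [Module.End.mul_apply, LinearMap.add_apply, LinearMap.sub_apply, units_apply, this]
  rw [add_comm]
  congr 2 <;> split_ifs <;> simp [units_apply]

lemma e_zero_eq : e 0 0 = (2 / 3 : ℂ) • h 0 + (1 / 3 : ℂ) • h 1 := by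
  have := e_trace
  have h2 : e 2 2 = -e 0 0 - e 1 1 := by rw [← sub_eq_zero, ← this]; abel
  simp only [h, Fin.castSucc_zero, Fin.succ_zero_eq_one, Fin.castSucc_one, Fin.succ_one_eq_two, h2]
  module

lemma e_one_eq : e 1 1 = (-1 / 3 : ℂ) • h 0 + (1 / 3 : ℂ) • h 1 := by
  have := e_trace
  have h2 : e 2 2 = -e 0 0 - e 1 1 := by rw [← sub_eq_zero, ← this]; abel
  simp only [h, Fin.castSucc_zero, Fin.succ_zero_eq_one, Fin.castSucc_one, Fin.succ_one_eq_two, h2]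
  module

lemma e_two_eq : e 2 2 = (-1 / 3 : ℂ) • h 0 + (-2 / 3 : ℂ) • h 1 := by
  have := e_trace
  have h2 : e 2 2 = -e 0 0 - e 1 1 := by rw [← sub_eq_zero, ← this]; abel
  simp only [h, Fin.castSucc_zero, Fin.succ_zero_eq_one, Fin.castSucc_one, Fin.succ_one_eq_two, h2]
  module

/-- Eigenvectors of the `h k` are eigenvectors of the `e i i`. -/
lemma diag_eigenvector {W : Type*} [AddCommGroup W] [Module ℂ W] (f : sl3 →ₗ[ℂ] Module.End ℂ W)
    {w : W} {p q : ℂ} (h0 : f (h 0) w = p • w) (h1 : f (h 1) w = q • w) (i : Fin 3) :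
    f (e i i) w = diagWeight p q i • w := by
  fin_cases i
  · simp [e_zero_eq, h0, h1, diagWeight]; module
  · simp [e_one_eq, h0, h1, diagWeight]; module
  · simp [e_two_eq, h0, h1, diagWeight]; module

lemma IsIrrep.exists_isHighest {p q : ℚ} (hV : IsIrrep p q V) : ∃ v : V, v ≠ 0 ∧
    IsHighest (units V) (diagWeight ((p : ℂ) - 1) ((q : ℂ) - 1)) v := by
  obtain ⟨v, hv, h1, h2, h3⟩ := hV.exists_highestWeight
  let f : sl3 →ₗ[ℂ] Module.End ℂ V :=
    { toFun := fun x => LieModule.toEnd ℂ sl3 V x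
      map_add' := fun x y => by ext; simp
      map_smul' := fun c x => by ext; simp }
  exact ⟨v, hv, h1, diag_eigenvector f h2 h3⟩

/-- An operator which commutes with the action is determined by its value at a nonzero vector. -/
lemma eq_smul_of_irreducible [LieModule.IsIrreducible ℂ sl3 V] {Z : Module.End ℂ V}
    (hZ : ∀ i j v, Z (units V i j v) = units V i j (Z v)) {c : ℂ} {v : V} (hv : v ≠ 0)
    (hc : Z v = c • v) (w : V) : Z w = c • w := by
  let N := lieSubmoduleOfStable (LinearMap.ker (Z - c • LinearMap.id)) (by
    intro i j u hu
    rw [LinearMap.mem_ker, LinearMap.sub_apply, sub_eq_zero] at hu ⊢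
    rw [← units_apply, hZ, hu]
    simp)
  have hN : N = ⊤ := (IsSimpleOrder.eq_bot_or_eq_top N).resolve_left fun hb => hv <| by
    have : v ∈ N := by
      change Z v - c • v = 0
      rw [hc, sub_self]
    rwa [hb, LieSubmodule.mem_bot] at this
  have : w ∈ N := by rw [hN]; exact LieSubmodule.mem_top w
  exact sub_eq_zero.1 this

lemma IsMatrixUnits.quad_commute {W : Type*} [AddCommGroup W] [Module ℂ W]
    {E : Fin 3 → Fin 3 → Module.End ℂ W} (hE : IsMatrixUnits E) (k l : Fin 3) (v : W) :
    ∑ i, sqEntry E i i (E k l v) = E k l (∑ i, sqEntry E i i v) := by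
  simp only [hE.sqEntry_apply_apply, Fin.sum_univ_three, map_add]
  fin_cases k <;> fin_cases l <;> simp <;> abel

lemma IsMatrixUnits.cubic_commute {W : Type*} [AddCommGroup W] [Module ℂ W]
    {E : Fin 3 → Fin 3 → Module.End ℂ W} (hE : IsMatrixUnits E) (k l : Fin 3) (v : W) :
    ∑ i, ∑ j, sqEntry E i j (E j i (E k l v)) = E k l (∑ i, ∑ j, sqEntry E i j (E j i v)) := by
  have h1 : ∀ i j, sqEntry E i j (E j i (E k l v)) = E k l (sqEntry E i j (E j i v))
      + ((if j = k then sqEntry E i l (E j i v) else 0)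
        - (if l = i then sqEntry E k j (E j i v) else 0))
      + ((if i = k then sqEntry E i j (E j l v) else 0)
        - (if l = j then sqEntry E i j (E k i v) else 0)) := by
    intro i j
    rw [hE.apply j i k l, map_add, map_sub, hE.sqEntry_apply_apply]
    congr 2 <;> split_ifs <;> simp
  simp only [h1, Fin.sum_univ_three, map_add]
  fin_cases k <;> fin_cases l <;> simp <;> abel

lemma IsIrrep.quad {p q : ℚ} (hV : IsIrrep p q V) (v : V) :
    ∑ i, sqEntry (units V) i i v = quadEigenvalue (diagWeight ((p : ℂ) - 1) ((q : ℂ) - 1)) • v := by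
  have := hV.irreducible
  obtain ⟨v₀, hv₀, hh⟩ := hV.exists_isHighest
  have := eq_smul_of_irreducible (Z := ∑ i, sqEntry (units V) i i)
    (fun i j v => by simpa using isMatrixUnits_units.quad_commute i j v) hv₀
    (by simpa using hh.quad isMatrixUnits_units) v
  simpa using this

lemma IsIrrep.cubic {p q : ℚ} (hV : IsIrrep p q V) (v : V) :
    ∑ i, ∑ j, sqEntry (units V) i j (units V j i v) =
      cubicEigenvalue (diagWeight ((p : ℂ) - 1) ((q : ℂ) - 1)) • v := by
  have := hV.irreducible
  obtain ⟨v₀, hv₀, hh⟩ := hV.exists_isHighest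
  have := eq_smul_of_irreducible (Z := ∑ i, ∑ j, sqEntry (units V) i j * units V j i)
    (fun i j v => by simpa using isMatrixUnits_units.cubic_commute i j v) hv₀
    (by simpa using hh.cubic isMatrixUnits_units) v
  simpa using this

end

/-! ### The action on tensor products -/

section

variable {V V' : Type*} [AddCommGroup V] [Module ℂ V] [LieRingModule sl3 V] [LieModule ℂ sl3 V]
  [AddCommGroup V'] [Module ℂ V'] [LieRingModule sl3 V'] [LieModule ℂ sl3 V']

@[simp] lemma act_copy_zero_tmul (x : sl3) (v : V) (v' : V') :
    act V V' (copy 0 x) (v ⊗ₜ v') = ⁅x, v⁆ ⊗ₜ v' := by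
  simp [act, copy, Module.endTensorEndAlgHom_apply]

@[simp] lemma act_copy_one_tmul (x : sl3) (v : V) (v' : V') :
    act V V' (copy 1 x) (v ⊗ₜ v') = v ⊗ₜ ⁅x, v'⁆ := by
  simp [act, copy, Module.endTensorEndAlgHom_apply]

variable (V V') in
/-- The operators by which the generators of the copy number `a` act. -/
def copyUnits (a : Fin 2) (i j : Fin 3) : Module.End ℂ (V ⊗[ℂ] V') := act V V' (eMat a i j)

lemma isMatrixUnits_copyUnits (a : Fin 2) : IsMatrixUnits (copyUnits V V' a) := by
  intro i j k l
  simp only [copyUnits, ← map_mul]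
  rw [eMat_comm, map_add, map_sub]
  congr 2 <;> split_ifs <;> simp

lemma copyUnits_comm (i j k l : Fin 3) (w : V ⊗[ℂ] V') :
    copyUnits V V' 0 i j (copyUnits V V' 1 k l w) =
        copyUnits V V' 1 k l (copyUnits V V' 0 i j w) := by
  have := congrArg (fun Z => act V V' Z w) (eMat_commute i j k l).eq
  simp only [map_mul, Module.End.mul_apply] at this
  exact this

lemma act_eMat_sq (a : Fin 2) (i j : Fin 3) (w : V ⊗[ℂ] V') :
    act V V' ((eMat a * eMat a) i j) w = sqEntry (copyUnits V V' a) i j w := by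
  simp [Matrix.mul_apply, sqEntry, copyUnits]

lemma sqEntry_copyUnits_zero_tmul (i j : Fin 3) (v : V) (v' : V') :
    sqEntry (copyUnits V V' 0) i j (v ⊗ₜ v') = sqEntry (units V) i j v ⊗ₜ v' := by
  simp [sqEntry, copyUnits, eMat, units, TensorProduct.sum_tmul]

lemma sqEntry_copyUnits_one_tmul (i j : Fin 3) (v : V) (v' : V') :
    sqEntry (copyUnits V V' 1) i j (v ⊗ₜ v') = v ⊗ₜ sqEntry (units V') i j v' := by
  simp [sqEntry, copyUnits, eMat, units, TensorProduct.tmul_sum]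

lemma act_trace_sq (a : Fin 2) (w : V ⊗[ℂ] V') :
    act V V' (eMat a * eMat a).trace w = ∑ i, sqEntry (copyUnits V V' a) i i w := by
  simp [Matrix.trace, act_eMat_sq]

lemma act_trace_cube (a : Fin 2) (w : V ⊗[ℂ] V') :
    act V V' (eMat a * eMat a * eMat a).trace w =
      ∑ i, ∑ j, sqEntry (copyUnits V V' a) i j (copyUnits V V' a j i w) := by
  simp [Matrix.trace, Matrix.mul_apply (M := eMat a * eMat a), act_eMat_sq, copyUnits]

lemma act_quad_zero {p q : ℚ} (hV : IsIrrep p q V) (w : V ⊗[ℂ] V') :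
    act V V' (eMat 0 * eMat 0).trace w =
      quadEigenvalue (diagWeight ((p : ℂ) - 1) ((q : ℂ) - 1)) • w := by
  rw [act_trace_sq]
  induction w with
  | zero => simp
  | add x y hx hy => simp only [map_add, Finset.sum_add_distrib, hx, hy, smul_add]
  | tmul v v' =>
    simp only [sqEntry_copyUnits_zero_tmul, ← TensorProduct.sum_tmul, hV.quad,
      TensorProduct.smul_tmul']

lemma act_quad_one {p q : ℚ} (hV : IsIrrep p q V') (w : V ⊗[ℂ] V') :
    act V V' (eMat 1 * eMat 1).trace w =
      quadEigenvalue (diagWeight ((p : ℂ) - 1) ((q : ℂ) - 1)) • w := by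
  rw [act_trace_sq]
  induction w with
  | zero => simp
  | add x y hx hy => simp only [map_add, Finset.sum_add_distrib, hx, hy, smul_add]
  | tmul v v' =>
    simp only [sqEntry_copyUnits_one_tmul, ← TensorProduct.tmul_sum, hV.quad,
      TensorProduct.tmul_smul]

lemma act_cubic_zero {p q : ℚ} (hV : IsIrrep p q V) (w : V ⊗[ℂ] V') :
    act V V' (eMat 0 * eMat 0 * eMat 0).trace w =
      cubicEigenvalue (diagWeight ((p : ℂ) - 1) ((q : ℂ) - 1)) • w := by
  rw [act_trace_cube]
  induction w with
  | zero => simp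
  | add x y hx hy => simp only [map_add, Finset.sum_add_distrib, hx, hy, smul_add]
  | tmul v v' =>
    have h1 : ∀ i j, copyUnits V V' 0 i j (v ⊗ₜ v') = units V i j v ⊗ₜ v' := fun i j => by
      simp [copyUnits, eMat, units]
    simp only [h1, sqEntry_copyUnits_zero_tmul, ← TensorProduct.sum_tmul, hV.cubic,
      TensorProduct.smul_tmul']

lemma act_cubic_one {p q : ℚ} (hV : IsIrrep p q V') (w : V ⊗[ℂ] V') :
    act V V' (eMat 1 * eMat 1 * eMat 1).trace w =
      cubicEigenvalue (diagWeight ((p : ℂ) - 1) ((q : ℂ) - 1)) • w := by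
  rw [act_trace_cube]
  induction w with
  | zero => simp
  | add x y hx hy => simp only [map_add, Finset.sum_add_distrib, hx, hy, smul_add]
  | tmul v v' =>
    have h1 : ∀ i j, copyUnits V V' 1 i j (v ⊗ₜ v') = v ⊗ₜ units V' i j v' := fun i j => by
      simp [copyUnits, eMat, units]
    simp only [h1, sqEntry_copyUnits_one_tmul, ← TensorProduct.tmul_sum, hV.cubic,
      TensorProduct.tmul_smul]

variable (V V') in
/-- The operators by which the generators act diagonally. -/
def diagUnits (i j : Fin 3) : Module.End ℂ (V ⊗[ℂ] V') := act V V' (diag (e i j))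

lemma diagUnits_apply (i j : Fin 3) (w : V ⊗[ℂ] V') :
    diagUnits V V' i j w = copyUnits V V' 0 i j w + copyUnits V V' 1 i j w := by
  simp [diagUnits, diag, copyUnits, eMat]

lemma isMatrixUnits_diagUnits : IsMatrixUnits (diagUnits V V') := by
  intro i j k l
  have h0 := isMatrixUnits_copyUnits (V := V) (V' := V') 0
  have h1 := isMatrixUnits_copyUnits (V := V) (V' := V') 1
  apply LinearMap.ext
  intro w
  simp only [Module.End.mul_apply, LinearMap.add_apply, LinearMap.sub_apply, diagUnits_apply,
    map_add]
  rw [h0.apply, h1.apply, copyUnits_comm, ← copyUnits_comm k l i j]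
  split_ifs <;> simp [diagUnits_apply] <;> abel

lemma act_diagMat_sq (i j : Fin 3) (w : V ⊗[ℂ] V') :
    act V V' ((diagMat * diagMat) i j) w = sqEntry (diagUnits V V') i j w := by
  simp [Matrix.mul_apply, sqEntry, diagUnits, diagMat_apply]

lemma isHighest_of_mem {p q : ℚ} {w : V ⊗[ℂ] V'} (hw : w ∈ multSpace V V' p q) :
    IsHighest (diagUnits V V') (diagWeight ((p : ℂ) - 1) ((q : ℂ) - 1)) w := by
  obtain ⟨h1, h2, h3⟩ := hw
  let f : sl3 →ₗ[ℂ] Module.End ℂ (V ⊗[ℂ] V') :=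
    { toFun := fun x => act V V' (diag x)
      map_add' := fun x y => by
        rw [← map_add]; congr 1; simp only [diag, copy_add]; abel
      map_smul' := fun c x => by
        rw [RingHom.id_apply, ← map_smul]
        congr 1
        simp [diag, copy, TensorProduct.smul_tmul'] }
  exact ⟨h1, diag_eigenvector f h2 h3⟩

lemma mem_multSpace_of_isHighest {p q : ℚ} {w : V ⊗[ℂ] V'}
    (hw : IsHighest (diagUnits V V') (diagWeight ((p : ℂ) - 1) ((q : ℂ) - 1)) w) :
    w ∈ multSpace V V' p q := by
  refine ⟨hw.raise, ?_, ?_⟩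
  · rw [h, diag_sub, map_sub, LinearMap.sub_apply]
    refine (congrArg₂ (· - ·) (hw.weight 0) (hw.weight 1)).trans ?_
    rw [← sub_smul]; congr 1; simp [diagWeight]; ring
  · rw [h, diag_sub, map_sub, LinearMap.sub_apply]
    refine (congrArg₂ (· - ·) (hw.weight 1) (hw.weight 2)).trans ?_
    rw [← sub_smul]; congr 1; simp [diagWeight]; ring

lemma IsHighest.act_diag_quad {n : Fin 3 → ℂ} {w : V ⊗[ℂ] V'} (hw :
    IsHighest (diagUnits V V') n w) :
    act V V' (diagMat * diagMat).trace w = quadEigenvalue n • w := by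
  rw [← hw.quad isMatrixUnits_diagUnits]
  simp [Matrix.trace, act_diagMat_sq]

lemma IsHighest.act_diag_cubic {n : Fin 3 → ℂ} {w : V ⊗[ℂ] V'} (hw :
    IsHighest (diagUnits V V') n w) :
    act V V' (diagMat * diagMat * diagMat).trace w = cubicEigenvalue n • w := by
  rw [← hw.cubic isMatrixUnits_diagUnits]
  simp [Matrix.trace, Matrix.mul_apply (M := diagMat * diagMat), act_diagMat_sq, diagUnits,
    diagMat_apply]

variable {p q p' q' : ℚ} {l l' n : Fin 3 → ℂ}

/-- Polarisation: the diagonal quadratic Casimir is the sum of the two partial ones and of twice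
`mixedQuad`, and all three act by scalars on `w`. -/
lemma act_mixedQuad (hV : IsIrrep p q V) (hV' : IsIrrep p' q' V')
    (hl : l = diagWeight ((p : ℂ) - 1) ((q : ℂ) - 1))
    (hl' : l' = diagWeight ((p' : ℂ) - 1) ((q' : ℂ) - 1))
    {w : V ⊗[ℂ] V'} (hw : IsHighest (diagUnits V V') n w) :
    act V V' mixedQuad w = mixedEigenvalue l l' n • w := by
  have h1 := hw.act_diag_quad
  rw [trace_diagMat_sq, map_add, map_add, map_smul, LinearMap.add_apply, LinearMap.add_apply,
    act_quad_zero hV, act_quad_one hV', LinearMap.smul_apply, ← hl, ← hl'] at h1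
  have h2 : act V V' mixedQuad w = (1 / 2 : ℂ) • ((2 : ℂ) • act V V' mixedQuad w) := by module
  rw [h2, eq_sub_iff_add_eq'.2 h1, mixedEigenvalue]
  module

/-- In `X_eq` every term except `mixedCubic` comes from Casimir elements of the two factors or of
the diagonal, and those are scalars on highest weight vectors. -/
lemma act_X (hV : IsIrrep p q V) (hV' : IsIrrep p' q' V')
    (hl : l = diagWeight ((p : ℂ) - 1) ((q : ℂ) - 1))
    (hl' : l' = diagWeight ((p' : ℂ) - 1) ((q' : ℂ) - 1))
    {w : V ⊗[ℂ] V'} (hw : IsHighest (diagUnits V V') n w) :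
    act V V' X w = act V V' mixedCubic w + xShift l l' n • w := by
  simp only [X_eq, map_add, map_sub, map_smul, LinearMap.add_apply, LinearMap.sub_apply,
    LinearMap.smul_apply, act_quad_zero hV, act_quad_one hV', act_cubic_zero hV,
    act_cubic_one hV', act_mixedQuad hV hV' hl hl' hw, hw.act_diag_cubic, ← hl, ← hl', xShift,
    mixedCubicEigenvalue]
  module

lemma act_Y (hV : IsIrrep p q V) (hV' : IsIrrep p' q' V')
    (hl : l = diagWeight ((p : ℂ) - 1) ((q : ℂ) - 1))
    (hl' : l' = diagWeight ((p' : ℂ) - 1) ((q' : ℂ) - 1))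
    {w : V ⊗[ℂ] V'} (hw : IsHighest (diagUnits V V') n w) :
    act V V' Y w = act V V' mixedQuartic w + yShift l l' n • w := by
  simp only [Y_eq, map_add, map_sub, map_smul, map_mul, LinearMap.add_apply, LinearMap.sub_apply,
    LinearMap.smul_apply, Module.End.mul_apply, act_quad_zero hV, act_quad_one hV',
    act_cubic_zero hV, act_cubic_one hV', act_mixedQuad hV hV' hl hl' hw, hw.act_diag_cubic,
    ← hl, ← hl', yShift, mixedCubicEigenvalue]
  module

/-- A functional which is an eigenvector of lowest weight `-l` in the dual space. -/
structure IsLowestFunctional (l : Fin 3 → ℂ) (φ : V' →ₗ[ℂ] ℂ) : Prop where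
  lower : ∀ i j, j < i → ∀ v, φ (units V' i j v) = 0
  weight : ∀ i v, φ (units V' i i v) = l i * φ v

variable (V) in
/-- Contraction of the second factor with a functional. -/
def contract (φ : V' →ₗ[ℂ] ℂ) : V ⊗[ℂ] V' →ₗ[ℂ] V :=
  (TensorProduct.rid ℂ V).toLinearMap ∘ₗ TensorProduct.map LinearMap.id φ

@[simp] lemma contract_tmul (φ : V' →ₗ[ℂ] ℂ) (v : V) (v' : V') :
    contract V φ (v ⊗ₜ v') = φ v' • v := by
  simp [contract]

lemma contract_copyUnits_zero (φ : V' →ₗ[ℂ] ℂ) (i j : Fin 3) (w : V ⊗[ℂ] V') :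
    contract V φ (copyUnits V V' 0 i j w) = units V i j (contract V φ w) := by
  induction w with
  | zero => simp
  | add x y hx hy => simp only [map_add, hx, hy]
  | tmul v v' => simp [copyUnits, eMat, units]

lemma contract_copyUnits_one (φ : V' →ₗ[ℂ] ℂ) (i j : Fin 3) (w : V ⊗[ℂ] V') :
    contract V φ (copyUnits V V' 1 i j w) = contract V (φ ∘ₗ units V' i j) w := by
  induction w with
  | zero => simp
  | add x y hx hy => simp only [map_add, hx, hy]
  | tmul v v' => simp [copyUnits, eMat, units]

lemma contract_sqEntry_zero (φ : V' →ₗ[ℂ] ℂ) (i j : Fin 3) (w : V ⊗[ℂ] V') :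
    contract V φ (sqEntry (copyUnits V V' 0) i j w) = sqEntry (units V) i j (contract V φ w) := by
  simp [sqEntry_apply, contract_copyUnits_zero]

variable {φ : V' →ₗ[ℂ] ℂ}

lemma IsLowestFunctional.contract_lower (hφ : IsLowestFunctional l φ) {i j : Fin 3} (hij : j < i)
    (w : V ⊗[ℂ] V') : contract V φ (copyUnits V V' 1 i j w) = 0 := by
  rw [contract_copyUnits_one, show φ ∘ₗ units V' i j = 0 from LinearMap.ext (hφ.lower i j hij)]
  simp [contract]

lemma IsLowestFunctional.contract_weight (hφ : IsLowestFunctional l φ) (i : Fin 3)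
    (w : V ⊗[ℂ] V') : contract V φ (copyUnits V V' 1 i i w) = l i • contract V φ w := by
  rw [contract_copyUnits_one,
    show φ ∘ₗ units V' i i = l i • φ from LinearMap.ext (hφ.weight i)]
  simp [contract, TensorProduct.map_smul_right]

lemma IsHighest.copyUnits_one {w : V ⊗[ℂ] V'} (hw : IsHighest (diagUnits V V') n w) {i j : Fin 3}
    (hij : i < j) : copyUnits V V' 1 i j w = -copyUnits V V' 0 i j w := by
  have := hw.raise i j hij
  rw [diagUnits_apply] at this
  exact (neg_eq_of_add_eq_zero_right this).symm

lemma IsHighest.contract_raise {w : V ⊗[ℂ] V'} (hw : IsHighest (diagUnits V V') n w)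
    (φ : V' →ₗ[ℂ] ℂ) {i j : Fin 3} (hij : i < j) :
    contract V φ (copyUnits V V' 1 i j w) = -units V i j (contract V φ w) := by
  rw [hw.copyUnits_one hij, map_neg, contract_copyUnits_zero]

/-- The units of the second copy are removed one by one: the functional kills the lowering ones and
turns the diagonal ones into scalars. The raising ones equal minus those of the first copy, because
`w` is a highest weight vector. -/
lemma contract_mixedCubic (hφ : IsLowestFunctional l φ) {w : V ⊗[ℂ] V'}
    (hw : IsHighest (diagUnits V V') n w) :
    contract V φ (act V V' mixedCubic w) = transportedCubic (units V) l (contract V φ w) := by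
  have h1 : act V V' mixedCubic w =
      ∑ i, ∑ j, sqEntry (copyUnits V V' 0) i j (copyUnits V V' 1 j i w) := by
    simp [mixedCubic, Matrix.trace, Matrix.mul_apply (M := eMat 0 * eMat 0), act_eMat_sq,
      copyUnits]
  rw [h1]
  simp only [map_sum, contract_sqEntry_zero]
  simp only [Fin.sum_univ_three, hφ.contract_weight,
    hφ.contract_lower (show (0 : Fin 3) < 1 by decide),
    hφ.contract_lower (show (0 : Fin 3) < 2 by decide),
    hφ.contract_lower (show (1 : Fin 3) < 2 by decide),
    hw.contract_raise φ (show (0 : Fin 3) < 1 by decide),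
    hw.contract_raise φ (show (0 : Fin 3) < 2 by decide),
    hw.contract_raise φ (show (1 : Fin 3) < 2 by decide)]
  simp [transportedCubic, Fin.sum_univ_three]
  abel

/-- In the sum over the middle index `k` the functional kills the terms with `k < j` and gives `l j`
for `k = j`. For `j < k` the raising unit `E j k` is commuted to the right, where it reaches the
highest weight vector and passes to the first copy. -/
lemma contract_sqEntry_one (hφ : IsLowestFunctional l φ) {w : V ⊗[ℂ] V'}
    (hw : IsHighest (diagUnits V V') n w) (j i : Fin 3) :
    contract V φ (sqEntry (copyUnits V V' 1) j i w) =
      l j • contract V φ (copyUnits V V' 1 j i w)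
      + ∑ k, if j < k then
          -units V j k (contract V φ (copyUnits V V' 1 k i w))
            + contract V φ (copyUnits V V' 1 j i w) - (if i = j then l k • contract V φ w else 0)
        else 0 := by
  have h := isMatrixUnits_copyUnits (V := V) (V' := V') 1
  have h1 : ∀ k, contract V φ (copyUnits V V' 1 j k (copyUnits V V' 1 k i w)) =
      (if j = k then l j • contract V φ (copyUnits V V' 1 j i w) else 0)
      + if j < k then
          -units V j k (contract V φ (copyUnits V V' 1 k i w))
            + contract V φ (copyUnits V V' 1 j i w) - (if i = j then l k • contract V φ w else 0)
        else 0 := by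
    intro k
    rcases lt_trichotomy j k with hjk | rfl | hjk
    · rw [h.apply, hw.copyUnits_one hjk, map_neg, ← copyUnits_comm]
      simp only [map_add, map_neg, map_sub, contract_copyUnits_zero, hjk, hjk.ne, if_true, if_false,
        zero_add]
      split_ifs <;> simp [hφ.contract_weight] <;> abel
    · simp [hφ.contract_weight]
    · rw [hφ.contract_lower hjk]
      simp [hjk.ne', hjk.not_gt]
  simp only [sqEntry, LinearMap.sum_apply, Module.End.mul_apply, map_sum, h1,
    Finset.sum_add_distrib, Finset.sum_ite_eq, Finset.mem_univ, if_true]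

lemma contract_mixedQuartic (hφ : IsLowestFunctional l φ) {w : V ⊗[ℂ] V'}
    (hw : IsHighest (diagUnits V V') n w) :
    contract V φ (act V V' mixedQuartic w) = transportedQuartic (units V) l (contract V φ w) := by
  have h1 : act V V' mixedQuartic w =
      ∑ i, ∑ j, sqEntry (copyUnits V V' 0) i j (sqEntry (copyUnits V V' 1) j i w) := by
    simp [mixedQuartic, Matrix.trace, Matrix.mul_apply (M := eMat 0 * eMat 0), act_eMat_sq]
  rw [h1]
  simp only [map_sum, contract_sqEntry_zero, contract_sqEntry_one hφ hw]
  simp only [Fin.sum_univ_three, hφ.contract_weight,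
    hφ.contract_lower (show (0 : Fin 3) < 1 by decide),
    hφ.contract_lower (show (0 : Fin 3) < 2 by decide),
    hφ.contract_lower (show (1 : Fin 3) < 2 by decide),
    hw.contract_raise φ (show (0 : Fin 3) < 1 by decide),
    hw.contract_raise φ (show (0 : Fin 3) < 2 by decide),
    hw.contract_raise φ (show (1 : Fin 3) < 2 by decide)]
  -- The double raising term appears as `E 0 1 * E 1 2`, while `transportedQuartic` is written with
  -- the opposite order. The commutator contributes to the term with `E 0 2`.
  have h3 := isMatrixUnits_units.apply 0 1 1 2 (contract V φ w)
  simp [transportedQuartic, sqEigenvalue, Fin.sum_univ_three] at h3 ⊢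
  rw [h3]
  simp only [map_add]
  module

end

/-! ### A model of the irreducible representations -/

/-- Polynomial functions on pairs of vectors. -/
abbrev Pol : Type := MvPolynomial (Fin 2 × Fin 3) ℂ

namespace Pol

/-- The coordinates of the first vector. -/
def x (i : Fin 3) : Pol := MvPolynomial.X (0, i)

/-- The coordinates of the second vector. -/
def s (i : Fin 3) : Pol := MvPolynomial.X (1, i)

/-- The coordinates of the vector product. -/
def ξ : Fin 3 → Pol := ![x 1 * s 2 - x 2 * s 1, x 2 * s 0 - x 0 * s 2, x 0 * s 1 - x 1 * s 0]

lemma incidence : x 0 * ξ 0 + x 1 * ξ 1 + x 2 * ξ 2 = 0 := by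
  simp [ξ]; ring

/-- The derivation which extends the action of a matrix on vectors. -/
def der (M : Matrix (Fin 3) (Fin 3) ℂ) : Derivation ℂ Pol Pol :=
  MvPolynomial.mkDerivation ℂ fun v => ∑ i, M i v.2 • (MvPolynomial.X (v.1, i) : Pol)

lemma der_X (M : Matrix (Fin 3) (Fin 3) ℂ) (v : Fin 2 × Fin 3) :
    der M (MvPolynomial.X v) = ∑ i, M i v.2 • (MvPolynomial.X (v.1, i) : Pol) := by
  simp [der]

lemma der_lie (M N : Matrix (Fin 3) (Fin 3) ℂ) : der (M * N - N * M) = ⁅der M, der N⁆ := by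
  apply MvPolynomial.derivation_ext
  intro v
  rw [Derivation.commutator_apply, der_X, der_X, der_X]
  simp only [Fin.sum_univ_three, map_add, Derivation.map_smul, der_X,
    smul_smul, Matrix.sub_apply, Matrix.mul_apply]
  module

lemma der_add (M N : Matrix (Fin 3) (Fin 3) ℂ) : der (M + N) = der M + der N := by
  apply MvPolynomial.derivation_ext
  intro v
  simp [der_X, add_smul, Finset.sum_add_distrib]

lemma der_smul (c : ℂ) (M : Matrix (Fin 3) (Fin 3) ℂ) : der (c • M) = c • der M := by
  apply MvPolynomial.derivation_ext
  intro v
  simp [der_X, mul_smul, Finset.smul_sum]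

instance : LieRingModule sl3 Pol where
  bracket y f := der y.1 f
  add_lie y z f := by
    change der (y.1 + z.1) f = _
    rw [der_add]; rfl
  lie_add y f g := map_add _ _ _
  leibniz_lie y z f := by
    change der y.1 (der z.1 f) = der (y.1 * z.1 - z.1 * y.1) f + der z.1 (der y.1 f)
    rw [der_lie, Derivation.commutator_apply]; abel

lemma lie_def (y : sl3) (f : Pol) : ⁅y, f⁆ = der y.1 f := rfl

instance : LieModule ℂ sl3 Pol where
  smul_lie c y f := by
    change der (c • y.1) f = c • der y.1 f
    rw [der_smul]; rfl
  lie_smul c y f := (der y.1).map_smul c f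

lemma lie_mul (y : sl3) (f g : Pol) : ⁅y, f * g⁆ = ⁅y, f⁆ * g + f * ⁅y, g⁆ := by
  simp only [lie_def, Derivation.leibniz, smul_eq_mul]; ring

lemma lie_pow (y : sl3) (f : Pol) (n : ℕ) : ⁅y, f ^ n⁆ = (n : ℂ) • (f ^ (n - 1) * ⁅y, f⁆) := by
  simp only [lie_def, Derivation.leibniz_pow, smul_eq_mul, Nat.cast_smul_eq_nsmul]

lemma lie_x (i j k : Fin 3) :
    ⁅e i j, x k⁆ = (if j = k then x i else 0) - (if i = j then (1 / 3 : ℂ) • x k else 0) := by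
  rw [lie_def, x, der_X]
  fin_cases i <;> fin_cases j <;> fin_cases k <;>
    simp [e, Fin.sum_univ_three, Matrix.single_apply, x] <;> module

lemma lie_s (i j k : Fin 3) :
    ⁅e i j, s k⁆ = (if j = k then s i else 0) - (if i = j then (1 / 3 : ℂ) • s k else 0) := by
  rw [lie_def, s, der_X]
  fin_cases i <;> fin_cases j <;> fin_cases k <;>
    simp [e, Fin.sum_univ_three, Matrix.single_apply, s] <;> module

/-- A matrix acts on a vector product by its trace minus its transpose; here the trace is zero, so
`ξ` transforms as a covector. -/
lemma lie_ξ (i j k : Fin 3) :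
    ⁅e i j, ξ k⁆ = (if i = j then (1 / 3 : ℂ) • ξ k else 0) - (if i = k then ξ j else 0) := by
  have hc : (3 : Pol) * algebraMap ℂ Pol (1 / 3) = 1 := by
    rw [← map_ofNat (algebraMap ℂ Pol) 3, ← map_mul]; norm_num
  have h0 : ξ 0 = x 1 * s 2 - x 2 * s 1 := rfl
  have h1 : ξ 1 = x 2 * s 0 - x 0 * s 2 := rfl
  have h2 : ξ 2 = x 0 * s 1 - x 1 * s 0 := rfl
  have hk : k = 0 ∨ k = 1 ∨ k = 2 := by fin_cases k <;> simp
  rcases hk with rfl | rfl | rfl <;> fin_cases i <;> fin_cases j <;>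
    simp only [h0, h1, h2, lie_mul, lie_x, lie_s, lie_sub, Algebra.smul_def, Fin.zero_eta,
      Fin.mk_one, Fin.reduceFinMk, Fin.isValue, Fin.reduceEq, if_true, if_false] <;>
    generalize algebraMap ℂ Pol (1 / 3) = c at hc <;>
    first | ring1 | linear_combination (-(x 1 * s 2 - x 2 * s 1)) * hc
          | linear_combination (-(x 2 * s 0 - x 0 * s 2)) * hc
          | linear_combination (-(x 0 * s 1 - x 1 * s 0)) * hc

/-- Monomials in the `x i` and the `ξ i`. -/
def mon (a0 a1 a2 b0 b1 b2 : ℕ) : Pol :=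
  x 0 ^ a0 * x 1 ^ a1 * x 2 ^ a2 * (ξ 0 ^ b0 * ξ 1 ^ b1 * ξ 2 ^ b2)

variable (a0 a1 a2 b0 b1 b2 : ℕ)

lemma lie_mon (i j : Fin 3) : ⁅e i j, mon a0 a1 a2 b0 b1 b2⁆ =
    (a0:ℂ) • ((x 0 ^ (a0 - 1) *
        ⁅e i j, x 0⁆) * x 1 ^ a1 * x 2 ^ a2 * (ξ 0 ^ b0 * ξ 1 ^ b1 * ξ 2 ^ b2)) +
    (a1:ℂ) • (x 0 ^ a0 * (x 1 ^ (a1 - 1) *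
        ⁅e i j, x 1⁆) * x 2 ^ a2 * (ξ 0 ^ b0 * ξ 1 ^ b1 * ξ 2 ^ b2)) +
    (a2:ℂ) • (x 0 ^ a0 * x 1 ^ a1 * (x 2 ^ (a2 - 1) *
        ⁅e i j, x 2⁆) * (ξ 0 ^ b0 * ξ 1 ^ b1 * ξ 2 ^ b2)) +
    (b0:ℂ) • (x 0 ^ a0 * x 1 ^ a1 * x 2 ^ a2 * ((ξ 0 ^ (b0 - 1) *
        ⁅e i j, ξ 0⁆) * ξ 1 ^ b1 * ξ 2 ^ b2)) +
    (b1:ℂ) • (x 0 ^ a0 * x 1 ^ a1 * x 2 ^ a2 * (ξ 0 ^ b0 * (ξ 1 ^ (b1 - 1) *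
        ⁅e i j, ξ 1⁆) * ξ 2 ^ b2)) +
    (b2:ℂ) • (x 0 ^ a0 * x 1 ^ a1 * x 2 ^ a2 * (ξ 0 ^ b0 * ξ 1 ^ b1 * (ξ 2 ^ (b2 - 1) *
        ⁅e i j, ξ 2⁆))) := by
  simp only [mon, lie_mul, lie_pow, Algebra.smul_def]
  ring

lemma lie_mon_zero_one : ⁅e 0 1, mon a0 a1 a2 b0 b1 b2⁆ =
    (a1 : ℂ) • mon (a0 + 1) (a1 - 1) a2 b0 b1 b2 - (b0 : ℂ) • mon a0 a1 a2 (b0 - 1) (b1 +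
        1) b2 := by
  rw [lie_mon]; simp [lie_x, lie_ξ, mon, Algebra.smul_def]; ring

lemma lie_mon_one_two : ⁅e 1 2, mon a0 a1 a2 b0 b1 b2⁆ =
    (a2 : ℂ) • mon a0 (a1 + 1) (a2 - 1) b0 b1 b2 - (b1 : ℂ) • mon a0 a1 a2 b0 (b1 - 1) (b2 +
        1) := by
  rw [lie_mon]; simp [lie_x, lie_ξ, mon, Algebra.smul_def]; ring

lemma lie_mon_zero_two : ⁅e 0 2, mon a0 a1 a2 b0 b1 b2⁆ =
    (a2 : ℂ) • mon (a0 + 1) a1 (a2 - 1) b0 b1 b2 - (b0 : ℂ) • mon a0 a1 a2 (b0 - 1) b1 (b2 +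
        1) := by
  rw [lie_mon]; simp [lie_x, lie_ξ, mon, Algebra.smul_def]; ring

lemma lie_mon_one_zero : ⁅e 1 0, mon a0 a1 a2 b0 b1 b2⁆ =
    (a0 : ℂ) • mon (a0 - 1) (a1 + 1) a2 b0 b1 b2 - (b1 : ℂ) • mon a0 a1 a2 (b0 + 1) (b1 -
        1) b2 := by
  rw [lie_mon]; simp [lie_x, lie_ξ, mon, Algebra.smul_def]; ring

lemma lie_mon_two_one : ⁅e 2 1, mon a0 a1 a2 b0 b1 b2⁆ =
    (a1 : ℂ) • mon a0 (a1 - 1) (a2 + 1) b0 b1 b2 - (b2 : ℂ) • mon a0 a1 a2 b0 (b1 + 1) (b2 -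
        1) := by
  rw [lie_mon]; simp [lie_x, lie_ξ, mon, Algebra.smul_def]; ring

lemma lie_mon_two_zero : ⁅e 2 0, mon a0 a1 a2 b0 b1 b2⁆ =
    (a0 : ℂ) • mon (a0 - 1) a1 (a2 + 1) b0 b1 b2 - (b2 : ℂ) • mon a0 a1 a2 (b0 + 1) b1 (b2 -
        1) := by
  rw [lie_mon]; simp [lie_x, lie_ξ, mon, Algebra.smul_def]; ring


lemma lie_mon_diag (i : Fin 3) : ⁅e i i, mon a0 a1 a2 b0 b1 b2⁆ =
    ((![a0, a1, a2] i : ℂ) - (![b0, b1, b2] i : ℂ)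
      - ((a0 + a1 + a2 : ℂ) - (b0 + b1 + b2)) / 3) • mon a0 a1 a2 b0 b1 b2 := by
  have hp : ∀ (y : Pol) (n : ℕ), (n : ℂ) • (y ^ (n - 1) * y) = (n : ℂ) • y ^ n := by
    rintro y (_ | n)
    · simp
    · rw [Nat.add_sub_cancel, pow_succ]
  have hx : ∀ k, ⁅e i i, x k⁆ = ((if i = k then 1 else 0) - 1 / 3 : ℂ) • x k := by
    intro k; rw [lie_x, if_pos rfl]; split_ifs <;> first | (subst_vars; module) | module
  have hξ : ∀ k, ⁅e i i, ξ k⁆ = (1 / 3 - (if i = k then 1 else 0) : ℂ) • ξ k := by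
    intro k; rw [lie_ξ, if_pos rfl]; split_ifs <;> first | (subst_vars; module) | module
  have hx' : ∀ k (n : ℕ), ⁅e i i, x k ^ n⁆ = ((n : ℂ) * ((if i = k then 1 else 0) -
      1 / 3)) • x k ^ n := by
    intro k n
    rw [lie_pow, hx, mul_smul_comm, smul_comm, hp, smul_smul, mul_comm (n : ℂ)]
  have hξ' : ∀ k (n : ℕ), ⁅e i i, ξ k ^ n⁆ = ((n : ℂ) * (1 / 3 - (if i =
      k then 1 else 0))) • ξ k ^ n := by
    intro k n
    rw [lie_pow, hξ, mul_smul_comm, smul_comm, hp, smul_smul, mul_comm (n : ℂ)]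
  simp only [mon, lie_mul, hx', hξ', smul_mul_assoc, mul_smul_comm, ← add_smul]
  fin_cases i <;> simp <;> ring_nf

/-- The span of the monomials of degree `p` in `x` and `q` in `ξ`. -/
def modelSpan (p q : ℕ) : Submodule ℂ Pol :=
  Submodule.span ℂ {f | ∃ a0 a1 a2 b0 b1 b2 : ℕ, a0 + a1 + a2 = p ∧ b0 + b1 + b2 = q ∧
    f = mon a0 a1 a2 b0 b1 b2}

variable {a0 a1 a2 b0 b1 b2} {p q : ℕ}

lemma mon_mem_modelSpan (hp : a0 + a1 + a2 = p) (hq : b0 + b1 + b2 = q) :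
    mon a0 a1 a2 b0 b1 b2 ∈ modelSpan p q :=
  Submodule.subset_span ⟨a0, a1, a2, b0, b1, b2, hp, hq, rfl⟩

lemma natCast_smul_mem {M : Type*} [AddCommGroup M] [Module ℂ M] {S : Submodule ℂ M} {n : ℕ}
    {f : M} (hf : n ≠ 0 → f ∈ S) : (n : ℂ) • f ∈ S := by
  rcases eq_or_ne n 0 with rfl | hn
  · simp
  · exact S.smul_mem _ (hf hn)

lemma modelSpan_stable (p q : ℕ) (i j : Fin 3) (f : Pol) (hf : f ∈ modelSpan p q) :
    ⁅e i j, f⁆ ∈ modelSpan p q := by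
  induction hf using Submodule.span_induction with
  | zero => simp
  | add f g _ _ hf hg => rw [lie_add]; exact add_mem hf hg
  | smul c f _ hf => rw [lie_smul]; exact Submodule.smul_mem _ _ hf
  | mem f hf =>
    obtain ⟨a0, a1, a2, b0, b1, b2, hp, hq, rfl⟩ := hf
    rcases eq_or_ne i j with rfl | hij
    · rw [lie_mon_diag]
      exact Submodule.smul_mem _ _ (mon_mem_modelSpan hp hq)
    · have cases3 : ∀ k : Fin 3, k = 0 ∨ k = 1 ∨ k = 2 := by decide
      rcases cases3 i with rfl | rfl | rfl <;> rcases cases3 j with rfl | rfl | rfl <;>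
        first
        | exact absurd rfl hij
        | (first
            | rw [lie_mon_zero_one] | rw [lie_mon_one_two] | rw [lie_mon_zero_two]
            | rw [lie_mon_one_zero] | rw [lie_mon_two_one] | rw [lie_mon_two_zero])
          refine sub_mem ?_ ?_ <;>
            exact natCast_smul_mem fun h => mon_mem_modelSpan (by omega) (by omega)

/-- The representation on the forms of degree `p` in `x` and `q` in `ξ`. -/
def model (p q : ℕ) : LieSubmodule ℂ sl3 Pol := lieSubmoduleOfStable _ (modelSpan_stable p q)

lemma mem_model {f : Pol} : f ∈ model p q ↔ f ∈ modelSpan p q := Iff.rfl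

lemma mon_mem_model (hp : a0 + a1 + a2 = p) (hq : b0 + b1 + b2 = q) :
    mon a0 a1 a2 b0 b1 b2 ∈ model p q := mon_mem_modelSpan hp hq

instance : FiniteDimensional ℂ (model p q) := by
  have : FiniteDimensional ℂ (modelSpan p q) := by
    refine FiniteDimensional.span_of_finite ℂ ?_
    have : {f | ∃ a0 a1 a2 b0 b1 b2 : ℕ, a0 + a1 + a2 = p ∧ b0 + b1 + b2 = q ∧
        f = mon a0 a1 a2 b0 b1 b2} ⊆
        (fun g : Fin 6 → ℕ => mon (g 0) (g 1) (g 2) (g 3) (g 4) (g 5)) ''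
          Set.Icc 0 (fun _ => p + q) := by
      rintro _ ⟨a0, a1, a2, b0, b1, b2, hp, hq, rfl⟩
      refine ⟨![a0, a1, a2, b0, b1, b2], ⟨fun i => by simp, fun i => ?_⟩, rfl⟩
      fin_cases i <;> simp <;> omega
    exact ((Set.finite_Icc _ _).image _).subset this
  exact this

lemma mon_reduce : mon a0 (a1 + 1) a2 b0 (b1 + 1) b2 =
    -mon (a0 + 1) a1 a2 (b0 + 1) b1 b2 - mon a0 a1 (a2 + 1) b0 b1 (b2 + 1) := by
  have := incidence
  simp only [mon]
  linear_combination (x 0 ^ a0 * x 1 ^ a1 * x 2 ^ a2 * (ξ 0 ^ b0 * ξ 1 ^ b1 * ξ 2 ^ b2)) * this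

/-- The model is generated by its highest weight vector. -/
lemma mon_mem_of_highest (N : LieSubmodule ℂ sl3 Pol) (hN : mon p 0 0 0 0 q ∈ N)
    (hp : a0 + a1 + a2 = p) (hq : b0 + b1 + b2 = q) : mon a0 a1 a2 b0 b1 b2 ∈ N := by
  have hsmul : ∀ (n : ℕ) (f : Pol), ((n : ℂ) + 1) • f ∈ N → f ∈ N := fun n f hf => by
    have := N.smul_mem ((n : ℂ) + 1)⁻¹ hf
    rwa [inv_smul_smul₀ (Nat.cast_add_one_ne_zero n)] at this
  -- This height counts the simple lowering steps from the highest weight: replacing `x 0` by `x 1`,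
  -- `x 1` by `x 2`, `ξ 2` by `ξ 1` or `ξ 1` by `ξ 0` adds one.
  induction hh : a1 + 2 * a2 + b1 + 2 * b0 using Nat.strong_induction_on generalizing
    a0 a1 a2 b0 b1 b2 with
  | _ h ih =>
  have low : ∀ {a0 a1 a2 b0 b1 b2 : ℕ}, a0 + a1 + a2 = p → b0 + b1 + b2 = q →
      a1 + 2 * a2 + b1 + 2 * b0 < h → ∀ i j, ⁅e i j, mon a0 a1 a2 b0 b1 b2⁆ ∈ N :=
    fun h1 h2 h3 i j => N.lie_mem (ih _ h3 h1 h2 rfl)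
  clear ih
  -- monomials without `x 1` and `ξ 1`, first those with `x 2`
  have key1 : ∀ {a c d f : ℕ}, a + (c + 1) = p → d + f = q → 2 * (c + 1) + 2 * d = h →
      mon a 0 (c + 1) d 0 f ∈ N := by
    intro a c d f h1 h2 h3
    -- After the reduction of `x 1 * ξ 1`, the two lowered vectors both contain an unwanted
    -- monomial, with opposite coefficients. In their sum only the desired monomial remains, with a
    -- positive coefficient.
    have e1 := low (a0 := a) (a1 := 1) (a2 := c) (b0 := d) (b1 := 0) (b2 := f)
      (by omega) (by omega) (by omega) 2 1
    have e2 := low (a0 := a + 1) (a1 := 0) (a2 := c) (b0 := d) (b1 := 0) (b2 := f)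
      (by omega) (by omega) (by omega) 2 0
    rw [lie_mon_two_one] at e1
    rw [lie_mon_two_zero] at e2
    rcases f with _ | f
    · refine hsmul a _ ?_
      simpa using e2
    · refine hsmul (1 + (f + 1) + a) _ ?_
      have e3 := N.add_mem e1 e2
      simp only [Nat.add_sub_cancel, Nat.sub_self] at e3
      rw [show mon a 1 c d (0 + 1) f = _ from mon_reduce (a1 := 0)] at e3
      convert (show _ ∈ N from e3) using 1
      push_cast
      module
  have key2 : ∀ {a c d f : ℕ}, a + c = p → d + f = q → 2 * c + 2 * d = h →
      mon a 0 c d 0 f ∈ N := by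
    intro a c d f h1 h2 h3
    rcases c with _ | c
    · rcases d with _ | d
      · have : a = p := by omega
        have : f = q := by omega
        subst_vars
        exact hN
      · have e1 := low (a0 := a) (a1 := 0) (a2 := 0) (b0 := d) (b1 := 0) (b2 := f + 1)
          (by omega) (by omega) (by omega) 2 0
        rw [lie_mon_two_zero] at e1
        refine hsmul f _ ?_
        rcases a with _ | a
        · simpa using e1
        · have e2 := N.smul_mem ((a : ℂ) + 1) (key1 (a := a) (c := 0) (d := d) (f := f + 1)
            (by omega) (by omega) (by omega))
          have e3 := N.sub_mem e2 e1
          simp only [Nat.add_sub_cancel] at e3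
          convert (show _ ∈ N from e3) using 1
          push_cast
          module
    · exact key1 h1 h2 h3
  -- the general case, by reduction of the products `x 1 * ξ 1`
  clear hN
  induction a1 generalizing a0 a2 b0 b1 b2 with
  | zero =>
    rcases b1 with _ | b1
    · exact key2 (by omega) (by omega) (by omega)
    · have e1 := low (a0 := a0) (a1 := 0) (a2 := a2) (b0 := b0) (b1 := b1) (b2 := b2 + 1)
        (by omega) (by omega) (by omega) 2 1
      rw [lie_mon_two_one] at e1
      refine hsmul b2 _ ?_
      simpa using e1
  | succ a1 ih =>
    rcases b1 with _ | b1
    · have e1 := low (a0 := a0 + 1) (a1 := a1) (a2 := a2) (b0 := b0) (b1 := 0) (b2 := b2)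
        (by omega) (by omega) (by omega) 1 0
      rw [lie_mon_one_zero] at e1
      refine hsmul a0 _ ?_
      simpa using e1
    · rw [mon_reduce]
      exact N.sub_mem (N.neg_mem (ih (by omega) (by omega) (by omega)))
        (ih (by omega) (by omega) (by omega))

end Pol

namespace Pol

/-! ### One-parameter subgroups -/

/-- The action of the elementary unipotent matrix `1 + τ e_{ij}` on pairs of vectors. -/
def flow {R : Type*} [CommRing R] (i j : Fin 3) (τ : R) (P : Fin 2 × Fin 3 → R)
    (v : Fin 2 × Fin 3) : R :=
  P v + if v.2 = j then τ * P (v.1, i) else 0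

section flow

variable {R : Type*} [CommRing R] [Algebra ℂ R] {i j : Fin 3}

/-- The restriction of a polynomial to an orbit of a one-parameter subgroup. -/
def orbit (i j : Fin 3) (P : Fin 2 × Fin 3 → R) : Pol →ₐ[ℂ] Polynomial R :=
  MvPolynomial.aeval (flow i j Polynomial.X fun v => Polynomial.C (P v))

/-- Along the curve `τ ↦ (1 + τ e i j) P` the derivative of a function is given by the infinitesimal
action. Nilpotency of `e i j` on `f` thereby becomes a bound on the degree in `τ`. -/
lemma derivative_orbit (hij : i ≠ j) (P : Fin 2 × Fin 3 → R) (f : Pol) :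
    Polynomial.derivative (orbit i j P f) = orbit i j P ⁅e i j, f⁆ := by
  induction f using MvPolynomial.induction_on with
  | C c =>
    have h1 : ⁅e i j, (MvPolynomial.C c : Pol)⁆ = 0 := by
      rw [lie_def]; exact (der _).map_algebraMap c
    have h2 : orbit i j P (MvPolynomial.C c) = Polynomial.C (algebraMap ℂ R c) := by
      simp [orbit, Polynomial.algebraMap_apply]
    rw [h1, h2, map_zero, Polynomial.derivative_C]
  | add f g hf hg => rw [lie_add, map_add, map_add, map_add, hf, hg]
  | mul_X f v hf =>
    rw [lie_mul, map_mul, Polynomial.derivative_mul, hf, map_add, map_mul, map_mul]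
    congr 2
    have h1 : ⁅e i j, (MvPolynomial.X v : Pol)⁆ = if v.2 = j then MvPolynomial.X (v.1,
        i) else 0 := by
      obtain ⟨a, k⟩ := v
      have ha : a = 0 ∨ a = 1 := by fin_cases a <;> simp
      rcases ha with rfl | rfl
      · have := lie_x i j k
        simpa [x, hij, eq_comm] using this
      · have := lie_s i j k
        simpa [s, hij, eq_comm] using this
    rw [h1]
    by_cases hv : v.2 = j
    · simp [orbit, flow, hv, hij]
    · simp [orbit, flow, hv]

lemma eval_orbit (P : Fin 2 × Fin 3 → R) (τ : R) (f : Pol) :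
    (orbit i j P f).eval τ = MvPolynomial.aeval (flow i j τ P) f := by
  have : ((Polynomial.aeval τ).restrictScalars ℂ).comp (orbit i j P) =
      MvPolynomial.aeval (flow i j τ P) := by
    apply MvPolynomial.algHom_ext
    intro v
    simp [orbit, flow]
    split_ifs <;> simp
    exact mul_comm _ _
  exact congrArg (fun F => F f) this

lemma iterate_derivative_orbit (hij : i ≠ j) (P : Fin 2 × Fin 3 → R) (f : Pol) (n : ℕ) :
    Polynomial.derivative^[n] (orbit i j P f) = orbit i j P ((units Pol i j ^ n) f) := by
  induction n with
  | zero => rfl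
  | succ n ih =>
    rw [Function.iterate_succ_apply', ih, derivative_orbit hij, pow_succ']
    rfl

variable [IsDomain R] [CharZero R]

/-- The derivative of order `n + 1` vanishes, and in characteristic zero this kills all coefficients
of degree greater than `n`. -/
lemma natDegree_orbit_le (hij : i ≠ j) (P : Fin 2 × Fin 3 → R) {f : Pol} {n : ℕ}
    (hf : (units Pol i j ^ (n + 1)) f = 0) : (orbit i j P f).natDegree ≤ n := by
  have h1 := iterate_derivative_orbit hij P f (n + 1)
  rw [hf, map_zero] at h1
  rw [Polynomial.natDegree_le_iff_coeff_eq_zero]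
  intro N hN
  have h2 := congrArg (fun g => g.coeff (N - (n + 1))) h1
  simp only [Polynomial.coeff_iterate_derivative, Polynomial.coeff_zero,
    Nat.sub_add_cancel (show n + 1 ≤ N from hN)] at h2
  refine (smul_eq_zero.1 h2).resolve_left ?_
  exact (Nat.descFactorial_pos.2 hN).ne'

lemma aeval_flow (hij : i ≠ j) (P : Fin 2 × Fin 3 → R) {f : Pol} (hf : ⁅e i j, f⁆ = 0) (τ : R) :
    MvPolynomial.aeval (flow i j τ P) f = MvPolynomial.aeval P f := by
  have h1 : (orbit i j P f).natDegree ≤ 0 := natDegree_orbit_le hij P (by simpa [units_apply])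
  rw [Polynomial.natDegree_le_iff_degree_le, Nat.cast_zero] at h1
  have h2 : flow i j 0 P = P := by ext v; simp [flow]
  conv_rhs => rw [← h2]
  rw [← eval_orbit, ← eval_orbit, Polynomial.eq_C_of_degree_le_zero h1]
  simp

end flow

/-! ### Highest weight vectors of the model -/

variable {p q : ℕ}

lemma aeval_mon {R : Type*} [CommRing R] [Algebra ℂ R] (P : Fin 2 × Fin 3 → R)
    (a0 a1 a2 b0 b1 b2 : ℕ) : MvPolynomial.aeval P (mon a0 a1 a2 b0 b1 b2) =
    P (0, 0) ^ a0 * P (0, 1) ^ a1 * P (0, 2) ^ a2 *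
    ((P (0, 1) * P (1, 2) - P (0, 2) * P (1, 1)) ^ b0 *
    (P (0, 2) * P (1, 0) - P (0, 0) * P (1, 2)) ^ b1 *
    (P (0, 0) * P (1, 1) - P (0, 1) * P (1, 0)) ^ b2) := by
  simp [mon, x, s, ξ]

lemma ξ_two_ne_zero : ξ 2 ≠ 0 := by
  intro h0
  have h1 := congrArg (MvPolynomial.aeval (fun v : Fin 2 × Fin 3 =>
    if v = (0, 0) ∨ v = (1, 1) then (1 : ℂ) else 0)) h0
  simp [ξ, x, s] at h1

/-- A generic pair of vectors can be brought to diagonal form by upper triangular matrices. -/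
lemma exists_flow_diagonal {K : Type*} [Field K] (P : Fin 2 × Fin 3 → K) (h0 : P (0, 0) ≠ 0)
    (h1 : P (0, 1) ≠ 0) (h2 : P (0, 0) * P (1, 1) - P (0, 1) * P (1, 0) ≠ 0) :
    ∃ (τ₁ τ₂ τ₃ : K) (P' : Fin 2 × Fin 3 → K),
      P' = flow 1 2 τ₃ (flow 0 1 τ₂ (flow 1 2 τ₁ P)) ∧ P' (0, 0) = P (0, 0) ∧ P' (0, 1) = 0 ∧
      P' (0, 2) = 0 ∧ P' (0, 0) * P' (1, 1) = P (0, 0) * P (1, 1) - P (0, 1) * P (1, 0) ∧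
      P' (1, 2) = 0 := by
  let P₂ := flow 0 1 (-P (0, 1) / P (0, 0)) (flow 1 2 (-P (0, 2) / P (0, 1)) P)
  have e01 : P₂ (0, 1) = 0 := by
    simp [P₂, flow]
    field_simp
    ring
  have e02 : P₂ (0, 2) = 0 := by
    simp [P₂, flow]
    field_simp
    ring
  have e00 : P₂ (0, 0) = P (0, 0) := by simp [P₂, flow]
  have e11 : P (0, 0) * P₂ (1, 1) = P (0, 0) * P (1, 1) - P (0, 1) * P (1, 0) := by
    simp [P₂, flow]
    field_simp
    ring
  have h11 : P₂ (1, 1) ≠ 0 := fun h => h2 (by rw [← e11, h, mul_zero])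
  refine ⟨-P (0, 2) / P (0, 1), -P (0, 1) / P (0, 0), -P₂ (1, 2) / P₂ (1, 1),
    flow 1 2 (-P₂ (1, 2) / P₂ (1, 1)) P₂, rfl, ?_, ?_, ?_, ?_, ?_⟩
  · simp [flow, e00]
  · simp [flow, e01]
  · simp [flow, e01, e02]
  · rw [← e11, ← e00]
    simp [flow]
  · simp [flow]
    field_simp
    ring

/-- The vectors which are killed by the raising operators are multiples of the highest weight
vector. -/
lemma eq_smul_highest {f : Pol} (hf : f ∈ model p q) (h01 : ⁅e 0 1, f⁆ = 0) (h12 : ⁅e 1 2, f⁆ = 0) :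
    ∃ c : ℂ, f = c • mon p 0 0 0 0 q := by
  have hinj : Function.Injective (IsScalarTower.toAlgHom ℂ Pol (FractionRing Pol)) :=
    IsFractionRing.injective Pol (FractionRing Pol)
  have : CharZero (FractionRing Pol) :=
    charZero_of_injective_algebraMap (FaithfulSMul.algebraMap_injective ℂ (FractionRing Pol))
  generalize hι : IsScalarTower.toAlgHom ℂ Pol (FractionRing Pol) = ι at hinj
  obtain ⟨τ₁, τ₂, τ₃, P', hP', e00, e01, e02, e11, e12⟩ :=
    exists_flow_diagonal (fun v => ι (MvPolynomial.X v))
      ((map_ne_zero_iff _ hinj).2 (MvPolynomial.X_ne_zero _))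
      ((map_ne_zero_iff _ hinj).2 (MvPolynomial.X_ne_zero _))
      (by rw [← map_mul, ← map_mul, ← map_sub]; exact (map_ne_zero_iff _ hinj).2 ξ_two_ne_zero)
  -- At `P'` the vector is `(x 0, 0, 0)` and the covector `(0, 0, ξ 2)`, so all monomials vanish
  -- except the highest one. Since `f` is invariant under the flows, its value there is its value at
  -- the generic point, which is `f` itself.
  have hev : ∃ c : ℂ, MvPolynomial.aeval P' f = ι (c • mon p 0 0 0 0 q) := by
    rw [mem_model] at hf
    clear h01 h12
    induction hf using Submodule.span_induction with
    | zero => exact ⟨0, by simp⟩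
    | add f g _ _ hf hg =>
      obtain ⟨c, hc⟩ := hf
      obtain ⟨d, hd⟩ := hg
      exact ⟨c + d, by rw [map_add, hc, hd, add_smul, map_add]⟩
    | smul k f _ hf =>
      obtain ⟨c, hc⟩ := hf
      exact ⟨k * c, by rw [map_smul, hc, mul_smul, map_smul _ k]⟩
    | mem f hf =>
      obtain ⟨a0, a1, a2, b0, b1, b2, h1, h2, rfl⟩ := hf
      rw [aeval_mon, e11, e00, e01, e02, e12]
      rcases a1 with _ | a1
      · rcases a2 with _ | a2
        · rcases b0 with _ | b0
          · rcases b1 with _ | b1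
            · refine ⟨1, ?_⟩
              simp only [add_zero, zero_add] at h1 h2
              subst h1 h2
              simp [mon, x, ξ, s]
            · exact ⟨0, by simp⟩
          · exact ⟨0, by simp⟩
        · exact ⟨0, by simp⟩
      · exact ⟨0, by simp⟩
  obtain ⟨c, hc⟩ := hev
  refine ⟨c, hinj ?_⟩
  rw [← hc, hP', aeval_flow (by decide) _ h12, aeval_flow (by decide) _ h01,
    aeval_flow (by decide) _ h12]
  exact congrArg (fun F => F f) (MvPolynomial.algHom_ext (f := ι)
    (g := MvPolynomial.aeval fun v => ι (MvPolynomial.X v)) fun v => by simp)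

/-- The vectors which are killed by all products of `n` simple raising operators. -/
def raisingKernel : ℕ → Submodule ℂ Pol
  | 0 => ⊥
  | n + 1 => (raisingKernel n).comap (units Pol 0 1) ⊓ (raisingKernel n).comap (units Pol 1 2)

lemma mem_raisingKernel_succ {n : ℕ} {f : Pol} : f ∈ raisingKernel (n + 1) ↔
    ⁅e 0 1, f⁆ ∈ raisingKernel n ∧ ⁅e 1 2, f⁆ ∈ raisingKernel n := by
  rw [raisingKernel, Submodule.mem_inf, Submodule.mem_comap, Submodule.mem_comap, units_apply,
    units_apply]

/-- A simple raising operator lowers the height `a1 + 2 * a2 + b1 + 2 * b0` by one. Natural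
subtraction is harmless, since the coefficient vanishes with the exponent. -/
lemma mon_mem_raisingKernel (n : ℕ) {a0 a1 a2 b0 b1 b2 : ℕ}
    (hn : a1 + 2 * a2 + b1 + 2 * b0 < n) : mon a0 a1 a2 b0 b1 b2 ∈ raisingKernel n := by
  induction n generalizing a0 a1 a2 b0 b1 b2 with
  | zero => omega
  | succ n ih =>
    rw [mem_raisingKernel_succ, lie_mon_zero_one, lie_mon_one_two]
    exact ⟨sub_mem (natCast_smul_mem fun h => ih (by omega))
        (natCast_smul_mem fun h => ih (by omega)),
      sub_mem (natCast_smul_mem fun h => ih (by omega))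
        (natCast_smul_mem fun h => ih (by omega))⟩

lemma model_le_raisingKernel : modelSpan p q ≤ raisingKernel (2 * (p + q) + 1) := by
  refine Submodule.span_le.2 ?_
  rintro _ ⟨a0, a1, a2, b0, b1, b2, h1, h2, rfl⟩
  exact mon_mem_raisingKernel _ (by omega)

/-- A nonzero subspace of the model which is stable under the raising operators contains the
highest weight vector. -/
lemma highest_mem_of_stable {Z : Submodule ℂ Pol} (hZ : Z ≤ modelSpan p q) (hne : Z ≠ ⊥)
    (h01 : ∀ f ∈ Z, ⁅e 0 1, f⁆ ∈ Z) (h12 : ∀ f ∈ Z, ⁅e 1 2, f⁆ ∈ Z) : mon p 0 0 0 0 q ∈ Z := by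
  -- A nonzero vector is raised as long as one of the two simple operators does not kill it. The
  -- filtration `raisingKernel` bounds the number of steps, and at the end `eq_smul_highest`
  -- applies.
  have main : ∀ n, (∃ f ∈ Z, f ≠ 0 ∧ f ∈ raisingKernel n) → mon p 0 0 0 0 q ∈ Z := by
    intro n
    induction n with
    | zero => rintro ⟨f, -, hf, h0⟩; exact absurd h0 hf
    | succ n ih =>
      rintro ⟨f, hfZ, hf, h⟩
      obtain ⟨h1, h2⟩ := mem_raisingKernel_succ.1 h
      by_cases e01 : ⁅e 0 1, f⁆ = 0
      · by_cases e12 : ⁅e 1 2, f⁆ = 0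
        · obtain ⟨c, rfl⟩ := eq_smul_highest (hZ hfZ) e01 e12
          have hc : c ≠ 0 := fun h => hf (by rw [h, zero_smul])
          have := Z.smul_mem c⁻¹ hfZ
          rwa [inv_smul_smul₀ hc] at this
        · exact ih ⟨_, h12 f hfZ, e12, h2⟩
      · exact ih ⟨_, h01 f hfZ, e01, h1⟩
  obtain ⟨f, hf, hf0⟩ := Z.ne_bot_iff.1 hne
  exact main _ ⟨f, hf, hf0, model_le_raisingKernel (hZ hf)⟩

lemma mon_ne_zero (a0 a1 a2 b0 b1 b2 : ℕ) : mon a0 a1 a2 b0 b1 b2 ≠ 0 := by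
  intro h0
  have h1 := congrArg (MvPolynomial.aeval (fun v : Fin 2 × Fin 3 =>
    (!![1, 1, 1; 0, 1, 2] : Matrix (Fin 2) (Fin 3) ℂ) v.1 v.2)) h0
  rw [aeval_mon] at h1
  simp at h1
  norm_num at h1

end Pol

/-! ### Vectors of a given weight in the model -/

/-- The generators are split according to whether their eigenvalue is `μ`. The part of `u` from the
other eigenvalues is itself an eigenvector for `μ`, hence zero by independence of eigenspaces. -/
lemma mem_span_eigenvectors {M : Type*} [AddCommGroup M] [Module ℂ M] (H : Module.End ℂ M)
    {S : Set M} (hS : ∀ v ∈ S, ∃ c : ℂ, H v = c • v) {μ : ℂ} {u : M} (hu : u ∈ Submodule.span ℂ S)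
    (hμ : H u = μ • u) : u ∈ Submodule.span ℂ {v ∈ S | H v = μ • v} := by
  have hS' : S ⊆ {v ∈ S | H v = μ • v} ∪ ⋃ c ∈ {c : ℂ | c ≠ μ}, (H.eigenspace c : Set M) := by
    intro v hv
    obtain ⟨c, hc⟩ := hS v hv
    by_cases h : c = μ
    · subst h; exact Or.inl ⟨hv, hc⟩
    · refine Or.inr (Set.mem_biUnion h ?_)
      exact Module.End.mem_eigenspace_iff.2 hc
  have h1 := Submodule.span_mono hS' hu
  rw [Submodule.span_union, Submodule.mem_sup] at h1
  obtain ⟨y, hy, z, hz, rfl⟩ := h1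
  have hz' : z ∈ ⨆ c, ⨆ (_ : c ≠ μ), H.eigenspace c := by
    refine (Submodule.span_le.2 ?_) hz
    refine Set.iUnion₂_subset fun c hc => ?_
    exact le_iSup₂_of_le (f := fun c (_ : c ≠ μ) => H.eigenspace c) c hc (le_refl (H.eigenspace c))
  have hy' : H y = μ • y := by
    refine Submodule.span_induction (p := fun y _ => H y = μ • y) (fun v hv => hv.2) (by simp)
      (fun a b _ _ ha hb => by rw [map_add, ha, hb, smul_add])
      (fun c a _ ha => by rw [map_smul, ha, smul_comm]) hy
  have hzμ : z ∈ H.eigenspace μ := by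
    rw [Module.End.mem_eigenspace_iff]
    rw [map_add, hy', smul_add] at hμ
    exact add_left_cancel hμ
  have : z = 0 := by
    have := (H.eigenspaces_iSupIndep μ).le_bot ⟨hzμ, hz'⟩
    simpa using this
  rw [this, add_zero]
  exact hy

/-- If polynomials have distinct degrees, then the degree of a linear combination bounds those of
its terms. -/
lemma mem_span_of_degree_le {M : Type*} [AddCommGroup M] [Module ℂ M] {ι : Type*} (v : ι → M)
    (F : M →ₗ[ℂ] Polynomial ℂ) (d : ι → ℕ) {S : Set ι} (hd : Set.InjOn d S)
    (hF : ∀ i ∈ S, (F (v i)).degree = d i) {u : M} (hu : u ∈ Submodule.span ℂ (v '' S)) {n : ℕ}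
    (hn : (F u).natDegree ≤ n) : u ∈ Submodule.span ℂ (v '' {i ∈ S | d i ≤ n}) := by
  classical
  obtain ⟨c, hc, rfl⟩ := (Finsupp.mem_span_image_iff_linearCombination ℂ).1 hu
  have hcS : ∀ i ∈ c.support, i ∈ S := fun i hi => (Finsupp.mem_supported _ _).1 hc hi
  rw [Finsupp.mem_span_image_iff_linearCombination]
  refine ⟨c, (Finsupp.mem_supported _ _).2 fun i hi => ⟨hcS i hi, ?_⟩, rfl⟩
  have hdeg : ∀ j ∈ c.support, (F (c j • v j)).degree = d j := by
    intro j hj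
    rw [map_smul, Polynomial.smul_eq_C_mul, Polynomial.degree_C_mul (Finsupp.mem_support_iff.1 hj),
      hF j (hcS j hj)]
  have h1 := Polynomial.degree_sum_eq_of_disjoint (fun j => F (c j • v j)) c.support (by
    rintro j ⟨hj, -⟩ k ⟨hk, -⟩ hjk h
    simp only [Function.comp] at h
    rw [hdeg j hj, hdeg k hk] at h
    exact hjk (hd (hcS j hj) (hcS k hk) (by exact_mod_cast h)))
  rw [Finsupp.linearCombination_apply, Finsupp.sum, map_sum] at hn
  have h2 := Finset.le_sup (f := fun j => (F (c j • v j)).degree) hi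
  rw [← h1, hdeg i hi] at h2
  have h3 := h2.trans (Polynomial.natDegree_le_iff_degree_le.1 hn)
  exact_mod_cast h3

namespace Pol

/-- The monomial with the given exponents. -/
def monomial (g : Fin 6 → ℕ) : Pol := mon (g 0) (g 1) (g 2) (g 3) (g 4) (g 5)

/-- The exponents of the monomials of degree `p` in `x` and `q` in `ξ` which are not divisible by
`x 1 * ξ 1`. -/
def reducedExponents (p q : ℕ) : Set (Fin 6 → ℕ) :=
  {g | g 0 + g 1 + g 2 = p ∧ g 3 + g 4 + g 5 = q ∧ (g 1 = 0 ∨ g 4 = 0)}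

variable {p q : ℕ}

lemma modelSpan_le_reduced :
    modelSpan p q ≤ Submodule.span ℂ (monomial '' reducedExponents p q) := by
  refine Submodule.span_le.2 ?_
  rintro _ ⟨a0, a1, a2, b0, b1, b2, h1, h2, rfl⟩
  induction a1 generalizing a0 a2 b0 b1 b2 with
  | zero => exact Submodule.subset_span ⟨![a0, 0, a2, b0, b1, b2], ⟨h1, h2, Or.inl rfl⟩, rfl⟩
  | succ a1 ih =>
    rcases b1 with _ | b1
    · exact Submodule.subset_span ⟨![a0, a1 + 1, a2, b0, 0, b2], ⟨h1, h2, Or.inr rfl⟩, rfl⟩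
    · rw [mon_reduce]
      exact sub_mem (neg_mem (ih _ _ _ _ _ (by omega) (by omega)))
        (ih _ _ _ _ _ (by omega) (by omega))

/-- The exponents of the monomials of a given weight. -/
def weightExponents (p q : ℕ) (μ : Fin 3 → ℂ) : Set (Fin 6 → ℕ) :=
  {g ∈ reducedExponents p q | ∀ i, (![g 0, g 1, g 2] i : ℂ) - (![g 3, g 4, g 5] i : ℂ)
      - ((p : ℂ) - q) / 3 = μ i}

lemma lie_monomial {g : Fin 6 → ℕ} (hg : g ∈ reducedExponents p q) (i : Fin 3) :
    ⁅e i i, monomial g⁆ = ((![g 0, g 1, g 2] i : ℂ) - (![g 3, g 4, g 5] i : ℂ)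
      - ((p : ℂ) - q) / 3) • monomial g := by
  obtain ⟨h1, h2, -⟩ := hg
  rw [monomial, lie_mon_diag, ← h1, ← h2]
  push_cast
  rfl

lemma mem_span_weight {f : Pol} (hf : f ∈ model p q) {μ : Fin 3 → ℂ}
    (hμ : ∀ i, ⁅e i i, f⁆ = μ i • f) :
    f ∈ Submodule.span ℂ (monomial '' weightExponents p q μ) := by
  have h0 := modelSpan_le_reduced hf
  have hS : ∀ i, ∀ v ∈ monomial '' reducedExponents p q, ∃ c : ℂ, units Pol i i v = c • v := by
    rintro i _ ⟨g, hg, rfl⟩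
    exact ⟨_, lie_monomial hg i⟩
  have h1 := mem_span_eigenvectors (units Pol 0 0) (hS 0) h0 (hμ 0)
  have h2 := mem_span_eigenvectors (units Pol 1 1) (fun v hv => hS 1 v hv.1) h1 (hμ 1)
  have h3 := mem_span_eigenvectors (units Pol 2 2) (fun v hv => hS 2 v hv.1.1) h2 (hμ 2)
  refine Submodule.span_mono ?_ h3
  rintro _ ⟨⟨⟨⟨g, hg, rfl⟩, e0⟩, e1⟩, e2⟩
  refine ⟨g, ⟨hg, fun i => ?_⟩, rfl⟩
  have : ⁅e i i, monomial g⁆ = μ i • monomial g := by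
    have hi : i = 0 ∨ i = 1 ∨ i = 2 := by fin_cases i <;> simp
    rcases hi with rfl | rfl | rfl
    exacts [e0, e1, e2]
  rw [lie_monomial hg] at this
  exact smul_left_injective ℂ (mon_ne_zero _ _ _ _ _ _) this

/-- The weight prescribes `g 1 - g 4`, and one of these two exponents is zero, so both are
determined. With the degrees fixed, a single integer parameter remains: the future index of the
ladder. -/
lemma weightExponents_unique {μ : Fin 3 → ℂ} {g g' : Fin 6 → ℕ}
    (hg : g ∈ weightExponents p q μ) (hg' : g' ∈ weightExponents p q μ) :
    g 1 = g' 1 ∧ g 4 = g' 4 ∧ g 0 + g' 3 = g' 0 + g 3 ∧ g 2 + g' 5 = g' 2 + g 5 := by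
  have key : ∀ i, ![g 0, g 1, g 2] i + ![g' 3, g' 4, g' 5] i
      = ![g' 0, g' 1, g' 2] i + ![g 3, g 4, g 5] i := by
    intro i
    have := (hg.2 i).trans (hg'.2 i).symm
    have h2 : ((![g 0, g 1, g 2] i + ![g' 3, g' 4, g' 5] i : ℕ) : ℂ)
      = ((![g' 0, g' 1, g' 2] i + ![g 3, g 4, g 5] i : ℕ) : ℂ) := by
      push_cast
      linear_combination this
    exact_mod_cast h2
  have k0 := key 0
  have k1 := key 1
  have k2 := key 2
  have := hg.1.2.2
  have := hg'.1.2.2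
  simp at k0 k1 k2
  omega

/-- The exponents allowed by the nilpotency orders of the simple raising operators. -/
def boundedExponents (p q : ℕ) (μ : Fin 3 → ℂ) (N N' : ℕ) : Set (Fin 6 → ℕ) :=
  {g ∈ weightExponents p q μ | g 1 + g 3 ≤ N ∧ g 2 + g 4 ≤ N'}

/-- The point of the orbit of `exp (τ e₀₁)`. -/
def point01 : Fin 2 × Fin 3 → ℂ :=
  fun v => (!![1, 0, 1; 0, 1, 1] : Matrix (Fin 2) (Fin 3) ℂ) v.1 v.2

/-- The point of the orbit of `exp (τ e₁₂)`. -/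
def point12 : Fin 2 × Fin 3 → ℂ :=
  fun v => (!![1, 1, 0; 0, 1, -1] : Matrix (Fin 2) (Fin 3) ℂ) v.1 v.2

/-- On this orbit `x = (1, τ, 1)` and `ξ = (τ - 1, -1, 1)`, so each monomial becomes a product of
powers whose degree is read off directly. -/
lemma degree_orbit01 (g : Fin 6 → ℕ) :
    (orbit 0 1 point01 (monomial g)).degree = (g 1 + g 3 : ℕ) := by
  have : orbit 0 1 point01 (monomial g) =
      Polynomial.X ^ g 1 * (Polynomial.X - Polynomial.C 1) ^ g 3 * Polynomial.C ((-1) ^ g 4) := by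
    rw [orbit, monomial, aeval_mon]
    simp [flow, point01]
    ring
  rw [this, Polynomial.degree_mul, Polynomial.degree_mul, Polynomial.degree_pow,
    Polynomial.degree_pow, Polynomial.degree_X, Polynomial.degree_X_sub_C,
    Polynomial.degree_C (by simp)]
  simp

/-- Here `x = (1, 1, τ)` and `ξ = (-1, 1 - τ, 1)`. -/
lemma degree_orbit12 (g : Fin 6 → ℕ) :
    (orbit 1 2 point12 (monomial g)).degree = (g 2 + g 4 : ℕ) := by
  have : orbit 1 2 point12 (monomial g) =
      Polynomial.X ^ g 2 * (Polynomial.X - Polynomial.C 1) ^ g 4 *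
        Polynomial.C ((-1) ^ (g 3 + g 4)) := by
    rw [orbit, monomial, aeval_mon]
    have h : (1 - Polynomial.X : Polynomial ℂ) ^ g 4 = (-1) ^ g 4 * (Polynomial.X - 1) ^ g 4 := by
      rw [← mul_pow]; ring
    simp [flow, point12]
    rw [neg_add_eq_sub, h]
    ring
  rw [this, Polynomial.degree_mul, Polynomial.degree_mul, Polynomial.degree_pow,
    Polynomial.degree_pow, Polynomial.degree_X, Polynomial.degree_X_sub_C,
    Polynomial.degree_C (by simp)]
  simp

/-- The nilpotency order bounds the degree of the restriction to an orbit. Distinct reduced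
monomials of one weight have distinct degrees there, so no cancellation is possible and the bound
holds for each monomial of `f`. -/
lemma mem_span_bounded {f : Pol} (hf : f ∈ model p q) {μ : Fin 3 → ℂ}
    (hμ : ∀ i, ⁅e i i, f⁆ = μ i • f) {N N' : ℕ} (hN : (units Pol 0 1 ^ (N + 1)) f = 0)
    (hN' : (units Pol 1 2 ^ (N' + 1)) f = 0) :
    f ∈ Submodule.span ℂ (monomial '' boundedExponents p q μ N N') := by
  have h1 := mem_span_of_degree_le monomial (orbit 0 1 point01).toLinearMap
    (fun g => g 1 + g 3) (S := weightExponents p q μ) (fun g hg g' hg' h => by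
      obtain ⟨h1, h2, h3, h4⟩ := weightExponents_unique hg hg'
      obtain ⟨⟨k1, k2, -⟩, -⟩ := hg
      obtain ⟨⟨k1', k2', -⟩, -⟩ := hg'
      simp only at h
      ext i; fin_cases i <;> simp <;> omega) (fun g _ => degree_orbit01 g) (mem_span_weight hf hμ)
    (natDegree_orbit_le (by decide) _ hN)
  have h2 := mem_span_of_degree_le monomial (orbit 1 2 point12).toLinearMap
    (fun g => g 2 + g 4) (S := {g ∈ weightExponents p q μ | g 1 + g 3 ≤ N})
    (fun g ⟨hg, _⟩ g' ⟨hg', _⟩ h => by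
      obtain ⟨h1, h2, h3, h4⟩ := weightExponents_unique hg hg'
      obtain ⟨⟨k1, k2, -⟩, -⟩ := hg
      obtain ⟨⟨k1', k2', -⟩, -⟩ := hg'
      simp only at h
      ext i; fin_cases i <;> simp <;> omega) (fun g _ => degree_orbit12 g) h1
    (natDegree_orbit_le (by decide) _ hN')
  refine Submodule.span_mono (Set.image_mono ?_) h2
  rintro g ⟨⟨h1, h2⟩, h3⟩
  exact ⟨h1, h2, h3⟩

end Pol

/-! ### Irreducible representations are determined by their highest weight -/

section Unique

/-- The vectors obtained from `w` by lowering operators, with the drop of the weight. -/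
inductive IsLowering {W : Type*} [AddCommGroup W] [Module ℂ W]
    (E : Fin 3 → Fin 3 → Module.End ℂ W) (w : W) : W → ℕ → Prop
  | base : IsLowering E w w 0
  | step {y : W} {k : ℕ} (i j : Fin 3) (hij : j < i) (hy : IsLowering E w y k) :
      IsLowering E w (E i j y) (k + (i.1 - j.1))

variable {W : Type*} [AddCommGroup W] [Module ℂ W] {E : Fin 3 → Fin 3 → Module.End ℂ W}
  {l : Fin 3 → ℂ} {w : W}

/-- The subspace generated by a vector under lowering operators. -/
def loweringSpan (E : Fin 3 → Fin 3 → Module.End ℂ W) (w : W) : Submodule ℂ W :=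
  Submodule.span ℂ {y | ∃ k, IsLowering E w y k}

lemma self_mem_loweringSpan : w ∈ loweringSpan E w := Submodule.subset_span ⟨0, .base⟩

/-- By induction on the word, raising and diagonal operators are commuted past the lowering ones
until they meet the highest weight vector. -/
lemma IsHighest.loweringSpan_stable (hE : IsMatrixUnits E) (hw : IsHighest E l w) (i j : Fin 3)
    {y : W} (hy : y ∈ loweringSpan E w) : E i j y ∈ loweringSpan E w := by
  have low : ∀ i j, j < i → ∀ y ∈ loweringSpan E w, E i j y ∈ loweringSpan E w := by
    intro i j hij y hy
    induction hy using Submodule.span_induction with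
    | zero => simp
    | add a b _ _ ha hb => rw [map_add]; exact add_mem ha hb
    | smul c a _ ha => rw [map_smul]; exact Submodule.smul_mem _ _ ha
    | mem y hy =>
      obtain ⟨k, hy⟩ := hy
      exact Submodule.subset_span ⟨_, .step i j hij hy⟩
  have main : ∀ y k, IsLowering E w y k → ∀ i j, E i j y ∈ loweringSpan E w := by
    intro y k hy
    induction hy with
    | base =>
      intro i j
      rcases lt_trichotomy i j with h | rfl | h
      · rw [hw.raise i j h]; exact zero_mem _
      · rw [hw.weight]; exact Submodule.smul_mem _ _ self_mem_loweringSpan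
      · exact low i j h _ self_mem_loweringSpan
    | step i' j' h hy ih =>
      intro i j
      rw [hE.apply]
      refine add_mem (low _ _ h _ (ih _ _)) (sub_mem ?_ ?_)
      · split_ifs
        · exact ih _ _
        · exact zero_mem _
      · split_ifs
        · exact ih _ _
        · exact zero_mem _
  induction hy using Submodule.span_induction with
  | zero => simp
  | add a b _ _ ha hb => rw [map_add]; exact add_mem ha hb
  | smul c a _ ha => rw [map_smul]; exact Submodule.smul_mem _ _ ha
  | mem y hy => exact main y _ hy.choose_spec i j

lemma IsLowering.weight (hE : IsMatrixUnits E) (hw : IsHighest E l w) {y : W} {k : ℕ}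
    (hy : IsLowering E w y k) : (E 0 0 - E 2 2) y = (l 0 - l 2 - k) • y := by
  induction hy with
  | base => simp [hw.weight, sub_smul]
  | @step y k i j hij hy ih =>
    rw [LinearMap.sub_apply] at ih ⊢
    rw [hE.apply 0 0, hE.apply 2 2]
    have h1 : E i j (E 0 0 y) - E i j (E 2 2 y) = (l 0 - l 2 - k) • E i j y := by
      rw [← map_sub, ih, map_smul]
    fin_cases i <;> fin_cases j <;> simp at hij h1 ⊢ <;>
      linear_combination (norm := module) h1

/-- In the subspace generated by a highest weight vector, the multiples of this vector are the
only ones of the same weight. -/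
lemma IsHighest.eq_smul_of_mem (hE : IsMatrixUnits E) (hw : IsHighest E l w) {y : W}
    (hy : y ∈ loweringSpan E w) (hl : (E 0 0 - E 2 2) y = (l 0 - l 2) • y) : ∃ c : ℂ, y =
        c • w := by
  have h1 := mem_span_eigenvectors (E 0 0 - E 2 2) (S := {y | ∃ k, IsLowering E w y k})
    (fun v hv => ⟨_, hv.choose_spec.weight hE hw⟩) hy hl
  have h2 : {v ∈ {y | ∃ k, IsLowering E w y k} | (E 0 0 - E 2 2) v = (l 0 - l 2) • v} ⊆
      (Submodule.span ℂ {w} : Set W) := by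
    rintro v ⟨⟨k, hv⟩, hv'⟩
    rw [hv.weight hE hw] at hv'
    rcases eq_or_ne k 0 with rfl | hk
    · obtain rfl : v = w := by
        generalize hk : 0 = k at hv
        cases hv with
        | base => rfl
        | step i j hij hy =>
          have : j.1 < i.1 := hij
          omega
      exact Submodule.mem_span_singleton_self v
    · have h3 : (k : ℂ) • v = 0 := by
        have : (k : ℂ) • v = (l 0 - l 2) • v - (l 0 - l 2 - k) • v := by module
        rw [this, hv', sub_self]
      rw [(smul_eq_zero.1 h3).resolve_left (by exact_mod_cast hk)]
      exact zero_mem _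
  obtain ⟨c, hc⟩ := Submodule.mem_span_singleton.1 (Submodule.span_le.2 h2 h1)
  exact ⟨c, hc.symm⟩

end Unique

section Unique

variable {V W : Type*} [AddCommGroup V] [Module ℂ V] [LieRingModule sl3 V] [LieModule ℂ sl3 V]
  [AddCommGroup W] [Module ℂ W] [LieRingModule sl3 W] [LieModule ℂ sl3 W] {l : Fin 3 → ℂ}

lemma eq_top_of_irreducible [LieModule.IsIrreducible ℂ sl3 V] {N : Submodule ℂ V}
    (hN : ∀ i j, ∀ v ∈ N, ⁅e i j, v⁆ ∈ N) {v : V} (hv : v ≠ 0) (hvN : v ∈ N) : N = ⊤ := by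
  have h := (IsSimpleOrder.eq_bot_or_eq_top (lieSubmoduleOfStable N hN)).resolve_left fun hb =>
    hv <| by
      have : v ∈ lieSubmoduleOfStable N hN := hvN
      rwa [hb, LieSubmodule.mem_bot] at this
  rw [eq_top_iff]
  intro x _
  have : x ∈ lieSubmoduleOfStable N hN := by rw [h]; exact LieSubmodule.mem_top x
  exact this

lemma eq_zero_of_irreducible [LieModule.IsIrreducible ℂ sl3 V] {N : Submodule ℂ V}
    (hN : ∀ i j, ∀ v ∈ N, ⁅e i j, v⁆ ∈ N) {v : V} (hvN : v ∉ N) {x : V} (hx : x ∈ N) : x = 0 := by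
  by_contra h
  exact hvN (by rw [eq_top_of_irreducible hN h hx]; exact Submodule.mem_top)

/-- The submodule of `V × W` generated by `(v, w)` is the graph of an isomorphism. Its projections
are onto by irreducibility. It contains neither `(v, 0)` nor `(0, w)`, because its vectors of that
weight are the multiples of `(v, w)`; irreducibility again makes the projections injective. -/
lemma exists_equiv_of_isHighest [LieModule.IsIrreducible ℂ sl3 V] [LieModule.IsIrreducible ℂ sl3 W]
    {v : V} (hv : IsHighest (units V) l v) (hv0 : v ≠ 0) {w : W} (hw : IsHighest (units W) l w)
    (hw0 : w ≠ 0) :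
    ∃ f : V ≃ₗ[ℂ] W, ∀ i j x, f (units V i j x) = units W i j (f x) := by
  let E : Fin 3 → Fin 3 → Module.End ℂ (V × W) := fun i j => (units V i j).prodMap (units W i j)
  have hE : IsMatrixUnits E := by
    intro i j k l
    apply LinearMap.ext
    rintro ⟨a, b⟩
    have h1 := isMatrixUnits_units.apply i j k l a
    have h2 := isMatrixUnits_units.apply i j k l b
    simp only [E, Module.End.mul_apply, LinearMap.add_apply, LinearMap.sub_apply,
      LinearMap.prodMap_apply, h1, h2]
    split_ifs <;> simp
  have hvw : IsHighest E l (v, w) :=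
    ⟨fun i j hij => by simp [E, hv.raise i j hij, hw.raise i j hij],
      fun i => by simp [E, hv.weight, hw.weight]⟩
  let S := loweringSpan E (v, w)
  have hS : ∀ i j x y, (x, y) ∈ S → (⁅e i j, x⁆, ⁅e i j, y⁆) ∈ S := fun i j x y h =>
    hvw.loweringSpan_stable hE i j h
  have h1 : (v, (0 : W)) ∉ S := by
    intro h
    obtain ⟨c, hc⟩ := hvw.eq_smul_of_mem hE h (by simp [E, hv.weight, sub_smul])
    obtain ⟨hc1, hc2⟩ := Prod.mk.inj hc
    have : c = 0 := by simpa [hw0, eq_comm] using hc2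
    exact hv0 (by simpa [this] using hc1)
  have h2 : ((0 : V), w) ∉ S := by
    intro h
    obtain ⟨c, hc⟩ := hvw.eq_smul_of_mem hE h (by simp [E, hw.weight, sub_smul])
    obtain ⟨hc1, hc2⟩ := Prod.mk.inj hc
    have : c = 0 := by simpa [hv0, eq_comm] using hc1
    exact hw0 (by simpa [this] using hc2)
  have inj1 : ∀ x, (x, (0 : W)) ∈ S → x = 0 := fun x hx =>
    eq_zero_of_irreducible (N := S.comap (LinearMap.inl ℂ V W))
      (fun i j y hy => by simpa using hS i j y 0 hy) (v := v) h1 hx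
  have inj2 : ∀ y, ((0 : V), y) ∈ S → y = 0 := fun y hy =>
    eq_zero_of_irreducible (N := S.comap (LinearMap.inr ℂ V W))
      (fun i j y hy => by simpa using hS i j 0 y hy) (v := w) h2 hy
  have surj1 : S.map (LinearMap.fst ℂ V W) = ⊤ := by
    refine eq_top_of_irreducible ?_ hv0 ⟨(v, w), self_mem_loweringSpan, rfl⟩
    rintro i j _ ⟨⟨x, y⟩, hxy, rfl⟩
    exact ⟨_, hS i j x y hxy, rfl⟩
  have surj2 : S.map (LinearMap.snd ℂ V W) = ⊤ := by
    refine eq_top_of_irreducible ?_ hw0 ⟨(v, w), self_mem_loweringSpan, rfl⟩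
    rintro i j _ ⟨⟨x, y⟩, hxy, rfl⟩
    exact ⟨_, hS i j x y hxy, rfl⟩
  let f1 : S ≃ₗ[ℂ] V := LinearEquiv.ofBijective ((LinearMap.fst ℂ V W).domRestrict S) (by
    constructor
    · rw [← LinearMap.ker_eq_bot, LinearMap.ker_eq_bot']
      rintro ⟨⟨x, y⟩, hxy⟩ h
      obtain rfl : x = 0 := h
      simp [inj2 y hxy]
    · intro x
      obtain ⟨y, hy, rfl⟩ : x ∈ S.map (LinearMap.fst ℂ V W) := by rw [surj1]; trivial
      exact ⟨⟨y, hy⟩, rfl⟩)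
  let f2 : S ≃ₗ[ℂ] W := LinearEquiv.ofBijective ((LinearMap.snd ℂ V W).domRestrict S) (by
    constructor
    · rw [← LinearMap.ker_eq_bot, LinearMap.ker_eq_bot']
      rintro ⟨⟨x, y⟩, hxy⟩ h
      obtain rfl : y = 0 := h
      simp [inj1 x hxy]
    · intro x
      obtain ⟨y, hy, rfl⟩ : x ∈ S.map (LinearMap.snd ℂ V W) := by rw [surj2]; trivial
      exact ⟨⟨y, hy⟩, rfl⟩)
  refine ⟨f1.symm.trans f2, fun i j x => ?_⟩
  obtain ⟨⟨⟨x, y⟩, hxy⟩, rfl⟩ := f1.surjective x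
  have e1 : units V i j (f1 ⟨(x, y), hxy⟩) = f1 ⟨_, hS i j x y hxy⟩ := rfl
  rw [e1]
  simp only [LinearEquiv.trans_apply, LinearEquiv.symm_apply_apply]
  rfl

end Unique

/-! ### The model is irreducible -/

namespace Pol

variable {p q : ℕ}

/-- The highest weight vector of the model. -/
def highestVector (p q : ℕ) : model p q := ⟨mon p 0 0 0 0 q, mon_mem_model (by simp) (by simp)⟩

lemma highestVector_ne_zero : highestVector p q ≠ 0 := by
  intro h
  exact mon_ne_zero p 0 0 0 0 q (congrArg Subtype.val h)

lemma coe_units (i j : Fin 3) (f : model p q) : (units (model p q) i j f : Pol) = ⁅e i j, (f :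
    Pol)⁆ :=
  rfl

lemma isHighest_highestVector : IsHighest (units (model p q)) (diagWeight p q) (highestVector p q)
    := by
  constructor
  · intro i j hij
    apply Subtype.ext
    rw [coe_units]
    have cases3 : ∀ i j : Fin 3, i < j → (i = 0 ∧ j = 1) ∨ (i = 1 ∧ j = 2) ∨ (i = 0 ∧ j = 2) := by
      decide
    rcases cases3 i j hij with ⟨rfl, rfl⟩ | ⟨rfl, rfl⟩ | ⟨rfl, rfl⟩
    · change ⁅e 0 1, mon p 0 0 0 0 q⁆ = 0
      rw [lie_mon_zero_one]; simp
    · change ⁅e 1 2, mon p 0 0 0 0 q⁆ = 0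
      rw [lie_mon_one_two]; simp
    · change ⁅e 0 2, mon p 0 0 0 0 q⁆ = 0
      rw [lie_mon_zero_two]; simp
  · intro i
    apply Subtype.ext
    change ⁅e i i, mon p 0 0 0 0 q⁆ = _ • mon p 0 0 0 0 q
    rw [lie_mon_diag]
    congr 1
    fin_cases i <;> simp [diagWeight] <;> ring

/-- A nonzero submodule contains the highest weight vector by `highest_mem_of_stable`, and this
vector generates everything by `mon_mem_of_highest`. -/
lemma isIrreducible_model : LieModule.IsIrreducible ℂ sl3 (model p q) := by
  refine { exists_pair_ne := ⟨⊥, ⊤, fun h => ?_⟩, eq_bot_or_eq_top := fun N => ?_ }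
  · have : highestVector p q ∈ (⊥ : LieSubmodule ℂ sl3 (model p q)) := by
      rw [h]; exact LieSubmodule.mem_top _
    exact highestVector_ne_zero ((LieSubmodule.mem_bot _).1 this)
  · rw [or_iff_not_imp_left]
    intro hN
    let N' : LieSubmodule ℂ sl3 Pol := N.map (model p q).incl
    have hle : (N' : Submodule ℂ Pol) ≤ modelSpan p q := by
      rintro _ ⟨f, -, rfl⟩
      exact f.2
    have hne : (N' : Submodule ℂ Pol) ≠ ⊥ := by
      intro h
      apply hN
      rw [LieSubmodule.eq_bot_iff]
      intro f hf
      have : (f : Pol) ∈ (N' : Submodule ℂ Pol) := ⟨f, hf, rfl⟩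
      rw [h, Submodule.mem_bot] at this
      exact Subtype.ext this
    have hv := highest_mem_of_stable hle hne (fun f hf => N'.lie_mem hf) (fun f hf => N'.lie_mem hf)
    have hge : modelSpan p q ≤ N' := by
      refine Submodule.span_le.2 ?_
      rintro _ ⟨a0, a1, a2, b0, b1, b2, h1, h2, rfl⟩
      exact mon_mem_of_highest N' hv h1 h2
    rw [eq_top_iff]
    intro f _
    obtain ⟨g, hg, hgf⟩ := hge f.2
    obtain rfl : g = f := Subtype.ext hgf
    exact hg

lemma isIrrep_model : IsIrrep (p + 1 : ℕ) (q + 1 : ℕ) (model p q) where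
  finiteDimensional := inferInstance
  irreducible := isIrreducible_model
  exists_highestWeight := by
    refine ⟨highestVector p q, highestVector_ne_zero, isHighest_highestVector.raise, ?_, ?_⟩
    · have h0 := isHighest_highestVector (p := p) (q := q).weight 0
      have h1 := isHighest_highestVector (p := p) (q := q).weight 1
      rw [units_apply] at h0 h1
      change ⁅e 0 0 - e 1 1, _⁆ = _
      rw [sub_lie, h0, h1, ← sub_smul]
      congr 1
      simp [diagWeight]
      ring
    · have h0 := isHighest_highestVector (p := p) (q := q).weight 1
      have h1 := isHighest_highestVector (p := p) (q := q).weight 2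
      rw [units_apply] at h0 h1
      change ⁅e 1 1 - e 2 2, _⁆ = _
      rw [sub_lie, h0, h1, ← sub_smul]
      congr 1
      simp [diagWeight]
      ring

end Pol

lemma IsIrrep.exists_equiv_model {V : Type*} [AddCommGroup V] [Module ℂ V] [LieRingModule sl3 V]
    [LieModule ℂ sl3 V] {p q : ℕ} (hV : IsIrrep (p + 1 : ℕ) (q + 1 : ℕ) V) :
    ∃ f : V ≃ₗ[ℂ] Pol.model p q, ∀ i j x, f (units V i j x) = units (Pol.model p q) i j (f x) := by
  have := hV.irreducible
  have := Pol.isIrreducible_model (p := p) (q := q)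
  obtain ⟨v, hv0, hv⟩ := hV.exists_isHighest
  refine exists_equiv_of_isHighest (l := diagWeight p q) ?_ hv0 Pol.isHighest_highestVector
    Pol.highestVector_ne_zero
  simpa using hv

/-! ### Naturality -/

section Natural

variable {V V' W W' : Type*}
  [AddCommGroup V] [Module ℂ V] [LieRingModule sl3 V] [LieModule ℂ sl3 V]
  [AddCommGroup V'] [Module ℂ V'] [LieRingModule sl3 V'] [LieModule ℂ sl3 V']
  [AddCommGroup W] [Module ℂ W] [LieRingModule sl3 W] [LieModule ℂ sl3 W]
  [AddCommGroup W'] [Module ℂ W'] [LieRingModule sl3 W'] [LieModule ℂ sl3 W']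

/-- The elements of `U ⊗ U` whose action commutes with `f ⊗ f'`. -/
def naturalElements (f : V →ₗ[ℂ] W) (f' : V' →ₗ[ℂ] W') : Subalgebra ℂ (U ⊗[ℂ] U) where
  carrier := {Z | ∀ w, TensorProduct.map f f' (act V V' Z w) =
      act W W' Z (TensorProduct.map f f' w)}
  mul_mem' := by
    intro a b ha hb w
    simp only [map_mul, Module.End.mul_apply]
    rw [ha, hb]
  add_mem' := by
    intro a b ha hb w
    simp only [map_add, LinearMap.add_apply]
    rw [ha, hb]
  algebraMap_mem' := by
    intro c w
    simp [Algebra.algebraMap_eq_smul_one]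

variable {f : V →ₗ[ℂ] W} {f' : V' →ₗ[ℂ] W'}

/-- `f` commutes with the action of the generators. -/
def Intertwines (f : V →ₗ[ℂ] W) : Prop := ∀ i j v, f (units V i j v) = units W i j (f v)

lemma eMat_mem_naturalElements (hf : Intertwines f) (hf' : Intertwines f') (a : Fin 2)
    (i j : Fin 3) : eMat a i j ∈ naturalElements f f' := by
  intro w
  have ha : a = 0 ∨ a = 1 := by fin_cases a <;> simp
  induction w with
  | zero => simp
  | add x y hx hy => simp only [map_add, hx, hy]
  | tmul v v' =>
    rcases ha with rfl | rfl
    · simp only [eMat, Matrix.of_apply, act_copy_zero_tmul, TensorProduct.map_tmul]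
      rw [← units_apply, hf, units_apply]
    · simp only [eMat, Matrix.of_apply, act_copy_one_tmul, TensorProduct.map_tmul]
      rw [← units_apply, hf', units_apply]

lemma prod_apply_mem {S : Subalgebra ℂ (U ⊗[ℂ] U)}
    {L : List (Matrix (Fin 3) (Fin 3) (U ⊗[ℂ] U))} (hL : ∀ A ∈ L, ∀ i j, A i j ∈ S) (i j : Fin 3) :
    L.prod i j ∈ S := by
  induction L generalizing i j with
  | nil =>
    rw [List.prod_nil, Matrix.one_apply]
    split_ifs
    · exact one_mem S
    · exact zero_mem S
  | cons A L ih =>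
    rw [List.prod_cons, Matrix.mul_apply]
    exact sum_mem fun k _ => mul_mem (hL A (by simp) i k)
      (ih (fun B hB => hL B (List.mem_cons_of_mem _ hB)) k j)

lemma T_mem_naturalElements (hf : Intertwines f) (hf' : Intertwines f') (as : List (Fin 2)) :
    T as ∈ naturalElements f f' := by
  rw [T, Matrix.trace]
  refine sum_mem fun i _ => prod_apply_mem ?_ i i
  intro A hA
  obtain ⟨a, -, rfl⟩ := List.mem_map.1 hA
  exact fun i j => eMat_mem_naturalElements hf hf' a j i

lemma Tbar_mem_naturalElements (hf : Intertwines f) (hf' : Intertwines f') (as : List (Fin 2)) :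
    Tbar as ∈ naturalElements f f' := by
  rw [Tbar, Matrix.trace]
  refine sum_mem fun i _ => prod_apply_mem ?_ i i
  intro A hA
  obtain ⟨a, -, rfl⟩ := List.mem_map.1 hA
  exact fun i j => eMat_mem_naturalElements hf hf' a i j

lemma X_mem_naturalElements (hf : Intertwines f) (hf' : Intertwines f') :
    X ∈ naturalElements f f' := by
  have hT := T_mem_naturalElements hf hf'
  have hB := Tbar_mem_naturalElements hf hf'
  have hc : ∀ a, cubicCasimir a ∈ naturalElements f f' := fun a =>
    Subalgebra.smul_mem _ (add_mem (hB _) (hT _)) _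
  exact add_mem (Subalgebra.smul_mem _ (sub_mem (hT _) (hT _)) _)
    (Subalgebra.smul_mem _ (sub_mem (hc _) (hc _)) _)

lemma Y_mem_naturalElements (hf : Intertwines f) (hf' : Intertwines f') :
    Y ∈ naturalElements f f' := by
  have hT := T_mem_naturalElements hf hf'
  have hB := Tbar_mem_naturalElements hf hf'
  exact sub_mem (sub_mem (sub_mem (Subalgebra.smul_mem _ (add_mem (hT _) (hB _)) _)
    (Subalgebra.smul_mem _ (pow_mem (hT _) _) _)) (Subalgebra.smul_mem _ (mul_mem (hT _) (hT _)) _))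
    (Subalgebra.smul_mem _ (hT _) _)

lemma map_diagUnits (hf : Intertwines f) (hf' : Intertwines f') (i j : Fin 3) (w : V ⊗[ℂ] V') :
    TensorProduct.map f f' (diagUnits V V' i j w) =
      diagUnits W W' i j (TensorProduct.map f f' w) :=
  add_mem (eMat_mem_naturalElements hf hf' 0 i j) (eMat_mem_naturalElements hf hf' 1 i j) w

lemma IsHighest.map (hf : Intertwines f) (hf' : Intertwines f') {n : Fin 3 → ℂ} {w : V ⊗[ℂ] V'}
    (hw : IsHighest (diagUnits V V') n w) :
    IsHighest (diagUnits W W') n (TensorProduct.map f f' w) :=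
  ⟨fun i j hij => by rw [← map_diagUnits hf hf', hw.raise i j hij, map_zero],
    fun i => by rw [← map_diagUnits hf hf', hw.weight, map_smul]⟩

lemma IsHighest.of_map (hf : Intertwines f) (hf' : Intertwines f')
    (hinj : Function.Injective (TensorProduct.map f f')) {n : Fin 3 → ℂ} {w : V ⊗[ℂ] V'}
    (hw : IsHighest (diagUnits W W') n (TensorProduct.map f f' w)) :
    IsHighest (diagUnits V V') n w :=
  ⟨fun i j hij => hinj (by rw [map_diagUnits hf hf', hw.raise i j hij, map_zero]),
    fun i => hinj (by rw [map_diagUnits hf hf', hw.weight, map_smul])⟩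

lemma exists_multSpace_equiv (f : V ≃ₗ[ℂ] W) (f' : V' ≃ₗ[ℂ] W')
    (hf : Intertwines (f : V →ₗ[ℂ] W)) (hf' : Intertwines (f' : V' →ₗ[ℂ] W')) (p q : ℚ) :
    ∃ P : multSpace V V' p q ≃ₗ[ℂ] multSpace W W' p q,
      P.conj (physX V V' p q) = physX W W' p q ∧ P.conj (physY V V' p q) = physY W W' p q := by
  have hinj : Function.Injective (TensorProduct.map (f : V →ₗ[ℂ] W) (f' : V' →ₗ[ℂ] W')) :=
    (TensorProduct.congr f f').injective
  have hmap : (multSpace V V' p q).map (TensorProduct.congr f f' : V ⊗[ℂ] V' →ₗ[ℂ] W ⊗[ℂ] W') =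
      multSpace W W' p q := by
    ext w
    constructor
    · rintro ⟨v, hv, rfl⟩
      exact mem_multSpace_of_isHighest ((isHighest_of_mem hv).map hf hf')
    · intro hw
      obtain ⟨v, rfl⟩ := (TensorProduct.congr f f').surjective w
      exact ⟨v, mem_multSpace_of_isHighest ((isHighest_of_mem hw).of_map hf hf' hinj), rfl⟩
  let P := (TensorProduct.congr f f').ofSubmodules _ _ hmap
  have hP : ∀ v, (P v : W ⊗[ℂ] W') = TensorProduct.map (f : V →ₗ[ℂ] W) (f' : V' →ₗ[ℂ] W') v :=
    fun v => rfl
  refine ⟨P, ?_, ?_⟩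
  · apply LinearMap.ext
    intro w
    obtain ⟨v, rfl⟩ := P.surjective w
    rw [LinearEquiv.conj_apply_apply, LinearEquiv.symm_apply_apply]
    apply Subtype.ext
    rw [hP]
    exact X_mem_naturalElements hf hf' _
  · apply LinearMap.ext
    intro w
    obtain ⟨v, rfl⟩ := P.surjective w
    rw [LinearEquiv.conj_apply_apply, LinearEquiv.symm_apply_apply]
    apply Subtype.ext
    rw [hP]
    exact Y_mem_naturalElements hf hf' _

end Natural

/-! ### Contraction with the lowest functional -/

lemma eq_zero_of_contract {V V' : Type*} [AddCommGroup V] [Module ℂ V]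
    [AddCommGroup V'] [Module ℂ V'] {w : V ⊗[ℂ] V'}
    (hw : ∀ φ : V' →ₗ[ℂ] ℂ, contract V φ w = 0) : w = 0 := by
  classical
  let b := Module.Basis.ofVectorSpace ℂ V'
  have key : ∀ (w : V ⊗[ℂ] V') i,
      TensorProduct.equivFinsuppOfBasisRight b w i = contract V (b.coord i) w := by
    intro w i
    induction w with
    | zero => simp
    | add x y hx hy => simp only [map_add, Finsupp.add_apply, hx, hy]
    | tmul v v' => simp [TensorProduct.equivFinsuppOfBasisRight_apply_tmul_apply, contract]
  refine (TensorProduct.equivFinsuppOfBasisRight b).injective ?_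
  ext i
  rw [key, hw]
  simp

section

variable {V V' : Type*} [AddCommGroup V] [Module ℂ V] [LieRingModule sl3 V] [LieModule ℂ sl3 V]
  [AddCommGroup V'] [Module ℂ V'] [LieRingModule sl3 V'] [LieModule ℂ sl3 V']
  {n l : Fin 3 → ℂ} {w : V ⊗[ℂ] V'}

/-- A highest weight vector is killed by the diagonal raising operators, so raising in the second
factor, seen through functionals, is minus raising in the first. -/
lemma IsHighest.contract_comp (hw : IsHighest (diagUnits V V') n w) (φ : V' →ₗ[ℂ] ℂ) {i j : Fin 3}
    (hij : i < j) : contract V (φ ∘ₗ units V' i j) w = -units V i j (contract V φ w) := by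
  rw [← contract_copyUnits_one, hw.contract_raise φ hij]

lemma IsHighest.contract_comp_pow (hw : IsHighest (diagUnits V V') n w) (φ : V' →ₗ[ℂ] ℂ)
    {i j : Fin 3} (hij : i < j) (k : ℕ) : contract V (φ ∘ₗ (units V' i j ^ k)) w =
      (-1 : ℂ) ^ k • (units V i j ^ k) (contract V φ w) := by
  induction k with
  | zero => simp [Module.End.one_eq_id]
  | succ k ih =>
    rw [pow_succ, Module.End.mul_eq_comp, ← LinearMap.comp_assoc, hw.contract_comp _ hij, ih,
      map_smul, pow_succ' (units V i j), Module.End.mul_apply, pow_succ]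
    module

lemma IsHighest.contract_weight (hw : IsHighest (diagUnits V V') n w) {φ : V' →ₗ[ℂ] ℂ}
    (hφ : IsLowestFunctional l φ) (i : Fin 3) :
    units V i i (contract V φ w) = (n i - l i) • contract V φ w := by
  have h1 := congrArg (contract V φ) (hw.weight i)
  rw [diagUnits_apply, map_add, contract_copyUnits_zero, hφ.contract_weight, map_smul] at h1
  rw [sub_smul, ← h1, add_sub_cancel_right]

end

/-! ### The lowest functional of the model and the image of the contraction -/

namespace Pol

variable {p q p' q' : ℕ}

/-- Evaluation at the point where `x = (1, 0, 0)` and `ξ = (0, 0, 1)`. -/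
def evalPoint : Pol →ₐ[ℂ] ℂ := MvPolynomial.aeval
  fun v => (!![1, 0, 0; 0, 1, 0] : Matrix (Fin 2) (Fin 3) ℂ) v.1 v.2

lemma evalPoint_x (i : Fin 3) : evalPoint (x i) = if i = 0 then 1 else 0 := by
  fin_cases i <;> simp [evalPoint, x]

lemma evalPoint_ξ (i : Fin 3) : evalPoint (ξ i) = if i = 2 then 1 else 0 := by
  fin_cases i <;> simp [evalPoint, x, s, ξ]

lemma evalPoint_mon (a0 a1 a2 b0 b1 b2 : ℕ) : evalPoint (mon a0 a1 a2 b0 b1 b2) =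
    if a1 = 0 ∧ a2 = 0 ∧ b0 = 0 ∧ b1 = 0 then 1 else 0 := by
  simp only [mon, map_mul, map_pow, evalPoint_x, evalPoint_ξ]
  by_cases h1 : a1 = 0 <;> by_cases h2 : a2 = 0 <;> by_cases h3 : b0 = 0 <;>
    by_cases h4 : b1 = 0 <;> simp [h1, h2, h3, h4]

/-- Each application of `e 0 1` increases the difference `b1 - a1` by one. Once it is positive, the
monomial contains `ξ 1` and vanishes at the point. -/
lemma evalPoint_pow_zero_one (k a0 a1 a2 b0 b1 b2 : ℕ) (hk : a1 < k + b1) :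
    evalPoint ((units Pol 0 1 ^ k) (mon a0 a1 a2 b0 b1 b2)) = 0 := by
  induction k generalizing a0 a1 a2 b0 b1 b2 with
  | zero => rw [pow_zero, Module.End.one_apply, evalPoint_mon, if_neg (by omega)]
  | succ k ih =>
    rw [pow_succ, Module.End.mul_apply, units_apply, lie_mon_zero_one, map_sub, map_sub, map_smul,
      map_smul, map_smul, map_smul]
    rcases a1 with _ | a1
    · rw [ih _ _ _ (b0 - 1) _ _ (by omega)]; simp
    · rw [ih _ _ _ (b0 - 1) _ _ (by omega), ih _ _ _ _ _ _ (by omega)]; simp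

/-- The same argument with the difference `a1 - b1`, which `e 1 2` increases by one. -/
lemma evalPoint_pow_one_two (k a0 a1 a2 b0 b1 b2 : ℕ) (hk : b1 < k + a1) :
    evalPoint ((units Pol 1 2 ^ k) (mon a0 a1 a2 b0 b1 b2)) = 0 := by
  induction k generalizing a0 a1 a2 b0 b1 b2 with
  | zero => rw [pow_zero, Module.End.one_apply, evalPoint_mon, if_neg (by omega)]
  | succ k ih =>
    rw [pow_succ, Module.End.mul_apply, units_apply, lie_mon_one_two, map_sub, map_sub, map_smul,
      map_smul, map_smul, map_smul]
    rcases b1 with _ | b1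
    · rw [ih _ _ (a2 - 1) _ _ _ (by omega)]; simp
    · rw [ih _ _ (a2 - 1) _ _ _ (by omega), ih _ _ _ _ _ _ (by omega)]; simp

/-- The evaluation functional on the model. -/
def lowestFunctional (p q : ℕ) : model p q →ₗ[ℂ] ℂ :=
  evalPoint.toLinearMap ∘ₗ (model p q : Submodule ℂ Pol).subtype

/-- Two functionals on the model which agree on monomials are equal. -/
lemma model_hom_ext {F G : Pol →ₗ[ℂ] ℂ} (h : ∀ a0 a1 a2 b0 b1 b2 : ℕ, a0 + a1 + a2 = p →
    b0 + b1 + b2 = q → F (mon a0 a1 a2 b0 b1 b2) = G (mon a0 a1 a2 b0 b1 b2)) (f : model p q) :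
    F f = G f := by
  refine LinearMap.eqOn_span (f := F) (g := G) ?_ f.2
  rintro _ ⟨a0, a1, a2, b0, b1, b2, h1, h2, rfl⟩
  exact h _ _ _ _ _ _ h1 h2

/-- Lowering operators produce only monomials divisible by `x 1`, `x 2`, `ξ 0` or `ξ 1`, all of
which vanish at the point. -/
lemma isLowestFunctional : IsLowestFunctional (diagWeight p q) (lowestFunctional p q) := by
  constructor
  · intro i j hij f
    refine model_hom_ext (F := evalPoint.toLinearMap ∘ₗ units Pol i j) (G := 0) ?_ f
    intro a0 a1 a2 b0 b1 b2 _ _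
    have cases3 : ∀ i j : Fin 3, j < i → (i = 1 ∧ j = 0) ∨ (i = 2 ∧ j = 1) ∨ (i = 2 ∧ j = 0) := by
      decide
    simp only [LinearMap.comp_apply, units_apply, AlgHom.toLinearMap_apply, LinearMap.zero_apply]
    rcases cases3 i j hij with ⟨rfl, rfl⟩ | ⟨rfl, rfl⟩ | ⟨rfl, rfl⟩
    · rw [lie_mon_one_zero]; simp [evalPoint_mon]
    · rw [lie_mon_two_one]; simp [evalPoint_mon]
    · rw [lie_mon_two_zero]; simp [evalPoint_mon]
  · intro i f
    refine model_hom_ext (F := evalPoint.toLinearMap ∘ₗ units Pol i i)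
      (G := diagWeight p q i • evalPoint.toLinearMap) ?_ f
    rintro a0 a1 a2 b0 b1 b2 rfl rfl
    simp only [LinearMap.comp_apply, units_apply, AlgHom.toLinearMap_apply, LinearMap.smul_apply,
      lie_mon_diag, map_smul, evalPoint_mon]
    split_ifs with h
    · obtain ⟨rfl, rfl, rfl, rfl⟩ := h
      fin_cases i <;> simp [diagWeight] <;> ring
    · simp

lemma coe_pow_units (i j : Fin 3) (k : ℕ) (f : model p q) :
    ((units (model p q) i j ^ k) f : Pol) = (units Pol i j ^ k) (f : Pol) := by
  induction k generalizing f with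
  | zero => rfl
  | succ k ih =>
    rw [pow_succ, pow_succ, Module.End.mul_apply, Module.End.mul_apply, ih]
    rfl

lemma lowestFunctional_pow_zero_one :
    lowestFunctional p q ∘ₗ (units (model p q) 0 1 ^ (p + 1)) = 0 := by
  apply LinearMap.ext
  intro f
  change evalPoint ((units (model p q) 0 1 ^ (p + 1)) f : Pol) = 0
  rw [coe_pow_units]
  refine model_hom_ext (F := evalPoint.toLinearMap ∘ₗ (units Pol 0 1 ^ (p + 1))) (G := 0) ?_ f
  intro a0 a1 a2 b0 b1 b2 _ _
  exact evalPoint_pow_zero_one _ _ _ _ _ _ _ (by omega)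

lemma lowestFunctional_pow_one_two :
    lowestFunctional p q ∘ₗ (units (model p q) 1 2 ^ (q + 1)) = 0 := by
  apply LinearMap.ext
  intro f
  change evalPoint ((units (model p q) 1 2 ^ (q + 1)) f : Pol) = 0
  rw [coe_pow_units]
  refine model_hom_ext (F := evalPoint.toLinearMap ∘ₗ (units Pol 1 2 ^ (q + 1))) (G := 0) ?_ f
  intro a0 a1 a2 b0 b1 b2 _ _
  exact evalPoint_pow_one_two _ _ _ _ _ _ _ (by omega)

/-- Contraction with the lowest functional is injective on highest weight vectors. -/
lemma eq_zero_of_contract_lowest {V : Type*} [AddCommGroup V] [Module ℂ V] [LieRingModule sl3 V]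
    [LieModule ℂ sl3 V] {n : Fin 3 → ℂ} {w : V ⊗[ℂ] model p q}
    (hw : IsHighest (diagUnits V (model p q)) n w)
    (h0 : contract V (lowestFunctional p q) w = 0) : w = 0 := by
  -- The functionals whose contraction with `w` vanishes. By `contract_comp` this space is stable
  -- under composition with raising operators, so its common kernel is stable under raising.
  let A : Submodule ℂ (Module.Dual ℂ (model p q)) :=
    { carrier := {φ | contract V φ w = 0}
      add_mem' := by
        intro φ ψ hφ hψ
        change contract V (φ + ψ) w = 0
        rw [contract, TensorProduct.map_add_right, LinearMap.comp_add, LinearMap.add_apply]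
        exact (congrArg₂ (· + ·) hφ hψ).trans (add_zero _)
      zero_mem' := by
        change contract V 0 w = 0
        simp [contract]
      smul_mem' := by
        intro c φ hφ
        change contract V (c • φ) w = 0
        rw [contract, TensorProduct.map_smul_right, LinearMap.comp_smul, LinearMap.smul_apply]
        exact (congrArg (c • ·) hφ).trans (smul_zero _) }
  have hA : ∀ φ ∈ A, ∀ i j, i < j → φ ∘ₗ units (model p q) i j ∈ A := by
    intro φ hφ i j hij
    change contract V (φ ∘ₗ units (model p q) i j) w = 0
    rw [hw.contract_comp φ hij, show contract V φ w = 0 from hφ, map_zero, neg_zero]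
  -- If nonzero, the common kernel would contain the highest weight vector. But the lowest
  -- functional belongs to `A` and takes the value `1` there.
  have hbot : A.dualCoannihilator = ⊥ := by
    by_contra hne
    have hv : mon p 0 0 0 0 q ∈
        A.dualCoannihilator.map (model p q : Submodule ℂ Pol).subtype := by
      refine highest_mem_of_stable ?_ ?_ ?_ ?_
      · rintro _ ⟨f, -, rfl⟩
        exact f.2
      · intro h
        exact hne (Submodule.map_injective_of_injective (Submodule.subtype_injective _)
          (h.trans (Submodule.map_bot _).symm))
      · rintro _ ⟨f, hf, rfl⟩
        refine ⟨units (model p q) 0 1 f, ?_, rfl⟩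
        rw [SetLike.mem_coe, Submodule.mem_dualCoannihilator] at hf ⊢
        exact fun φ hφ => hf _ (hA φ hφ 0 1 (by decide))
      · rintro _ ⟨f, hf, rfl⟩
        refine ⟨units (model p q) 1 2 f, ?_, rfl⟩
        rw [SetLike.mem_coe, Submodule.mem_dualCoannihilator] at hf ⊢
        exact fun φ hφ => hf _ (hA φ hφ 1 2 (by decide))
    obtain ⟨f, hf, hfv⟩ := hv
    rw [SetLike.mem_coe, Submodule.mem_dualCoannihilator] at hf
    have h1 : evalPoint (f : Pol) = 0 := hf (lowestFunctional p q) h0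
    have h2 : (f : Pol) = mon p 0 0 0 0 q := hfv
    rw [h2, evalPoint_mon] at h1
    simp at h1
  have htop : A = ⊤ := by
    have h1 : A.dualCoannihilator.dualAnnihilator = A :=
      Subspace.dualCoannihilator_dualAnnihilator_eq
    rw [← h1, hbot, Submodule.dualAnnihilator_bot]
  refine eq_zero_of_contract fun φ => ?_
  have : φ ∈ A := by rw [htop]; trivial
  exact this

/-- The contraction of a highest weight vector is a combination of the allowed monomials. -/
lemma contract_mem_span {n : Fin 3 → ℂ} {w : model p q ⊗[ℂ] model p' q'}
    (hw : IsHighest (diagUnits (model p q) (model p' q')) n w) :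
    (contract (model p q) (lowestFunctional p' q') w : Pol) ∈ Submodule.span ℂ
      (monomial '' boundedExponents p q (fun i => n i - diagWeight p' q' i) p' q') := by
  refine mem_span_bounded (SetLike.coe_mem _) (fun i => ?_) ?_ ?_
  · have := congrArg Subtype.val (hw.contract_weight isLowestFunctional i)
    exact this
  · have h1 := hw.contract_comp_pow (lowestFunctional p' q') (show (0 : Fin 3) < 1 by decide)
      (p' + 1)
    rw [lowestFunctional_pow_zero_one] at h1
    have h2 : (units (model p q) 0 1 ^ (p' + 1))
        (contract (model p q) (lowestFunctional p' q') w) = 0 := by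
      refine (smul_eq_zero.1 (h1.symm.trans ?_)).resolve_left (by simp)
      simp [contract]
    rw [← coe_pow_units, h2]
    rfl
  · have h1 := hw.contract_comp_pow (lowestFunctional p' q') (show (1 : Fin 3) < 2 by decide)
      (q' + 1)
    rw [lowestFunctional_pow_one_two] at h1
    have h2 : (units (model p q) 1 2 ^ (q' + 1))
        (contract (model p q) (lowestFunctional p' q') w) = 0 := by
      refine (smul_eq_zero.1 (h1.symm.trans ?_)).resolve_left (by simp)
      simp [contract]
    rw [← coe_pow_units, h2]
    rfl

end Pol

namespace Pol

/-! ### Highest weight vectors as products of invariants -/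

lemma diagUnits_tmul (i j : Fin 3) (f g : Pol) :
    diagUnits Pol Pol i j (f ⊗ₜ g) = ⁅e i j, f⁆ ⊗ₜ g + f ⊗ₜ ⁅e i j, g⁆ := by
  rw [diagUnits_apply]
  simp [copyUnits, eMat]

lemma diagUnits_mul (i j : Fin 3) (a b : Pol ⊗[ℂ] Pol) :
    diagUnits Pol Pol i j (a * b) = diagUnits Pol Pol i j a * b + a * diagUnits Pol Pol i j b := by
  induction a with
  | zero => simp
  | add a a' ha ha' => rw [add_mul, map_add, ha, ha', map_add]; ring
  | tmul f g =>
    induction b with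
    | zero => simp
    | add b b' hb hb' => rw [mul_add, map_add, hb, hb', map_add]; ring
    | tmul f' g' =>
      simp only [Algebra.TensorProduct.tmul_mul_tmul, diagUnits_tmul, lie_mul, add_mul, mul_add,
        TensorProduct.add_tmul, TensorProduct.tmul_add]
      abel

lemma IsHighest.mul {l l' : Fin 3 → ℂ} {a b : Pol ⊗[ℂ] Pol}
    (ha : IsHighest (diagUnits Pol Pol) l a) (hb : IsHighest (diagUnits Pol Pol) l' b) :
    IsHighest (diagUnits Pol Pol) (l + l') (a * b) :=
  ⟨fun i j hij => by rw [diagUnits_mul, ha.raise i j hij, hb.raise i j hij]; simp,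
    fun i => by
      rw [diagUnits_mul, ha.weight, hb.weight, smul_mul_assoc, mul_smul_comm, ← add_smul]; rfl⟩

/-- The forms of given degrees in two pairs of variables. -/
def bimodel (p q p' q' : ℕ) : Submodule ℂ (Pol ⊗[ℂ] Pol) :=
  Submodule.span ℂ {w | ∃ f ∈ model p q, ∃ g ∈ model p' q', w = f ⊗ₜ g}

variable {p q p' q' r s r' s' : ℕ}

lemma mul_mem_model {f g : Pol} (hf : f ∈ model p q) (hg : g ∈ model r s) :
    f * g ∈ model (p + r) (q + s) := by
  have h := Submodule.mul_mem_mul (mem_model.1 hf) (mem_model.1 hg)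
  rw [modelSpan, modelSpan, Submodule.span_mul_span] at h
  refine Submodule.span_le.2 ?_ h
  rintro _ ⟨_, ⟨a0, a1, a2, b0, b1, b2, h1, h2, rfl⟩, _, ⟨c0, c1, c2, d0, d1, d2, h3, h4, rfl⟩, rfl⟩
  have : mon a0 a1 a2 b0 b1 b2 * mon c0 c1 c2 d0 d1 d2 =
      mon (a0 + c0) (a1 + c1) (a2 + c2) (b0 + d0) (b1 + d1) (b2 + d2) := by
    simp only [mon]; ring
  simp only [SetLike.mem_coe, this]
  exact mon_mem_model (by omega) (by omega)

lemma mul_mem_bimodel {a b : Pol ⊗[ℂ] Pol} (ha : a ∈ bimodel p q p' q')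
    (hb : b ∈ bimodel r s r' s') : a * b ∈ bimodel (p + r) (q + s) (p' + r') (q' + s') := by
  have h := Submodule.mul_mem_mul ha hb
  rw [bimodel, bimodel, Submodule.span_mul_span] at h
  refine Submodule.span_le.2 ?_ h
  rintro _ ⟨_, ⟨f, hf, g, hg, rfl⟩, _, ⟨f', hf', g', hg', rfl⟩, rfl⟩
  exact Submodule.subset_span ⟨_, mul_mem_model hf hf', _, mul_mem_model hg hg',
    Algebra.TensorProduct.tmul_mul_tmul _ _ _ _⟩

lemma bimodel_le_range : bimodel p q p' q' ≤ LinearMap.range (TensorProduct.map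
    (model p q : Submodule ℂ Pol).subtype (model p' q' : Submodule ℂ Pol).subtype) := by
  refine Submodule.span_le.2 ?_
  rintro _ ⟨f, hf, g, hg, rfl⟩
  exact ⟨(⟨f, hf⟩ : model p q) ⊗ₜ (⟨g, hg⟩ : model p' q'), rfl⟩

/-- Highest weight vectors in the space of forms of given degrees. -/
structure IsCovariant (p q p' q' P Q : ℕ) (a : Pol ⊗[ℂ] Pol) : Prop where
  mem : a ∈ bimodel p q p' q'
  highest : IsHighest (diagUnits Pol Pol) (diagWeight P Q) a

lemma diagWeight_add (P Q P' Q' : ℂ) :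
    diagWeight P Q + diagWeight P' Q' = diagWeight (P + P') (Q + Q') := by
  ext i; fin_cases i <;> simp [diagWeight] <;> ring

variable {P Q P' Q' : ℕ} {a b : Pol ⊗[ℂ] Pol}

lemma IsCovariant.mul (ha : IsCovariant p q p' q' P Q a) (hb : IsCovariant r s r' s' P' Q' b) :
    IsCovariant (p + r) (q + s) (p' + r') (q' + s') (P + P') (Q + Q') (a * b) :=
  ⟨mul_mem_bimodel ha.mem hb.mem, by
    have := IsHighest.mul ha.highest hb.highest
    rw [diagWeight_add] at this
    push_cast
    exact this⟩

lemma x_mem (i : Fin 3) : x i ∈ model 1 0 := by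
  fin_cases i
  · simpa [mon] using mon_mem_model (a0 := 1) (a1 := 0) (a2 := 0) (b0 := 0) (b1 := 0)
      (b2 := 0) rfl rfl
  · simpa [mon] using mon_mem_model (a0 := 0) (a1 := 1) (a2 := 0) (b0 := 0) (b1 := 0)
      (b2 := 0) rfl rfl
  · simpa [mon] using mon_mem_model (a0 := 0) (a1 := 0) (a2 := 1) (b0 := 0) (b1 := 0)
      (b2 := 0) rfl rfl

lemma ξ_mem (i : Fin 3) : ξ i ∈ model 0 1 := by
  fin_cases i
  · simpa [mon] using mon_mem_model (a0 := 0) (a1 := 0) (a2 := 0) (b0 := 1) (b1 := 0)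
      (b2 := 0) rfl rfl
  · simpa [mon] using mon_mem_model (a0 := 0) (a1 := 0) (a2 := 0) (b0 := 0) (b1 := 1)
      (b2 := 0) rfl rfl
  · simpa [mon] using mon_mem_model (a0 := 0) (a1 := 0) (a2 := 0) (b0 := 0) (b1 := 0)
      (b2 := 1) rfl rfl

lemma one_mem : (1 : Pol) ∈ model 0 0 := by
  simpa [mon] using mon_mem_model (a0 := 0) (a1 := 0) (a2 := 0) (b0 := 0) (b1 := 0)
      (b2 := 0) rfl rfl

lemma tmul_mem {f g : Pol} (hf : f ∈ model p q) (hg : g ∈ model p' q') :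
    f ⊗ₜ g ∈ bimodel p q p' q' := Submodule.subset_span ⟨f, hf, g, hg, rfl⟩

lemma lie_one (y : sl3) : ⁅y, (1 : Pol)⁆ = 0 := (der y.1).map_one_eq_zero

lemma isHighest_of_cases {l : Fin 3 → ℂ} (h01 : diagUnits Pol Pol 0 1 a = 0)
    (h12 : diagUnits Pol Pol 1 2 a = 0) (h02 : diagUnits Pol Pol 0 2 a = 0)
    (h0 : diagUnits Pol Pol 0 0 a = l 0 • a) (h1 : diagUnits Pol Pol 1 1 a = l 1 • a)
    (h2 : diagUnits Pol Pol 2 2 a = l 2 • a) : IsHighest (diagUnits Pol Pol) l a := by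
  constructor
  · have cases3 : ∀ i j : Fin 3, i < j → (i = 0 ∧ j = 1) ∨ (i = 1 ∧ j = 2) ∨ (i = 0 ∧ j = 2) := by
      decide
    intro i j hij
    rcases cases3 i j hij with ⟨rfl, rfl⟩ | ⟨rfl, rfl⟩ | ⟨rfl, rfl⟩ <;> assumption
  · intro i
    fin_cases i <;> assumption

lemma isCovariant_one : IsCovariant 0 0 0 0 0 0 1 :=
  ⟨tmul_mem one_mem one_mem, by
    rw [Algebra.TensorProduct.one_def]
    apply isHighest_of_cases <;> rw [diagUnits_tmul] <;> simp [lie_one, diagWeight]⟩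

lemma IsCovariant.pow (ha : IsCovariant p q p' q' P Q a) (k : ℕ) :
    IsCovariant (k * p) (k * q) (k * p') (k * q') (k * P) (k * Q) (a ^ k) := by
  induction k with
  | zero => simpa using isCovariant_one
  | succ k ih =>
    rw [pow_succ]
    simp only [Nat.succ_mul]
    exact ih.mul ha

/-- This and the next seven lemmas give the elementary covariants. Under `contractHom` they become
`x 0`, `1`, `ξ 2`, `1`, `x 2`, `ξ 0`, `x 1` and `ξ 1`, in this order. -/
lemma isCovariant_x : IsCovariant 1 0 0 0 1 0 (x 0 ⊗ₜ 1) :=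
  ⟨tmul_mem (x_mem 0) one_mem, by
    apply isHighest_of_cases <;> rw [diagUnits_tmul, lie_one, lie_x] <;>
      simp [diagWeight, ← TensorProduct.smul_tmul', TensorProduct.sub_tmul,
        TensorProduct.neg_tmul, TensorProduct.tmul_neg] <;> module⟩

lemma isCovariant_x' : IsCovariant 0 0 1 0 1 0 (1 ⊗ₜ x 0) :=
  ⟨tmul_mem one_mem (x_mem 0), by
    apply isHighest_of_cases <;> rw [diagUnits_tmul, lie_one, lie_x] <;>
      simp [diagWeight, TensorProduct.tmul_sub, TensorProduct.tmul_neg] <;> module⟩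

lemma isCovariant_ξ : IsCovariant 0 1 0 0 0 1 (ξ 2 ⊗ₜ 1) :=
  ⟨tmul_mem (ξ_mem 2) one_mem, by
    apply isHighest_of_cases <;> rw [diagUnits_tmul, lie_one, lie_ξ] <;>
      simp [diagWeight, ← TensorProduct.smul_tmul', TensorProduct.sub_tmul,
        TensorProduct.neg_tmul, TensorProduct.tmul_neg] <;> module⟩

lemma isCovariant_ξ' : IsCovariant 0 0 0 1 0 1 (1 ⊗ₜ ξ 2) :=
  ⟨tmul_mem one_mem (ξ_mem 2), by
    apply isHighest_of_cases <;> rw [diagUnits_tmul, lie_one, lie_ξ] <;>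
      simp [diagWeight, TensorProduct.tmul_sub, TensorProduct.tmul_neg] <;> module⟩

lemma isCovariant_pairing : IsCovariant 1 0 0 1 0 0 (x 0 ⊗ₜ ξ 0 + x 1 ⊗ₜ ξ 1 + x 2 ⊗ₜ ξ 2) :=
  ⟨add_mem (add_mem (tmul_mem (x_mem 0) (ξ_mem 0)) (tmul_mem (x_mem 1) (ξ_mem 1)))
    (tmul_mem (x_mem 2) (ξ_mem 2)), by
    apply isHighest_of_cases <;>
      simp [diagUnits_tmul, lie_x, lie_ξ, diagWeight, ← TensorProduct.smul_tmul',
        TensorProduct.tmul_sub, TensorProduct.sub_tmul,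
        TensorProduct.neg_tmul, TensorProduct.tmul_neg] <;> module⟩

lemma isCovariant_pairing' : IsCovariant 0 1 1 0 0 0 (ξ 0 ⊗ₜ x 0 + ξ 1 ⊗ₜ x 1 + ξ 2 ⊗ₜ x 2) :=
  ⟨add_mem (add_mem (tmul_mem (ξ_mem 0) (x_mem 0)) (tmul_mem (ξ_mem 1) (x_mem 1)))
    (tmul_mem (ξ_mem 2) (x_mem 2)), by
    apply isHighest_of_cases <;>
      simp [diagUnits_tmul, lie_x, lie_ξ, diagWeight, ← TensorProduct.smul_tmul',
        TensorProduct.tmul_sub, TensorProduct.sub_tmul,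
        TensorProduct.neg_tmul, TensorProduct.tmul_neg] <;> module⟩

lemma isCovariant_minor : IsCovariant 1 0 1 0 0 1 (x 1 ⊗ₜ x 0 - x 0 ⊗ₜ x 1) :=
  ⟨sub_mem (tmul_mem (x_mem 1) (x_mem 0)) (tmul_mem (x_mem 0) (x_mem 1)), by
    apply isHighest_of_cases <;>
      simp [diagUnits_tmul, lie_x, diagWeight, ← TensorProduct.smul_tmul',
        TensorProduct.tmul_sub, TensorProduct.sub_tmul,
        TensorProduct.neg_tmul, TensorProduct.tmul_neg] <;> module⟩

lemma isCovariant_minor' : IsCovariant 0 1 0 1 1 0 (ξ 1 ⊗ₜ ξ 2 - ξ 2 ⊗ₜ ξ 1) :=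
  ⟨sub_mem (tmul_mem (ξ_mem 1) (ξ_mem 2)) (tmul_mem (ξ_mem 2) (ξ_mem 1)), by
    apply isHighest_of_cases <;>
      simp [diagUnits_tmul, lie_ξ, diagWeight, ← TensorProduct.smul_tmul',
        TensorProduct.tmul_sub, TensorProduct.sub_tmul,
        TensorProduct.neg_tmul, TensorProduct.tmul_neg] <;> module⟩

/-- Contraction of the second factor with the evaluation, as a homomorphism. -/
def contractHom : Pol ⊗[ℂ] Pol →ₐ[ℂ] Pol :=
  Algebra.TensorProduct.lift (AlgHom.id ℂ Pol) ((Algebra.ofId ℂ Pol).comp evalPoint)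
    fun _ _ => Commute.all _ _

lemma contractHom_tmul (f g : Pol) : contractHom (f ⊗ₜ g) = evalPoint g • f := by
  simp [contractHom, Algebra.ofId_apply, Algebra.smul_def, mul_comm]

lemma coe_contract (w : model p q ⊗[ℂ] model p' q') :
    (contract (model p q) (lowestFunctional p' q') w : Pol) =
      contractHom (TensorProduct.map (model p q : Submodule ℂ Pol).subtype
        (model p' q' : Submodule ℂ Pol).subtype w) := by
  induction w with
  | zero => simp
  | add x y hx hy => simp only [map_add, ← hx, ← hy]; rfl
  | tmul f g =>
    rw [contract_tmul, TensorProduct.map_tmul, contractHom_tmul]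
    rfl

/-- Each allowed monomial is the contraction of a highest weight vector. -/
lemma exists_contract_eq_mon {a0 a1 a2 b0 b1 b2 κ₁ κ₂ : ℕ} (hp : p = a0 + b0 + κ₁)
    (hq : q = a1 + b2 + κ₂) (hp' : p' = a1 + b1 + κ₁) (hq' : q' = a2 + b0 + κ₂)
    (hP : P = a0 + b1 + κ₂) (hQ : Q = a2 + b2 + κ₁) :
    ∃ w : model p q ⊗[ℂ] model p' q',
      IsHighest (diagUnits (model p q) (model p' q')) (diagWeight P Q) w ∧
      (contract (model p q) (lowestFunctional p' q') w : Pol) = mon a0 κ₁ b0 a1 κ₂ b2 := by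
  -- Each exponent is that of one elementary covariant. The exponents `b1` and `a2` belong to the
  -- covariants of contraction `1`, which is why they are absent from the monomial.
  have h := (((((((isCovariant_x.pow a0).mul (isCovariant_x'.pow b1)).mul
    (isCovariant_ξ.pow b2)).mul (isCovariant_ξ'.pow a2)).mul (isCovariant_pairing.pow b0)).mul
    (isCovariant_pairing'.pow a1)).mul (isCovariant_minor.pow κ₁)).mul (isCovariant_minor'.pow κ₂)
  obtain ⟨hmem, hhigh⟩ := h
  rw [show a0 * 1 + b1 * 0 + b2 * 0 + a2 * 0 + b0 * 1 + a1 * 0 + κ₁ * 1 + κ₂ * 0 = p by omega,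
    show a0 * 0 + b1 * 0 + b2 * 1 + a2 * 0 + b0 * 0 + a1 * 1 + κ₁ * 0 + κ₂ * 1 = q by omega,
    show a0 * 0 + b1 * 1 + b2 * 0 + a2 * 0 + b0 * 0 + a1 * 1 + κ₁ * 1 + κ₂ * 0 = p' by omega,
    show a0 * 0 + b1 * 0 + b2 * 0 + a2 * 1 + b0 * 1 + a1 * 0 + κ₁ * 0 + κ₂ * 1 = q' by omega]
    at hmem
  rw [show a0 * 1 + b1 * 1 + b2 * 0 + a2 * 0 + b0 * 0 + a1 * 0 + κ₁ * 0 + κ₂ * 1 = P by omega,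
    show a0 * 0 + b1 * 0 + b2 * 1 + a2 * 1 + b0 * 0 + a1 * 0 + κ₁ * 1 + κ₂ * 0 = Q by omega]
    at hhigh
  obtain ⟨w, hw⟩ := bimodel_le_range hmem
  refine ⟨w, ?_, ?_⟩
  · rw [← hw] at hhigh
    refine IsHighest.of_map (fun _ _ _ => rfl) (fun _ _ _ => rfl) ?_ hhigh
    exact TensorProduct.map_injective_of_flat_flat _ _ (Submodule.subtype_injective _)
      (Submodule.subtype_injective _)
  · rw [coe_contract, hw]
    simp only [map_mul, map_pow, map_add, map_sub, contractHom_tmul, evalPoint_x, evalPoint_ξ,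
      map_one]
    simp [mon]
    ring

end Pol

/-! ### Extension of the action to the field of fractions -/

/-- A derivation `d` is the same as the homomorphism `f ↦ f + ε (d f)` to dual numbers. An element
there is a unit as soon as its first component is, so the homomorphism extends to the localisation,
and its `ε`-component is the extended derivation. -/
lemma exists_derivation_fractionRing {R : Type*} [CommRing R] [IsDomain R] [Algebra ℂ R]
    (d : Derivation ℂ R R) : ∃ D : Derivation ℂ (FractionRing R) (FractionRing R),
      ∀ f, D (algebraMap R (FractionRing R) f) = algebraMap R (FractionRing R) (d f) := by
  let K := FractionRing R
  let g : R →ₐ[ℂ] TrivSqZeroExt K K :=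
    { toFun := fun f => (algebraMap R K f, algebraMap R K (d f))
      map_one' := by
        rw [d.map_one_eq_zero, map_zero, map_one]; rfl
      map_mul' := fun a b => by
        rw [Derivation.leibniz]
        refine TrivSqZeroExt.ext (map_mul _ a b) ?_
        change algebraMap R K (a * d b + b * d a) =
          algebraMap R K a * algebraMap R K (d b) + algebraMap R K (d a) * algebraMap R K b
        simp only [map_add, map_mul]
        ring
      map_zero' := by
        rw [map_zero, map_zero, map_zero]; rfl
      map_add' := fun a b => by
        rw [map_add, map_add, map_add]; rfl
      commutes' := fun c => by
        rw [d.map_algebraMap, map_zero]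
        exact TrivSqZeroExt.ext (IsScalarTower.algebraMap_apply ℂ R K c).symm rfl }
  have hg : ∀ y : nonZeroDivisors R, IsUnit (g y) := by
    intro y
    rw [TrivSqZeroExt.isUnit_iff_isUnit_fst]
    have : (g y).fst = algebraMap R K y := rfl
    rw [this]
    exact IsLocalization.map_units K y
  let F : K →ₐ[ℂ] TrivSqZeroExt K K := IsLocalization.liftAlgHom (M := nonZeroDivisors R) hg
  have hF : ∀ f, F (algebraMap R K f) = g f := fun f => IsLocalization.lift_eq hg f
  have hfst : ∀ a, (F a).fst = a := by
    have : ((TrivSqZeroExt.fstHom ℂ K K).comp F).toRingHom = RingHom.id K := by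
      refine IsLocalization.ringHom_ext (nonZeroDivisors R) ?_
      ext f
      simp only [RingHom.comp_apply]
      change (F (algebraMap R K f)).fst = algebraMap R K f
      rw [hF]
      rfl
    exact fun a => congrArg (fun G => G a) this
  refine ⟨Derivation.mk' (((TrivSqZeroExt.sndHom K K).restrictScalars ℂ) ∘ₗ F.toLinearMap) ?_, ?_⟩
  · intro a b
    have h : (F (a * b)).snd = a * (F b).snd + (F a).snd * b := by
      rw [map_mul, TrivSqZeroExt.snd_mul, hfst, hfst]; rfl
    change (F (a * b)).snd = a * (F b).snd + b * (F a).snd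
    rw [h, mul_comm b]
  · intro f
    change (F (algebraMap R K f)).snd = _
    rw [hF]
    rfl

section

variable {V W : Type*} [AddCommGroup V] [Module ℂ V] [AddCommGroup W] [Module ℂ W]
  {E : Fin 3 → Fin 3 → Module.End ℂ V} {E' : Fin 3 → Fin 3 → Module.End ℂ W} {F : V →ₗ[ℂ] W}

lemma map_sqEntry (hF : ∀ i j v, F (E i j v) = E' i j (F v)) (i j : Fin 3) (v : V) :
    F (sqEntry E i j v) = sqEntry E' i j (F v) := by
  simp only [sqEntry_apply, map_add, hF]

lemma map_transportedCubic (hF : ∀ i j v, F (E i j v) = E' i j (F v)) (l : Fin 3 → ℂ) (v : V) :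
    F (transportedCubic E l v) = transportedCubic E' l (F v) := by
  simp only [transportedCubic, LinearMap.sub_apply, LinearMap.sum_apply, LinearMap.smul_apply,
    Module.End.mul_apply, map_sub, map_sum, map_smul, map_sqEntry hF, hF]

lemma map_transportedQuartic (hF : ∀ i j v, F (E i j v) = E' i j (F v)) (l : Fin 3 → ℂ) (v : V) :
    F (transportedQuartic E l v) = transportedQuartic E' l (F v) := by
  simp only [transportedQuartic, LinearMap.sub_apply, LinearMap.add_apply, LinearMap.sum_apply,
    LinearMap.smul_apply, Module.End.mul_apply, map_sub, map_add, map_sum, map_smul,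
    map_sqEntry hF, hF]

end

namespace Pol

lemma ξ_ne_zero (i : Fin 3) : ξ i ≠ 0 := by
  fin_cases i
  · simpa [mon] using mon_ne_zero 0 0 0 1 0 0
  · simpa [mon] using mon_ne_zero 0 0 0 0 1 0
  · simpa [mon] using mon_ne_zero 0 0 0 0 0 1

lemma exists_isFlagAction : ∃ D : Fin 3 → Fin 3 → Derivation ℂ (FractionRing Pol) (FractionRing
    Pol),
    (∀ i j f, D i j (algebraMap Pol (FractionRing Pol) f) = algebraMap Pol _ ⁅e i j, f⁆) ∧
    IsFlagAction D (fun i => algebraMap Pol _ (x i)) (fun i => algebraMap Pol _ (ξ i)) := by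
  choose D hD using fun i j => exists_derivation_fractionRing (der (e i j).1)
  have hinj : Function.Injective (algebraMap Pol (FractionRing Pol)) := IsFractionRing.injective _ _
  have hsmul : ∀ (c : ℂ) (f : Pol),
      algebraMap Pol (FractionRing Pol) (c • f) = c • algebraMap Pol (FractionRing Pol) f :=
    fun c f => map_smul (IsScalarTower.toAlgHom ℂ Pol (FractionRing Pol)) c f
  refine ⟨D, hD, ?_, ?_, ?_, ?_, ?_⟩
  · intro i
    exact (map_ne_zero_iff _ hinj).2 (MvPolynomial.X_ne_zero _)
  · intro i
    exact (map_ne_zero_iff _ hinj).2 (ξ_ne_zero i)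
  · simp only [← map_mul, ← map_add, incidence, map_zero]
  · intro i j k
    rw [hD, ← lie_def, lie_x, map_sub]
    congr 1 <;> split_ifs <;> simp only [hsmul, map_zero]
  · intro i j k
    rw [hD, ← lie_def, lie_ξ, map_sub]
    congr 1 <;> split_ifs <;> simp only [hsmul, map_zero]

lemma algebraMap_mon (a0 a1 a2 b0 b1 b2 : ℕ) :
    algebraMap Pol (FractionRing Pol) (mon a0 a1 a2 b0 b1 b2) =
      IsFlagAction.laurent (fun i => algebraMap Pol _ (x i)) (fun i => algebraMap Pol _ (ξ i))
        ![a0, a1, a2] ![b0, b1, b2] := by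
  simp [mon, IsFlagAction.laurent]

end Pol

/-! ### Ladders -/

/-- The indices of a ladder. -/
def window (α β : Fin 3 → ℤ) : Set ℤ := {t | ∀ i, 0 ≤ α i - t ∧ 0 ≤ β i + t}

/-- A basis on which the operators `A` and `B` are tridiagonal, with coefficients determined by the
numbers `α`, `β` and `κ`. -/
structure IsLadder {M : Type*} [AddCommGroup M] [Module ℂ M] (α β : Fin 3 → ℤ) (κ : ℂ)
    (A B : Module.End ℂ M) (v : ℤ → M) : Prop where
  linearIndependent : LinearIndependent ℂ fun t : window α β => v t
  span : Submodule.span ℂ (v '' window α β) = ⊤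
  apply_left : ∀ t ∈ window α β, A (v t) = (-∏ i, ((β i + t : ℤ) : ℂ)) • v (t - 1)
    + xDiag (fun i => (α i - t : ℤ)) (fun i => (β i + t : ℤ)) κ • v t
    + (∏ i, ((α i - t : ℤ) : ℂ)) • v (t + 1)
  apply_right : ∀ t ∈ window α β, B (v t) =
    yOff (fun i => (β i + t : ℤ)) (fun i => (α i - t : ℤ)) κ • v (t - 1)
    + yDiag (fun i => (α i - t : ℤ)) (fun i => (β i + t : ℤ)) κ • v t
    + yOff (fun i => (α i - t : ℤ)) (fun i => (β i + t : ℤ)) κ • v (t + 1)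

/-- Terms of distinct degrees cannot cancel. -/
lemma linearIndependent_of_degree {M : Type*} [AddCommGroup M] [Module ℂ M] {ι : Type*} (v : ι → M)
    (F : M →ₗ[ℂ] Polynomial ℂ) (d : ι → ℕ) (hd : Function.Injective d)
    (hF : ∀ i, (F (v i)).degree = d i) : LinearIndependent ℂ v := by
  rw [linearIndependent_iff']
  intro s c hc i hi
  by_contra hne
  have hdeg : ∀ j, c j ≠ 0 → (F (c j • v j)).degree = d j := by
    intro j hj
    rw [map_smul, Polynomial.smul_eq_C_mul, Polynomial.degree_C_mul hj, hF j]
  have hz : ∀ j, F (c j • v j) ≠ 0 → c j ≠ 0 := fun j hj h => hj (by rw [h, zero_smul, map_zero])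
  have h1 := Polynomial.degree_sum_eq_of_disjoint (fun j => F (c j • v j)) s (by
    rintro j ⟨-, hj⟩ k ⟨-, hk⟩ hjk h
    simp only [Function.comp] at h
    rw [hdeg j (hz j hj), hdeg k (hz k hk)] at h
    exact hjk (hd (by exact_mod_cast h)))
  rw [← map_sum, hc, map_zero, Polynomial.degree_zero] at h1
  have h2 := Finset.le_sup (f := fun j => (F (c j • v j)).degree) hi
  rw [← h1, hdeg i hne] at h2
  simp at h2

/-! ### The ladder of highest weight vectors -/

namespace Pol

variable {p q p' q' P Q : ℕ}

/-- The degrees and weights in terms of the exponents of a monomial in the invariants. -/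
structure IsLabel (α β : Fin 3 → ℤ) (κ₁ κ₂ : ℕ) (p q p' q' P Q : ℕ) : Prop where
  p_eq : (p : ℤ) = α 0 + β 0 + κ₁
  q_eq : (q : ℤ) = α 1 + β 2 + κ₂
  p'_eq : (p' : ℤ) = α 1 + β 1 + κ₁
  q'_eq : (q' : ℤ) = α 2 + β 0 + κ₂
  P_eq : (P : ℤ) = α 0 + β 1 + κ₂
  Q_eq : (Q : ℤ) = α 2 + β 2 + κ₁
  disjoint : κ₁ = 0 ∨ κ₂ = 0

variable {α β : Fin 3 → ℤ} {κ₁ κ₂ : ℕ}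

/-- The exponents of the monomial number `t`. -/
def ladderExponents (α β : Fin 3 → ℤ) (κ₁ κ₂ : ℕ) (t : ℤ) : Fin 6 → ℕ :=
  ![(α 0 - t).toNat, κ₁, (β 0 + t).toNat, (α 1 - t).toNat, κ₂, (β 2 + t).toNat]

/-- The contraction of a highest weight vector, as a polynomial. -/
def contractPol (p q p' q' P Q : ℕ) :
    multSpace (model p q) (model p' q') (P + 1 : ℕ) (Q + 1 : ℕ) →ₗ[ℂ] Pol :=
  (model p q : Submodule ℂ Pol).subtype ∘ₗ contract (model p q) (lowestFunctional p' q') ∘ₗ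
    Submodule.subtype _

lemma isHighest_coe (w : multSpace (model p q) (model p' q') (P + 1 : ℕ) (Q + 1 : ℕ)) :
    IsHighest (diagUnits (model p q) (model p' q')) (diagWeight P Q) w.1 := by
  simpa using isHighest_of_mem w.2

lemma contractPol_injective : Function.Injective (contractPol p q p' q' P Q) := by
  refine (injective_iff_map_eq_zero _).2 fun w hw => ?_
  apply Subtype.ext
  exact eq_zero_of_contract_lowest (isHighest_coe w) (Subtype.ext hw)

lemma contractPol_mem_span (w : multSpace (model p q) (model p' q') (P + 1 : ℕ) (Q + 1 : ℕ)) :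
    contractPol p q p' q' P Q w ∈ Submodule.span ℂ (monomial ''
      boundedExponents p q (fun i => diagWeight P Q i - diagWeight p' q' i) p' q') :=
  contract_mem_span (isHighest_coe w)

lemma exists_contractPol_eq (h : IsLabel α β κ₁ κ₂ p q p' q' P Q) {t : ℤ} (ht : t ∈ window α β) :
    ∃ w, contractPol p q p' q' P Q w = monomial (ladderExponents α β κ₁ κ₂ t) := by
  obtain ⟨h1, h2, h3, h4, h5, h6, -⟩ := h
  have t0 := ht 0
  have t1 := ht 1
  have t2 := ht 2
  obtain ⟨w, hw, hc⟩ := exists_contract_eq_mon (p := p) (q := q) (p' := p') (q' := q') (P := P)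
    (Q := Q) (a0 := (α 0 - t).toNat) (a1 := (α 1 - t).toNat) (a2 := (α 2 - t).toNat)
    (b0 := (β 0 + t).toNat) (b1 := (β 1 + t).toNat) (b2 := (β 2 + t).toNat) (κ₁ := κ₁) (κ₂ := κ₂)
    (by omega) (by omega) (by omega) (by omega) (by omega) (by omega)
  exact ⟨⟨w, mem_multSpace_of_isHighest (by simpa using hw)⟩, hc⟩

/-- Four of the six window conditions say that exponents of the monomial are nonnegative. The other
two, `0 ≤ β 1 + t` and `0 ≤ α 2 - t`, are exactly the bounds by `p'` and `q'` from the nilpotency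
orders. -/
lemma IsLabel.exists_index (h : IsLabel α β κ₁ κ₂ p q p' q' P Q) {g : Fin 6 → ℕ}
    (hg : g ∈ boundedExponents p q (fun i => diagWeight P Q i - diagWeight p' q' i) p' q') :
    ∃ t ∈ window α β, g = ladderExponents α β κ₁ κ₂ t := by
  obtain ⟨⟨⟨g1, g2, g3⟩, hw⟩, g4, g5⟩ := hg
  obtain ⟨h1, h2, h3, h4, h5, h6, h7⟩ := h
  have w0 := hw 0
  have w1 := hw 1
  have w2 := hw 2
  -- The factor `3` clears the denominators of `diagWeight`, so that the weight condition becomes an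
  -- identity of integers.
  have i0 : 3 * ((g 0 : ℤ) - g 3) - (p - q) = (2 * P + Q) - (2 * p' + q') := by
    have : ((3 * ((g 0 : ℤ) - g 3) - (p - q) : ℤ) : ℂ) = ((2 * P + Q) - (2 * p' + q') : ℤ) := by
      simp [diagWeight] at w0
      push_cast
      linear_combination 3 * w0
    exact_mod_cast this
  have i1 : 3 * ((g 1 : ℤ) - g 4) - (p - q) = (Q - P) - (q' - p') := by
    have : ((3 * ((g 1 : ℤ) - g 4) - (p - q) : ℤ) : ℂ) = ((Q - P) - (q' - p') : ℤ) := by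
      simp [diagWeight] at w1
      push_cast
      linear_combination 3 * w1
    exact_mod_cast this
  have hκ : g 1 = κ₁ ∧ g 4 = κ₂ := by omega
  refine ⟨α 0 - g 0, fun i => ?_, ?_⟩
  · fin_cases i <;> simp <;> omega
  · ext i
    fin_cases i <;> simp [ladderExponents] <;> omega

/-- If there are highest weight vectors, then their weights have labels. -/
lemma exists_isLabel (h : multSpace (model p q) (model p' q') (P + 1 : ℕ) (Q + 1 : ℕ) ≠ ⊥) :
    ∃ (a b : Fin 3 → ℕ) (κ₁ κ₂ : ℕ),
      IsLabel (fun i => a i) (fun i => b i) κ₁ κ₂ p q p' q' P Q := by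
  obtain ⟨w, hw, hw0⟩ := (Submodule.ne_bot_iff _).1 h
  have hmem := contractPol_mem_span ⟨w, hw⟩
  have hne : contractPol p q p' q' P Q ⟨w, hw⟩ ≠ 0 := by
    intro h0
    rw [← map_zero (contractPol p q p' q' P Q)] at h0
    exact hw0 (congrArg Subtype.val (contractPol_injective h0))
  obtain ⟨g, hg⟩ : (boundedExponents p q
      (fun i => diagWeight P Q i - diagWeight p' q' i) p' q').Nonempty := by
    by_contra hemp
    rw [Set.not_nonempty_iff_eq_empty] at hemp
    rw [hemp, Set.image_empty, Submodule.span_empty, Submodule.mem_bot] at hmem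
    exact hne hmem
  obtain ⟨⟨⟨g1, g2, g3⟩, hw⟩, g4, g5⟩ := hg
  have w0 := hw 0
  have w1 := hw 1
  have i0 : 3 * ((g 0 : ℤ) - g 3) - (p - q) = (2 * P + Q) - (2 * p' + q') := by
    have : ((3 * ((g 0 : ℤ) - g 3) - (p - q) : ℤ) : ℂ) = ((2 * P + Q) - (2 * p' + q') : ℤ) := by
      simp [diagWeight] at w0
      push_cast
      linear_combination 3 * w0
    exact_mod_cast this
  have i1 : 3 * ((g 1 : ℤ) - g 4) - (p - q) = (Q - P) - (q' - p') := by
    have : ((3 * ((g 1 : ℤ) - g 4) - (p - q) : ℤ) : ℂ) = ((Q - P) - (q' - p') : ℤ) := by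
      simp [diagWeight] at w1
      push_cast
      linear_combination 3 * w1
    exact_mod_cast this
  -- The allowed monomial itself is taken as the one of index `0`. The two missing components are
  -- forced by `q'` and `p'`; the natural subtractions are exact thanks to the bounds.
  refine ⟨![g 0, g 3, q' - g 2 - g 4], ![g 2, p' - g 1 - g 3, g 5], g 1, g 4, ?_, ?_, ?_, ?_, ?_,
    ?_, g3⟩ <;> simp <;> omega

section Action

variable {t : ℤ} {w : multSpace (model p q) (model p' q') (P + 1 : ℕ) (Q + 1 : ℕ)}

/-- The Laurent monomial number `t`. -/
def ladderLaurent (α β : Fin 3 → ℤ) (κ₁ κ₂ : ℕ) (t : ℤ) : FractionRing Pol :=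
  IsFlagAction.laurent (fun i => algebraMap Pol _ (x i)) (fun i => algebraMap Pol _ (ξ i))
    ![α 0 - t, κ₁, β 0 + t] ![α 1 - t, κ₂, β 2 + t]

lemma algebraMap_monomial (ht : t ∈ window α β) :
    algebraMap Pol (FractionRing Pol) (monomial (ladderExponents α β κ₁ κ₂ t)) =
      ladderLaurent α β κ₁ κ₂ t := by
  rw [monomial, algebraMap_mon, ladderLaurent]
  have t0 := ht 0
  have t1 := ht 1
  have t2 := ht 2
  congr 1
  · ext i
    fin_cases i <;> simp [ladderExponents] <;> omega
  · ext i
    fin_cases i <;> simp [ladderExponents] <;> omega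

lemma ladderLaurent_succ (α β : Fin 3 → ℤ) (κ₁ κ₂ : ℕ) (t : ℤ) :
    ladderLaurent α β κ₁ κ₂ (t + 1) = IsFlagAction.ratio (fun i => algebraMap Pol (FractionRing
        Pol) (x i))
      (fun i => algebraMap Pol _ (ξ i)) * ladderLaurent α β κ₁ κ₂ t := by
  obtain ⟨D, -, H⟩ := exists_isFlagAction
  have e1 : (![α 0 - (t + 1), κ₁, β 0 + (t + 1)] : Fin 3 → ℤ) =
      ![α 0 - t, κ₁, β 0 + t] + ![-1, 0, 1] := by
    ext i; fin_cases i <;> simp <;> ring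
  have e2 : (![α 1 - (t + 1), κ₂, β 2 + (t + 1)] : Fin 3 → ℤ) =
      ![α 1 - t, κ₂, β 2 + t] + ![-1, 0, 1] := by
    ext i; fin_cases i <;> simp <;> ring
  rw [ladderLaurent, e1, e2, H.laurent_add, ladderLaurent]
  congr 1
  have := H.x_ne 0
  have := H.ξ_ne 0
  simp [IsFlagAction.laurent, IsFlagAction.ratio]
  field_simp

lemma ladderLaurent_pred (α β : Fin 3 → ℤ) (κ₁ κ₂ : ℕ) (t : ℤ) :
    ladderLaurent α β κ₁ κ₂ (t - 1) = (IsFlagAction.ratio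
      (fun i => algebraMap Pol (FractionRing Pol) (x i))
      (fun i => algebraMap Pol _ (ξ i)))⁻¹ * ladderLaurent α β κ₁ κ₂ t := by
  obtain ⟨D, -, H⟩ := exists_isFlagAction
  have h1 := ladderLaurent_succ α β κ₁ κ₂ (t - 1)
  rw [sub_add_cancel] at h1
  rw [h1, inv_mul_cancel_left₀]
  exact div_ne_zero (mul_ne_zero (H.x_ne _) (H.ξ_ne _)) (mul_ne_zero (H.x_ne _) (H.ξ_ne _))

lemma IsLabel.weights (h : IsLabel α β κ₁ κ₂ p q p' q' P Q) (t : ℤ) :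
    IsFlagAction.Weights (fun i => α i - t) (fun i => β i + t) κ₁ κ₂
    (diagWeight p q) (diagWeight p' q') (diagWeight P Q) := by
  obtain ⟨h1, h2, h3, h4, h5, h6, h7⟩ := h
  have c : ∀ {a : ℕ} {b : ℤ}, (a : ℤ) = b → (a : ℂ) = b :=
      fun h => by exact_mod_cast congrArg (Int.cast (R := ℂ)) h
  refine ⟨?_, ?_, ?_, by exact_mod_cast h7⟩
  · rw [c h1, c h2]; push_cast; congr 1 <;> ring
  · rw [c h3, c h4]; push_cast; congr 1 <;> ring
  · rw [c h5, c h6]; push_cast; congr 1 <;> ring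

/-- On `w` the operator `X` is the mixed cubic trace plus a scalar. Contraction makes it
`transportedCubic`, and the result is computed among Laurent monomials, so that `t - 1` and `t + 1`
need not belong to the window. -/
lemma contractPol_physX (h : IsLabel α β κ₁ κ₂ p q p' q' P Q) (ht : t ∈ window α β)
    (hw : contractPol p q p' q' P Q w = monomial (ladderExponents α β κ₁ κ₂ t)) :
    algebraMap Pol (FractionRing Pol) (contractPol p q p' q' P Q (physX _ _ _ _ w)) =
      (-∏ i, ((β i + t : ℤ) : ℂ)) • ladderLaurent α β κ₁ κ₂ (t - 1)
      + xDiag (fun i => (α i - t : ℤ)) (fun i => (β i + t : ℤ)) (κ₁ + κ₂ : ℕ)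
        • ladderLaurent α β κ₁ κ₂ t
      + (∏ i, ((α i - t : ℤ) : ℂ)) • ladderLaurent α β κ₁ κ₂ (t + 1) := by
  obtain ⟨D, hD, H⟩ := exists_isFlagAction
  have hsmul : ∀ (c : ℂ) (f : Pol),
      algebraMap Pol (FractionRing Pol) (c • f) = c • algebraMap Pol (FractionRing Pol) f :=
    fun c f => map_smul (IsScalarTower.toAlgHom ℂ Pol (FractionRing Pol)) c f
  have h1 := act_X (l := diagWeight p q) (l' := diagWeight p' q') isIrrep_model isIrrep_model
    (by simp) (by simp) (isHighest_coe w)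
  have h2 : contractPol p q p' q' P Q (physX _ _ _ _ w) =
      transportedCubic (units Pol) (diagWeight p' q') (contractPol p q p' q' P Q w)
      + xShift (diagWeight p q) (diagWeight p' q') (diagWeight P Q)
        • contractPol p q p' q' P Q w := by
    have h3 := congrArg (fun z => (model p q : Submodule ℂ Pol).subtype
      (contract (model p q) (lowestFunctional p' q') z)) h1
    simp only [map_add, map_smul, contract_mixedCubic isLowestFunctional (isHighest_coe w)] at h3
    rw [map_transportedCubic (E' := units Pol) (fun _ _ _ => rfl)] at h3
    exact h3
  have h3 := H.transportedCubic_laurent (h.weights t)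
  have h4 : algebraMap Pol (FractionRing Pol)
      (transportedCubic (units Pol) (diagWeight p' q') (contractPol p q p' q' P Q w)) =
      transportedCubic (IsFlagAction.ops D) (diagWeight p' q')
        (algebraMap Pol (FractionRing Pol) (contractPol p q p' q' P Q w)) :=
    map_transportedCubic (F := (IsScalarTower.toAlgHom ℂ Pol (FractionRing Pol)).toLinearMap)
      (fun i j f => (hD i j f).symm) _ _
  rw [h2, map_add, hsmul, h4, hw, algebraMap_monomial ht, ladderLaurent_pred, ladderLaurent_succ]
  refine h3.trans ?_
  push_cast
  rfl

lemma contractPol_physY (h : IsLabel α β κ₁ κ₂ p q p' q' P Q) (ht : t ∈ window α β)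
    (hw : contractPol p q p' q' P Q w = monomial (ladderExponents α β κ₁ κ₂ t)) :
    algebraMap Pol (FractionRing Pol) (contractPol p q p' q' P Q (physY _ _ _ _ w)) =
      yOff (fun i => (β i + t : ℤ)) (fun i => (α i - t : ℤ)) (κ₁ + κ₂ : ℕ)
        • ladderLaurent α β κ₁ κ₂ (t - 1)
      + yDiag (fun i => (α i - t : ℤ)) (fun i => (β i + t : ℤ)) (κ₁ + κ₂ : ℕ)
        • ladderLaurent α β κ₁ κ₂ t
      + yOff (fun i => (α i - t : ℤ)) (fun i => (β i + t : ℤ)) (κ₁ + κ₂ : ℕ)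
        • ladderLaurent α β κ₁ κ₂ (t + 1) := by
  obtain ⟨D, hD, H⟩ := exists_isFlagAction
  have hsmul : ∀ (c : ℂ) (f : Pol),
      algebraMap Pol (FractionRing Pol) (c • f) = c • algebraMap Pol (FractionRing Pol) f :=
    fun c f => map_smul (IsScalarTower.toAlgHom ℂ Pol (FractionRing Pol)) c f
  have h1 := act_Y (l := diagWeight p q) (l' := diagWeight p' q') isIrrep_model isIrrep_model
    (by simp) (by simp) (isHighest_coe w)
  have h2 : contractPol p q p' q' P Q (physY _ _ _ _ w) =
      transportedQuartic (units Pol) (diagWeight p' q') (contractPol p q p' q' P Q w)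
      + yShift (diagWeight p q) (diagWeight p' q') (diagWeight P Q)
        • contractPol p q p' q' P Q w := by
    have h3 := congrArg (fun z => (model p q : Submodule ℂ Pol).subtype
      (contract (model p q) (lowestFunctional p' q') z)) h1
    simp only [map_add, map_smul, contract_mixedQuartic isLowestFunctional (isHighest_coe w)] at h3
    rw [map_transportedQuartic (E' := units Pol) (fun _ _ _ => rfl)] at h3
    exact h3
  have h3 := H.transportedQuartic_laurent (h.weights t)
  have h4 : algebraMap Pol (FractionRing Pol)
      (transportedQuartic (units Pol) (diagWeight p' q') (contractPol p q p' q' P Q w)) =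
      transportedQuartic (IsFlagAction.ops D) (diagWeight p' q')
        (algebraMap Pol (FractionRing Pol) (contractPol p q p' q' P Q w)) :=
    map_transportedQuartic (F := (IsScalarTower.toAlgHom ℂ Pol (FractionRing Pol)).toLinearMap)
      (fun i j f => (hD i j f).symm) _ _
  rw [h2, map_add, hsmul, h4, hw, algebraMap_monomial ht, ladderLaurent_pred, ladderLaurent_succ]
  refine h3.trans ?_
  push_cast
  rfl

end Action

/-- At the upper end of the window some `α i` equals `t`. The off-diagonal coefficients therefore
vanish exactly where the next vector would be missing. -/
lemma prod_eq_zero_of_succ {t : ℤ} (ht : t ∈ window α β) (ht' : t + 1 ∉ window α β) :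
    ∏ i, ((α i - t : ℤ) : ℂ) = 0 := by
  simp only [window, Set.mem_setOf_eq, not_forall] at ht'
  obtain ⟨i, hi⟩ := ht'
  have := ht i
  refine Finset.prod_eq_zero (Finset.mem_univ i) ?_
  rw [Int.cast_eq_zero]
  omega

lemma prod_eq_zero_of_pred {t : ℤ} (ht : t ∈ window α β) (ht' : t - 1 ∉ window α β) :
    ∏ i, ((β i + t : ℤ) : ℂ) = 0 := by
  simp only [window, Set.mem_setOf_eq, not_forall] at ht'
  obtain ⟨i, hi⟩ := ht'
  have := ht i
  refine Finset.prod_eq_zero (Finset.mem_univ i) ?_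
  rw [Int.cast_eq_zero]
  omega

/-- The operators are tridiagonal on the space of highest weight vectors. -/
theorem exists_isLadder (h : IsLabel α β κ₁ κ₂ p q p' q' P Q) :
    ∃ v, IsLadder α β (κ₁ + κ₂ : ℕ)
      (physX (model p q) (model p' q') (P + 1 : ℕ) (Q + 1 : ℕ))
      (physY (model p q) (model p' q') (P + 1 : ℕ) (Q + 1 : ℕ)) v := by
  classical
  have hex : ∀ t, ∃ w, t ∈ window α β →
      contractPol p q p' q' P Q w = monomial (ladderExponents α β κ₁ κ₂ t) := by
    intro t
    by_cases ht : t ∈ window α β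
    · obtain ⟨w, hw⟩ := exists_contractPol_eq h ht
      exact ⟨w, fun _ => hw⟩
    · exact ⟨0, fun h => absurd h ht⟩
  choose v hv using hex
  have hinj : Function.Injective (algebraMap Pol (FractionRing Pol)) := IsFractionRing.injective _ _
  have hsmul : ∀ (c : ℂ) (f : Pol),
      algebraMap Pol (FractionRing Pol) (c • f) = c • algebraMap Pol (FractionRing Pol) f :=
    fun c f => map_smul (IsScalarTower.toAlgHom ℂ Pol (FractionRing Pol)) c f
  -- The vectors `v t` are constrained only inside the window. A coefficient which vanishes together
  -- with the product makes the unspecified value at `t + 1` irrelevant.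
  have hsucc : ∀ t ∈ window α β, ∀ c : ℂ, (∏ i, ((α i - t : ℤ) : ℂ) = 0 → c = 0) →
      c • ladderLaurent α β κ₁ κ₂ (t + 1) =
        algebraMap Pol (FractionRing Pol) (contractPol p q p' q' P Q (c • v (t + 1))) := by
    intro t ht c hc
    by_cases ht' : t + 1 ∈ window α β
    · rw [map_smul, hsmul, hv _ ht', algebraMap_monomial ht']
    · rw [hc (prod_eq_zero_of_succ ht ht')]; simp
  have hpred : ∀ t ∈ window α β, ∀ c : ℂ, (∏ i, ((β i + t : ℤ) : ℂ) = 0 → c = 0) →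
      c • ladderLaurent α β κ₁ κ₂ (t - 1) =
        algebraMap Pol (FractionRing Pol) (contractPol p q p' q' P Q (c • v (t - 1))) := by
    intro t ht c hc
    by_cases ht' : t - 1 ∈ window α β
    · rw [map_smul, hsmul, hv _ ht', algebraMap_monomial ht']
    · rw [hc (prod_eq_zero_of_pred ht ht')]; simp
  have hself : ∀ t ∈ window α β, ∀ c : ℂ, c • ladderLaurent α β κ₁ κ₂ t =
        algebraMap Pol (FractionRing Pol) (contractPol p q p' q' P Q (c • v t)) := by
    intro t ht c
    rw [map_smul, hsmul, hv _ ht, algebraMap_monomial ht]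
  refine ⟨v, ?_, ?_, ?_, ?_⟩
  -- The restrictions to the orbit of `e 0 1` have degrees `κ₁ + (α 1 - t)`, which are distinct for
  -- distinct `t`.
  · refine linearIndependent_of_degree _
      ((orbit 0 1 point01).toLinearMap ∘ₗ contractPol p q p' q' P Q)
      (fun t => κ₁ + (α 1 - t).toNat) ?_ ?_
    · rintro ⟨t, ht⟩ ⟨t', ht'⟩ htt
      have := ht 1
      have := ht' 1
      simp only at htt
      apply Subtype.ext
      simp only
      omega
    · rintro ⟨t, ht⟩
      rw [LinearMap.comp_apply, hv t ht]
      exact degree_orbit01 _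
  · rw [eq_top_iff]
    intro w _
    have hw := contractPol_mem_span w
    have hle : Submodule.span ℂ (monomial '' boundedExponents p q
        (fun i => diagWeight P Q i - diagWeight p' q' i) p' q') ≤
        (Submodule.span ℂ (v '' window α β)).map (contractPol p q p' q' P Q) := by
      refine Submodule.span_le.2 ?_
      rintro _ ⟨g, hg, rfl⟩
      obtain ⟨t, ht, rfl⟩ := h.exists_index hg
      exact ⟨v t, Submodule.subset_span ⟨t, ht, rfl⟩, hv t ht⟩
    obtain ⟨w', hw', hww⟩ := hle hw
    rwa [← contractPol_injective hww]
  · intro t ht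
    apply contractPol_injective
    apply hinj
    have e1 := hsucc t ht _ id
    have e2 := hpred t ht (-∏ i, ((β i + t : ℤ) : ℂ)) fun h => by rw [h, neg_zero]
    rw [map_add, map_add, map_add, map_add]
    exact (contractPol_physX h ht (hv t ht)).trans
      (congrArg₂ (· + ·) (congrArg₂ (· + ·) e2 (hself t ht _)) e1)
  · intro t ht
    apply contractPol_injective
    apply hinj
    -- `yOff` contains the product as a factor, hence vanishes with it.
    have e1 := hsucc t ht (yOff (fun i => (α i - t : ℤ)) (fun i => (β i + t : ℤ)) (κ₁ + κ₂ : ℕ))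
      fun h => by rw [yOff, h]; simp
    have e2 := hpred t ht (yOff (fun i => (β i + t : ℤ)) (fun i => (α i - t : ℤ)) (κ₁ + κ₂ : ℕ))
      fun h => by rw [yOff, h]; simp
    rw [map_add, map_add, map_add, map_add]
    exact (contractPol_physY h ht (hv t ht)).trans
      (congrArg₂ (· + ·) (congrArg₂ (· + ·) e2 (hself t ht _)) e1)

end Pol

/-! ### Symmetries of ladders -/

lemma sum_sq_comp (A : Fin 3 → ℂ) (σ : Equiv.Perm (Fin 3)) :
    ∑ i, A (σ i) ^ 2 = ∑ i, A i ^ 2 := Equiv.sum_comp σ fun i => A i ^ 2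

lemma esymm2_comp (A : Fin 3 → ℂ) (σ : Equiv.Perm (Fin 3)) :
    esymm2 (fun i => A (σ i)) = esymm2 A := by
  rw [esymm2, esymm2, sum_sq_comp, Equiv.sum_comp σ A]

/-- The coefficient is written with power sums and products only, which do not see the order of the
components. -/
lemma xDiag_comp (A B : Fin 3 → ℂ) (k : ℂ) (σ τ : Equiv.Perm (Fin 3)) :
    xDiag (fun i => A (σ i)) (fun i => B (τ i)) k = xDiag A B k := by
  simp only [xDiag, xHalf, sum_sq_comp, Equiv.sum_comp σ A, Equiv.sum_comp τ B,
    Equiv.prod_comp σ A, Equiv.prod_comp τ B]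

lemma yOff_comp (A B : Fin 3 → ℂ) (k : ℂ) (σ τ : Equiv.Perm (Fin 3)) :
    yOff (fun i => A (σ i)) (fun i => B (τ i)) k = yOff A B k := by
  simp only [yOff, Equiv.sum_comp σ A, Equiv.sum_comp τ B, Equiv.prod_comp σ A]

lemma yDiag_comp (A B : Fin 3 → ℂ) (k : ℂ) (σ τ : Equiv.Perm (Fin 3)) :
    yDiag (fun i => A (σ i)) (fun i => B (τ i)) k = yDiag A B k := by
  simp only [yDiag, yHalf, esymm2_comp, Equiv.sum_comp σ A, Equiv.sum_comp τ B,
    Equiv.prod_comp σ A, Equiv.prod_comp τ B]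

lemma xDiag_swap (A B : Fin 3 → ℂ) (k : ℂ) : xDiag B A k = -xDiag A B k := by
  simp only [xDiag]; ring

lemma yDiag_swap (A B : Fin 3 → ℂ) (k : ℂ) : yDiag B A k = yDiag A B k := by
  simp only [yDiag]; ring

lemma window_comp (α β : Fin 3 → ℤ) (σ τ : Equiv.Perm (Fin 3)) :
    window (fun i => α (σ i)) (fun i => β (τ i)) = window α β := by
  ext t
  constructor
  · intro h i
    exact ⟨by simpa using (h (σ.symm i)).1, by simpa using (h (τ.symm i)).2⟩
  · exact fun h i => ⟨(h (σ i)).1, (h (τ i)).2⟩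

lemma neg_mem_window {α β : Fin 3 → ℤ} {t : ℤ} : -t ∈ window α β ↔ t ∈ window β α := by
  simp only [window, Set.mem_setOf_eq]
  refine forall_congr' fun i => ?_
  constructor <;> intro h <;> constructor <;> omega

namespace IsLadder

variable {M M' : Type*} [AddCommGroup M] [Module ℂ M] [AddCommGroup M'] [Module ℂ M']
  {α β : Fin 3 → ℤ} {κ : ℂ} {A B : Module.End ℂ M} {A' B' : Module.End ℂ M'} {v : ℤ → M}
  {v' : ℤ → M'}

lemma comp (h : IsLadder α β κ A B v) (σ τ : Equiv.Perm (Fin 3)) :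
    IsLadder (fun i => α (σ i)) (fun i => β (τ i)) κ A B v := by
  refine ⟨?_, ?_, ?_, ?_⟩
  · rw [window_comp]; exact h.linearIndependent
  · rw [window_comp]; exact h.span
  · rw [window_comp]
    intro t ht
    rw [h.apply_left t ht, Equiv.prod_comp σ fun i => ((α i - t : ℤ) : ℂ),
      Equiv.prod_comp τ fun i => ((β i + t : ℤ) : ℂ),
      xDiag_comp (fun i => ((α i - t : ℤ) : ℂ)) (fun i => ((β i + t : ℤ) : ℂ))]
  · rw [window_comp]
    intro t ht
    rw [h.apply_right t ht,
      yDiag_comp (fun i => ((α i - t : ℤ) : ℂ)) (fun i => ((β i + t : ℤ) : ℂ)),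
      yOff_comp (fun i => ((α i - t : ℤ) : ℂ)) (fun i => ((β i + t : ℤ) : ℂ)),
      yOff_comp (fun i => ((β i + t : ℤ) : ℂ)) (fun i => ((α i - t : ℤ) : ℂ))]

/-- Reversing the ladder exchanges the neighbours `t - 1` and `t + 1`. In `A` their coefficients
differ by a sign and the diagonal is antisymmetric, so `A` is negated; in `B` all coefficients
match. -/
lemma swap (h : IsLadder α β κ A B v) : IsLadder β α κ (-A) B fun t => v (-t) := by
  refine ⟨?_, ?_, ?_, ?_⟩
  · exact h.linearIndependent.comp
      (fun t : window β α => (⟨-t.1, neg_mem_window.2 t.2⟩ : window α β))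
      fun t t' htt => Subtype.ext (neg_injective (congrArg Subtype.val htt))
  · rw [eq_top_iff, ← h.span]
    refine Submodule.span_mono ?_
    rintro _ ⟨t, ht, rfl⟩
    exact ⟨-t, neg_mem_window.2 ht, congrArg v (neg_neg t)⟩
  · intro t ht
    have h1 := h.apply_left (-t) (neg_mem_window.2 ht)
    rw [LinearMap.neg_apply, h1, xDiag_swap, neg_add, neg_sub]
    simp only [sub_neg_eq_add, ← sub_eq_add_neg]
    rw [show -t - 1 = -(t + 1) by ring, show -t + 1 = 1 - t by ring]
    module
  · intro t ht
    have h1 := h.apply_right (-t) (neg_mem_window.2 ht)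
    rw [h1, yDiag_swap, neg_add, neg_sub]
    simp only [sub_neg_eq_add, ← sub_eq_add_neg]
    rw [show -t - 1 = -(t + 1) by ring, show -t + 1 = 1 - t by ring]
    module

/-- Two ladders with the same data give the same matrices in their bases, and the change of basis
conjugates one pair into the other. -/
lemma exists_equiv (h : IsLadder α β κ A B v) (h' : IsLadder α β κ A' B' v') :
    ∃ P : M ≃ₗ[ℂ] M', P.conj A = A' ∧ P.conj B = B' := by
  let b := Module.Basis.mk h.linearIndependent (by
    rw [← h.span, Set.image_eq_range])
  let b' := Module.Basis.mk h'.linearIndependent (by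
    rw [← h'.span, Set.image_eq_range])
  let P := b.equiv b' (Equiv.refl _)
  have hP : ∀ t ∈ window α β, P (v t) = v' t := by
    intro t ht
    have h1 : b ⟨t, ht⟩ = v t := Module.Basis.mk_apply _ _ _
    have h2 : b' ⟨t, ht⟩ = v' t := Module.Basis.mk_apply _ _ _
    rw [← h1, ← h2]
    simp [P]
  have hsucc : ∀ t ∈ window α β, ∀ c : ℂ, (∏ i, ((α i - t : ℤ) : ℂ) = 0 → c = 0) →
      c • P (v (t + 1)) = c • v' (t + 1) := by
    intro t ht c hc
    by_cases ht' : t + 1 ∈ window α β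
    · rw [hP _ ht']
    · rw [hc (Pol.prod_eq_zero_of_succ ht ht')]; simp
  have hpred : ∀ t ∈ window α β, ∀ c : ℂ, (∏ i, ((β i + t : ℤ) : ℂ) = 0 → c = 0) →
      c • P (v (t - 1)) = c • v' (t - 1) := by
    intro t ht c hc
    by_cases ht' : t - 1 ∈ window α β
    · rw [hP _ ht']
    · rw [hc (Pol.prod_eq_zero_of_pred ht ht')]; simp
  refine ⟨P, ?_, ?_⟩
  · refine b'.ext fun ⟨t, ht⟩ => ?_
    rw [show b' ⟨t, ht⟩ = v' t from Module.Basis.mk_apply _ _ _, LinearEquiv.conj_apply_apply,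
      ← hP t ht, LinearEquiv.symm_apply_apply, hP t ht, h.apply_left t ht, h'.apply_left t ht]
    simp only [map_add, map_smul]
    rw [hP t ht, hsucc t ht _ id, hpred t ht _ fun h => by rw [h, neg_zero]]
  · refine b'.ext fun ⟨t, ht⟩ => ?_
    rw [show b' ⟨t, ht⟩ = v' t from Module.Basis.mk_apply _ _ _, LinearEquiv.conj_apply_apply,
      ← hP t ht, LinearEquiv.symm_apply_apply, hP t ht, h.apply_right t ht, h'.apply_right t ht]
    simp only [map_add, map_smul]
    rw [hP t ht, hsucc t ht _ fun h => by rw [yOff, h]; simp,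
      hpred t ht _ fun h => by rw [yOff, h]; simp]

end IsLadder

/-! ### The group of symmetries of the squares -/

/-- The parameters, read on the squares. -/
def readout (A : Arrangement) : Params := ![A 0 0 0, A 1 2 0, A 0 0 1, A 1 2 1, A 1 2 2, A 0 0 2]

/-- Pairs of squares with a common value of the sums along lines and columns of the first, which
differ by a constant. -/
structure IsMagic (A : Arrangement) : Prop where
  sums : ∃ S : ℚ, (∀ r, ∑ c, A 0 r c = S) ∧ ∀ c, ∑ r, A 0 r c = S
  shift : ∃ k : ℚ, ∀ r c, A 1 r c = A 0 r c + k

lemma readout_squares (m : Params) : readout (squares m) = m := by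
  ext i; fin_cases i <;> rfl

lemma squares_injective : Function.Injective squares :=
  Function.LeftInverse.injective readout_squares

lemma isMagic_squares (m : Params) : IsMagic (squares m) := by
  refine ⟨⟨m 0 + m 2 + m 5, ?_, ?_⟩, ⟨ell m - en m, ?_⟩⟩
  · intro r; fin_cases r <;> simp [squares, Fin.sum_univ_three, ell, en] <;> ring
  · intro c; fin_cases c <;> simp [squares, Fin.sum_univ_three, ell, en] <;> ring
  · intro r c; fin_cases r <;> fin_cases c <;> simp [squares] <;> ring

/-- The six entries used by `readout` determine the rest: `hk` links the two squares, and the equal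
line and column sums give the remaining entries linearly. -/
lemma squares_readout {A : Arrangement} (hA : IsMagic A) : squares (readout A) = A := by
  obtain ⟨⟨S, hr, hc⟩, k, hk⟩ := hA
  have r0 := hr 0
  have r1 := hr 1
  have r2 := hr 2
  have c0 := hc 0
  have c1 := hc 1
  have c2 := hc 2
  simp only [Fin.sum_univ_three] at r0 r1 r2 c0 c1 c2
  have h0 : ∀ r c, squares (readout A) 0 r c = A 0 r c := by
    intro r c
    fin_cases r <;> fin_cases c <;> simp [squares, readout, ell, en, hk] <;> linarith
  have h1 : ∀ r c, squares (readout A) 1 r c = A 1 r c := by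
    intro r c
    fin_cases r <;> fin_cases c <;> simp [squares, readout, ell, en, hk] <;> linarith
  ext s r c
  fin_cases s
  · exact h0 r c
  · exact h1 r c

lemma IsMagic.permLines {A : Arrangement} (hA : IsMagic A) (σ : S3) : IsMagic (permLines σ A) := by
  obtain ⟨⟨S, hr, hc⟩, k, hk⟩ := hA
  refine ⟨⟨S, fun r => hr _, fun c => ?_⟩, k, fun r c => hk _ _⟩
  exact (Equiv.sum_comp σ⁻¹ fun r => A 0 r c).trans (hc c)

lemma IsMagic.transposeBoth {A : Arrangement} (hA : IsMagic A) : IsMagic (transposeBoth A) := by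
  obtain ⟨⟨S, hr, hc⟩, k, hk⟩ := hA
  exact ⟨⟨S, hc, hr⟩, k, fun r c => hk c r⟩

lemma IsMagic.permColumns {A : Arrangement} (hA : IsMagic A) (σ : S3) :
    IsMagic (permColumns σ A) := by
  have : MissingLabel.permColumns σ A =
      MissingLabel.transposeBoth (MissingLabel.permLines σ (MissingLabel.transposeBoth A)) := rfl
  rw [this]
  exact (hA.transposeBoth.permLines σ).transposeBoth

lemma IsMagic.exchange {A : Arrangement} (hA : IsMagic A) : IsMagic (exchange A) := by
  obtain ⟨⟨S, hr, hc⟩, k, hk⟩ := hA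
  refine ⟨⟨S + 3 * k, fun r => ?_, fun c => ?_⟩, -k, fun r c => ?_⟩
  · have := hr r
    simp [MissingLabel.exchange, hk, Fin.sum_univ_three] at this ⊢
    linarith
  · have := hc c
    simp [MissingLabel.exchange, hk, Fin.sum_univ_three] at this ⊢
    linarith
  · simp [MissingLabel.exchange, hk]

/-- The operation on the squares which corresponds to an element of the model group. -/
def operation (a : ModelGroup) (A : Arrangement) : Arrangement :=
  permLines a.1.left.1 (permColumns a.1.left.2
    ((if a.1.right = 1 then id else transposeBoth) ((if a.2 = 1 then id else exchange) A)))

lemma exchange_apply (A : Arrangement) (s : Fin 2) (r c : Fin 3) :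
    exchange A s r c = A (1 - s) r c := by
  fin_cases s <;> rfl

lemma C2.eq_one_or (z : C2) : z = 1 ∨ z = C2.gen := by
  revert z; decide

lemma swapAction_one_apply (x : S3 × S3) : swapAction 1 x = x := by
  rw [map_one, MulAut.one_apply]

lemma swapAction_gen_apply (x : S3 × S3) : swapAction C2.gen x = x.swap := rfl

lemma operation_one (A : Arrangement) : operation 1 A = A := by
  simp [operation]
  rfl

/-- Transposition turns permutations of lines into permutations of columns, which is what
`swapAction` encodes, while the exchange of squares commutes with everything. -/
lemma operation_mul (a b : ModelGroup) (A : Arrangement) :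
    operation (a * b) A = operation a (operation b A) := by
  obtain ⟨⟨⟨σ, τ⟩, z⟩, w⟩ := a
  obtain ⟨⟨⟨σ', τ'⟩, z'⟩, w'⟩ := b
  have hg : C2.gen ≠ 1 := by decide
  have hgg : C2.gen * C2.gen = 1 := by decide
  ext s r c
  change permLines (σ * (swapAction z (σ', τ')).1) (permColumns (τ * (swapAction z (σ', τ')).2)
    ((if z * z' = 1 then id else transposeBoth) ((if w * w' = 1 then id else exchange) A))) s r c =
    permLines σ (permColumns τ ((if z = 1 then id else transposeBoth)
      ((if w = 1 then id else exchange) (permLines σ' (permColumns τ'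
        ((if z' = 1 then id else transposeBoth) ((if w' = 1 then id else exchange) A))))))) s r c
  rcases C2.eq_one_or z with rfl | rfl <;> rcases C2.eq_one_or z' with rfl | rfl <;>
    rcases C2.eq_one_or w with rfl | rfl <;> rcases C2.eq_one_or w' with rfl | rfl <;>
    simp only [permLines, permColumns, transposeBoth, exchange_apply, hg, hgg, swapAction_one_apply,
      swapAction_gen_apply, id, one_mul, mul_one, if_true, if_false, Prod.fst_swap, Prod.snd_swap,
          mul_inv_rev, Matrix.submatrix_apply,
      Matrix.transpose_apply, Equiv.Perm.coe_mul, Function.comp_apply, sub_sub_cancel]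

lemma IsMagic.operation {A : Arrangement} (hA : IsMagic A) (a : ModelGroup) :
    IsMagic (operation a A) := by
  refine IsMagic.permLines (IsMagic.permColumns ?_ _) _
  have h1 : IsMagic ((if a.2 = 1 then id else MissingLabel.exchange) A) := by
    split_ifs
    exacts [hA, hA.exchange]
  rcases C2.eq_one_or a.1.right with h | h
  · rw [h, if_pos rfl]; exact h1
  · rw [h, if_neg (by decide)]; exact h1.transposeBoth

lemma squares_add (m m' : Params) : squares (m + m') = squares m + squares m' := by
  ext s r c
  fin_cases s <;> fin_cases r <;> fin_cases c <;> simp [squares, ell, en] <;> ring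

lemma squares_smul (k : ℚ) (m : Params) : squares (k • m) = k • squares m := by
  ext s r c
  fin_cases s <;> fin_cases r <;> fin_cases c <;> simp [squares, ell, en] <;> ring

lemma operation_add (a : ModelGroup) (A B : Arrangement) :
    operation a (A + B) = operation a A + operation a B := by
  ext s r c
  simp only [operation]
  split_ifs <;> simp [permLines, permColumns, transposeBoth, exchange_apply]

lemma operation_smul (a : ModelGroup) (k : ℚ) (A : Arrangement) :
    operation a (k • A) = k • operation a A := by
  ext s r c
  simp only [operation]
  split_ifs <;> simp [permLines, permColumns, transposeBoth, exchange_apply]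

/-- The transformation of the parameters which corresponds to an element of the model group. -/
def transformation (a : ModelGroup) (m : Params) : Params := readout (operation a (squares m))

lemma squares_transformation (a : ModelGroup) (m : Params) :
    squares (transformation a m) = operation a (squares m) :=
  squares_readout ((isMagic_squares m).operation a)

lemma transformation_mul (a b : ModelGroup) (m : Params) :
    transformation (a * b) m = transformation a (transformation b m) :=
  squares_injective (by simp only [squares_transformation, operation_mul])

lemma transformation_one (m : Params) : transformation 1 m = m :=
  squares_injective (by simp only [squares_transformation, operation_one])

/-- The homomorphism from the model group to the transformations of the parameters. -/
def transformationHom : ModelGroup →* (Params ≃ₗ[ℚ] Params) where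
  toFun a :=
    { toFun := transformation a
      map_add' := fun m m' => squares_injective (by
        simp only [squares_transformation, squares_add, operation_add])
      map_smul' := fun k m => squares_injective (by
        simp only [squares_transformation, squares_smul, operation_smul, RingHom.id_apply])
      invFun := transformation a⁻¹
      left_inv := fun m => by rw [← transformation_mul, inv_mul_cancel, transformation_one]
      right_inv := fun m => by rw [← transformation_mul, mul_inv_cancel, transformation_one] }
  map_one' := LinearEquiv.ext transformation_one
  map_mul' a b := LinearEquiv.ext (transformation_mul a b)

lemma realizes_transformationHom (a : ModelGroup) :
    Realizes (transformationHom a) (operation a) := squares_transformation a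

lemma Realizes.unique {φ φ' : Params ≃ₗ[ℚ] Params} {μ : Arrangement → Arrangement}
    (h : Realizes φ μ) (h' : Realizes φ' μ) : φ = φ' :=
  LinearEquiv.ext fun m => squares_injective ((h m).trans (h' m).symm)

/-- The element of the model group which corresponds to a permutation of lines and columns. -/
def ModelGroup.perm (σ τ : S3) : ModelGroup := (SemidirectProduct.inl (σ, τ), 1)

/-- The element of the model group which corresponds to the transposition. -/
def ModelGroup.transpose : ModelGroup := (SemidirectProduct.inr C2.gen, 1)

/-- The element of the model group which corresponds to the exchange of the squares. -/
def ModelGroup.exchange : ModelGroup := (1, C2.gen)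

lemma operation_perm (σ τ : S3) :
    operation (ModelGroup.perm σ τ) = permLines σ ∘ permColumns τ := by
  funext A
  simp [operation, ModelGroup.perm]

lemma operation_transpose : operation ModelGroup.transpose = transposeBoth := by
  funext A
  have hg : C2.gen ≠ 1 := by decide
  simp [operation, ModelGroup.transpose, hg]
  rfl

lemma operation_exchange : operation ModelGroup.exchange = exchange := by
  funext A
  have hg : C2.gen ≠ 1 := by decide
  simp [operation, ModelGroup.exchange, hg]
  rfl

/-- The sign on the model group. -/
def modelSign : ModelGroup →* ℤˣ where
  toFun a := Equiv.Perm.sign a.1.left.1 * Equiv.Perm.sign a.1.left.2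
  map_one' := by simp
  map_mul' a b := by
    obtain ⟨⟨⟨σ, τ⟩, z⟩, w⟩ := a
    obtain ⟨⟨⟨σ', τ'⟩, z'⟩, w'⟩ := b
    have hg : C2.gen ≠ 1 := by decide
    rcases C2.eq_one_or z with rfl | rfl
    · simp; ac_rfl
    · simp [swapAction_gen_apply]; ac_rfl

lemma modelSign_perm (σ τ : S3) :
    modelSign (ModelGroup.perm σ τ) = Equiv.Perm.sign σ * Equiv.Perm.sign τ := rfl

lemma modelSign_transpose : modelSign ModelGroup.transpose = 1 := by
  simp [modelSign, ModelGroup.transpose]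

lemma modelSign_exchange : modelSign ModelGroup.exchange = 1 := by
  simp [modelSign, ModelGroup.exchange]

/-- Each elementary operation comes from the model group. -/
lemma IsMove.exists_operation {μ : Arrangement → Arrangement} {s : ℤˣ} (h : IsMove μ s) :
    ∃ a, operation a = μ ∧ modelSign a = s := by
  cases h with
  | lines σ => exact ⟨ModelGroup.perm σ 1, by rw [operation_perm]; rfl, by
      rw [modelSign_perm, map_one, mul_one]⟩
  | columns σ => exact ⟨ModelGroup.perm 1 σ, by rw [operation_perm]; rfl, by
      rw [modelSign_perm, map_one, one_mul]⟩
  | transpose => exact ⟨ModelGroup.transpose, operation_transpose, modelSign_transpose⟩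
  | exchange => exact ⟨ModelGroup.exchange, operation_exchange, modelSign_exchange⟩

/-- Each element of the model group is a product of elementary ones. -/
lemma ModelGroup.exists_factors (a : ModelGroup) :
    ∃ σ τ : S3, ∃ b c : ModelGroup, (b = 1 ∨ b = transpose) ∧ (c = 1 ∨ c = exchange) ∧
      a = perm σ 1 * perm 1 τ * b * c := by
  obtain ⟨⟨⟨σ, τ⟩, z⟩, w⟩ := a
  refine ⟨σ, τ, (SemidirectProduct.inr z, 1), (1, w), ?_, ?_, ?_⟩
  · rcases C2.eq_one_or z with rfl | rfl
    · left; rfl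
    · right; rfl
  · rcases C2.eq_one_or w with rfl | rfl
    · left; rfl
    · right; rfl
  · refine Prod.ext (SemidirectProduct.ext ?_ ?_) ?_ <;> simp [perm]

lemma range_transformationHom : transformationHom.range = symmetryGroup := by
  apply le_antisymm
  · rintro _ ⟨a, rfl⟩
    have gen : ∀ {b μ s}, IsMove μ s → operation b = μ → transformationHom b ∈ symmetryGroup := by
      intro b μ s h hb
      exact Subgroup.subset_closure ⟨μ, s, h, hb ▸ realizes_transformationHom b⟩
    obtain ⟨σ, τ, b, c, hb, hc, rfl⟩ := a.exists_factors
    simp only [map_mul]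
    refine mul_mem (mul_mem (mul_mem ?_ ?_) ?_) ?_
    · exact gen (IsMove.lines σ) (by rw [operation_perm]; rfl)
    · exact gen (IsMove.columns τ) (by rw [operation_perm]; rfl)
    · rcases hb with rfl | rfl
      · rw [map_one]; exact one_mem _
      · exact gen IsMove.transpose operation_transpose
    · rcases hc with rfl | rfl
      · rw [map_one]; exact one_mem _
      · exact gen IsMove.exchange operation_exchange
  · rw [symmetryGroup, Subgroup.closure_le]
    rintro φ ⟨μ, s, h, hφ⟩
    obtain ⟨a, rfl, -⟩ := h.exists_operation
    exact ⟨a, (realizes_transformationHom a).unique hφ⟩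

/-- A pair of squares with distinct entries. -/
def distinctSquares : Arrangement := fun s r c => ((c - r).1 + 3 * (c + r).1 + 9 * s.1 : ℕ)

lemma isMagic_distinctSquares : IsMagic distinctSquares := by
  refine ⟨⟨12, ?_, ?_⟩, 9, ?_⟩
  · have : ∀ r : Fin 3, ∑ c : Fin 3, ((c - r).1 + 3 * (c + r).1 + 9 * (0 : Fin 2).1) = 12 := by
      decide
    intro r
    have h := congrArg (Nat.cast : ℕ → ℚ) (this r)
    rw [Nat.cast_sum] at h
    exact h
  · have : ∀ c : Fin 3, ∑ r : Fin 3, ((c - r).1 + 3 * (c + r).1 + 9 * (0 : Fin 2).1) = 12 := by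
      decide
    intro r
    have h := congrArg (Nat.cast : ℕ → ℚ) (this r)
    rw [Nat.cast_sum] at h
    exact h
  · intro r c
    simp [distinctSquares]

/-- The residues `c - r` and `c + r` are ternary digits of the entry, and they determine `r` and `c`
because `2` is invertible modulo `3`. -/
lemma distinctSquares_inj {s s' : Fin 2} {r r' c c' : Fin 3}
    (h : distinctSquares s r c = distinctSquares s' r' c') : s = s' ∧ r = r' ∧ c = c' := by
  have h1 : (c - r).1 + 3 * (c + r).1 + 9 * s.1 = (c' - r').1 + 3 * (c' + r').1 + 9 * s'.1 := by
    exact Nat.cast_injective (R := ℚ) h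
  clear h
  revert s s' r r' c c'
  decide

/-- An element in the kernel fixes the pair with distinct entries, hence fixes every position. An
exchange would move the square, and a transposition would make the line index depend on the column.
-/
lemma transformationHom_injective : Function.Injective transformationHom := by
  rw [injective_iff_map_eq_one]
  intro a ha
  have h1 : operation a distinctSquares = distinctSquares := by
    have := realizes_transformationHom a (readout distinctSquares)
    rw [ha] at this
    rw [← squares_readout isMagic_distinctSquares]
    exact this.symm
  obtain ⟨⟨⟨σ, τ⟩, z⟩, w⟩ := a
  have hg : C2.gen ≠ 1 := by decide
  have h2 : ∀ s r c, permLines σ (permColumns τ ((if z = 1 then id else transposeBoth)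
      ((if w = 1 then id else exchange) distinctSquares))) s r c = distinctSquares s r c := by
    intro s r c
    exact congrFun (congrFun (congrFun h1 s) r) c
  rcases C2.eq_one_or z with rfl | rfl
  · obtain rfl : w = 1 := by
      refine (C2.eq_one_or w).resolve_right ?_
      rintro rfl
      have := h2 0 0 0
      simp only [permLines, permColumns, exchange_apply, hg, if_true, if_false, id,
        Matrix.submatrix_apply] at this
      exact absurd (distinctSquares_inj this).1 (by decide)
    have h3 : ∀ r c, σ⁻¹ r = r ∧ τ⁻¹ c = c := by
      intro r c
      have := h2 0 r c
      simp only [permLines, permColumns, if_true, id, Matrix.submatrix_apply] at this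
      exact (distinctSquares_inj this).2
    obtain rfl : σ = 1 := inv_eq_one.1 (Equiv.ext fun r => (h3 r 0).1)
    obtain rfl : τ = 1 := inv_eq_one.1 (Equiv.ext fun c => (h3 0 c).2)
    rfl
  · exfalso
    have h3 : ∀ r c, τ⁻¹ c = r := by
      intro r c
      have := h2 0 r c
      rcases C2.eq_one_or w with rfl | rfl <;>
        simp only [permLines, permColumns, transposeBoth, exchange_apply, hg, if_true, if_false, id,
          Matrix.submatrix_apply, Matrix.transpose_apply] at this <;>
        exact (distinctSquares_inj this).2.1
    exact absurd ((h3 0 0).symm.trans (h3 1 0)) (by decide)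

/-- The group of symmetries is isomorphic to the model group. -/
def symmetryEquiv : ModelGroup ≃* symmetryGroup :=
  (transformationHom.ofInjective transformationHom_injective).trans
    (MulEquiv.subgroupCongr range_transformationHom)

lemma card_symmetryGroup : Nat.card symmetryGroup = 144 := by
  rw [← Nat.card_congr symmetryEquiv.toEquiv, Nat.card_prod, SemidirectProduct.card, Nat.card_prod]
  simp [Nat.card_eq_fintype_card, Fintype.card_perm, ZMod.card]
  decide

/-! ### The squares of a label -/

/-- The pair of squares with entries `α (c - r) + β (c + r) + 1`, up to constants. -/
def labelSquares (α β : Fin 3 → ℤ) (κ : Fin 2 → ℕ) : Arrangement :=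
  fun s r c => ((α (c - r) + β (c + r) + 1 + κ s : ℤ) : ℚ)

lemma labelSquares_apply (α β : Fin 3 → ℤ) (κ : Fin 2 → ℕ) (s : Fin 2) (r c : Fin 3) :
    labelSquares α β κ s r c = ((α (c - r) + β (c + r) + 1 + κ s : ℤ) : ℚ) := rfl

lemma isMagic_labelSquares (α β : Fin 3 → ℤ) (κ : Fin 2 → ℕ) : IsMagic (labelSquares α β κ) := by
  refine ⟨⟨((∑ i, α i + ∑ i, β i + 3 + 3 * κ 0 : ℤ) : ℚ), fun r => ?_, fun c => ?_⟩,
    ((κ 1 - κ 0 : ℤ) : ℚ), fun r c => ?_⟩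
  · simp only [labelSquares_apply]
    have h1 := Equiv.sum_comp (Equiv.subRight r) α
    have h2 := Equiv.sum_comp (Equiv.addRight r) β
    rw [← h1, ← h2, ← Int.cast_sum, Int.cast_inj]
    simp only [Equiv.subRight_apply, Equiv.coe_addRight, Fin.sum_univ_three]
    ring
  · simp only [labelSquares_apply]
    have h1 := Equiv.sum_comp (Equiv.subLeft c) α
    have h2 := Equiv.sum_comp (Equiv.addLeft c) β
    rw [← h1, ← h2, ← Int.cast_sum, Int.cast_inj]
    simp only [Equiv.subLeft_apply, Equiv.coe_addLeft, Fin.sum_univ_three]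
    ring
  · simp only [labelSquares_apply]
    push_cast
    ring

/-- The parameters with the given values of `m - 1`. -/
def ofNat (p q p' q' P Q : ℕ) : Params :=
  ![(p + 1 : ℕ), (q + 1 : ℕ), (p' + 1 : ℕ), (q' + 1 : ℕ), (P + 1 : ℕ), (Q + 1 : ℕ)]

lemma IsDominant.exists_ofNat {m : Params} (hm : IsDominant m) :
    ∃ p q p' q' P Q : ℕ, m = ofNat p q p' q' P Q := by
  have h : ∀ i, ∃ k : ℕ, m i = (k + 1 : ℕ) := by
    intro i
    obtain ⟨k, hk, h⟩ := hm i
    exact ⟨k - 1, by rw [h, Nat.sub_add_cancel hk]⟩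
  choose k hk using h
  refine ⟨k 0, k 1, k 2, k 3, k 4, k 5, funext fun i => ?_⟩
  fin_cases i <;> exact hk _

/-- Both sides of the equation of squares are magic, so it is enough to compare the six entries read
by `readout`. These comparisons are the six equations of a label, and the vanishing product is its
disjointness. -/
lemma isLabel_iff {α β : Fin 3 → ℤ} {κ : Fin 2 → ℕ} {p q p' q' P Q : ℕ} :
    Pol.IsLabel α β (κ 0) (κ 1) p q p' q' P Q ↔
      squares (ofNat p q p' q' P Q) = labelSquares α β κ ∧ ∏ s, κ s = 0 := by
  have h1 : squares (ofNat p q p' q' P Q) = labelSquares α β κ ↔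
      ofNat p q p' q' P Q = readout (labelSquares α β κ) := by
    constructor
    · intro h
      rw [← h, readout_squares]
    · intro h
      rw [h, squares_readout (isMagic_labelSquares α β κ)]
  have cast : ∀ (n : ℕ) (z : ℤ), ((n + 1 : ℕ) : ℚ) = ((z : ℤ) : ℚ) ↔ (n : ℤ) + 1 = z :=
    fun n z => by exact_mod_cast Iff.rfl
  have i2 : (0 : Fin 3) - 2 = 1 := by decide
  have i3 : (1 : Fin 3) - 2 = 2 := by decide
  have i4 : (1 : Fin 3) + 2 = 0 := by decide
  have i5 : (2 : Fin 3) + 2 = 1 := by decide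
  rw [h1, Fin.prod_univ_two, mul_eq_zero, funext_iff]
  simp only [ofNat, readout, labelSquares_apply, Fin.forall_fin_succ, Matrix.cons_val_zero,
      Matrix.cons_val_succ,
    cast, sub_zero, add_zero, sub_self, zero_add, i2, i3, i4, i5, IsEmpty.forall_iff, and_true]
  constructor
  · rintro ⟨h1, h2, h3, h4, h5, h6, h7⟩
    refine ⟨⟨?_, ?_, ?_, ?_, ?_, ?_⟩, h7⟩ <;> linarith
  · rintro ⟨⟨h1, h2, h3, h4, h5, h6⟩, h7⟩
    refine ⟨?_, ?_, ?_, ?_, ?_, ?_, h7⟩ <;> linarith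

/-- The operation `μ` permutes the components of labels, and exchanges their two parts if the sign
is `-1`. -/
def PermutesLabels (μ : Arrangement → Arrangement) (s : ℤˣ) : Prop :=
  ∃ (σ τ : S3) (ρ : Equiv.Perm (Fin 2)), ∀ α β κ, μ (labelSquares α β κ) =
    if s = 1 then labelSquares (fun i => α (σ i)) (fun i => β (τ i)) (fun i => κ (ρ i))
    else labelSquares (fun i => β (σ i)) (fun i => α (τ i)) (fun i => κ (ρ i))

lemma PermutesLabels.comp {μ μ' : Arrangement → Arrangement} {s s' : ℤˣ} (h : PermutesLabels μ s)
    (h' : PermutesLabels μ' s') : PermutesLabels (μ ∘ μ') (s * s') := by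
  obtain ⟨σ, τ, ρ, h⟩ := h
  obtain ⟨σ', τ', ρ', h'⟩ := h'
  have hne : (-1 : ℤˣ) ≠ 1 := by decide
  rcases Int.units_eq_one_or s with rfl | rfl <;> rcases Int.units_eq_one_or s' with rfl | rfl
  · refine ⟨σ' * σ, τ' * τ, ρ' * ρ, fun α β κ => ?_⟩
    simp only [Function.comp_apply, h', h, mul_one, if_true]
    rfl
  · refine ⟨σ' * σ, τ' * τ, ρ' * ρ, fun α β κ => ?_⟩
    simp only [Function.comp_apply, h', h, one_mul, if_true, if_neg hne]
    rfl
  · refine ⟨τ' * σ, σ' * τ, ρ' * ρ, fun α β κ => ?_⟩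
    simp only [Function.comp_apply, h', h, mul_one, if_true, if_neg hne]
    rfl
  · refine ⟨τ' * σ, σ' * τ, ρ' * ρ, fun α β κ => ?_⟩
    simp only [Function.comp_apply, h', h, mul_neg, neg_neg, mul_one, if_true, if_neg hne]
    rfl

lemma permutesLabels_id : PermutesLabels id 1 := ⟨1, 1, 1, fun _ _ _ => rfl⟩

/-- Exchanging `r` and `c` negates `c - r` and fixes `c + r`. -/
lemma permutesLabels_transposeBoth : PermutesLabels transposeBoth 1 := by
  refine ⟨Equiv.neg (Fin 3), 1, 1, fun α β κ => ?_⟩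
  ext s r c
  simp only [if_true, transposeBoth, Matrix.transpose_apply, labelSquares_apply, Equiv.neg_apply,
    neg_sub, Equiv.Perm.one_apply, add_comm r c]

lemma permutesLabels_exchange : PermutesLabels exchange 1 := by
  refine ⟨1, 1, Equiv.subLeft 1, fun α β κ => ?_⟩
  ext s r c
  simp only [if_true, exchange_apply, labelSquares_apply, Equiv.subLeft_apply, Equiv.Perm.one_apply]

/-- All permutations of the residues modulo `3` are affine: the even ones are translations and the
odd ones reflections. Hence each acts simply on both families of diagonals. -/
lemma exists_affine_even (σ : S3) (hσ : Equiv.Perm.sign σ = 1) : ∃ k : Fin 3, ∀ r, σ⁻¹ r = r +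
    k := by
  revert σ; decide

lemma exists_affine_odd (σ : S3) (hσ : Equiv.Perm.sign σ = -1) :
    ∃ k : Fin 3, ∀ r, σ⁻¹ r = k - r := by
  revert σ; decide

/-- A translation of `r` translates `c - r` and `c + r`. A reflection exchanges them up to
translation, so that `α` and `β` trade places; the sign records this exchange. -/
lemma permutesLabels_permLines (σ : S3) : PermutesLabels (permLines σ) (Equiv.Perm.sign σ) := by
  rcases Int.units_eq_one_or (Equiv.Perm.sign σ) with h | h
  · obtain ⟨k, hk⟩ := exists_affine_even σ h
    refine ⟨Equiv.subRight k, Equiv.addRight k, 1, fun α β κ => ?_⟩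
    ext s r c
    rw [if_pos h]
    simp only [permLines, Matrix.submatrix_apply, labelSquares_apply, hk, id, Equiv.subRight_apply,
      Equiv.coe_addRight, Equiv.Perm.one_apply, sub_sub, add_assoc]
  · obtain ⟨k, hk⟩ := exists_affine_odd σ h
    refine ⟨Equiv.addRight k, Equiv.subRight k, 1, fun α β κ => ?_⟩
    ext s r c
    rw [if_neg (by rw [h]; decide)]
    simp only [permLines, Matrix.submatrix_apply, labelSquares_apply, hk, id, Equiv.subRight_apply,
      Equiv.coe_addRight, Equiv.Perm.one_apply]
    rw [show c - (k - r) = c + r - k by abel, show c + (k - r) = c - r + k by abel]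
    push_cast
    ring

/-- Permuting columns is permuting lines conjugated by the transposition, whose sign is `1`. -/
lemma permutesLabels_permColumns (σ : S3) : PermutesLabels (permColumns σ) (Equiv.Perm.sign σ) := by
  have h := (permutesLabels_transposeBoth.comp (permutesLabels_permLines σ)).comp
      permutesLabels_transposeBoth
  rwa [one_mul, mul_one] at h

lemma permutesLabels_operation (a : ModelGroup) : PermutesLabels (operation a) (modelSign a) := by
  obtain ⟨σ, τ, b, c, hb, hc, rfl⟩ := a.exists_factors
  have h1 : ∀ σ, operation (ModelGroup.perm σ 1) = permLines σ := fun σ => by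
    rw [operation_perm]; rfl
  have h2 : ∀ σ, operation (ModelGroup.perm 1 σ) = permColumns σ := fun σ => by
    rw [operation_perm]; rfl
  have h3 : ∀ a b : ModelGroup, operation (a * b) = operation a ∘ operation b := fun a b =>
    funext (operation_mul a b)
  have hid : PermutesLabels (operation 1) (modelSign 1) := by
    rw [map_one, show operation 1 = id from funext operation_one]
    exact permutesLabels_id
  simp only [h3, map_mul]
  refine PermutesLabels.comp (PermutesLabels.comp (PermutesLabels.comp ?_ ?_) ?_) ?_
  · rw [h1, modelSign_perm, map_one, mul_one]
    exact permutesLabels_permLines σ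
  · rw [h2, modelSign_perm, map_one, one_mul]
    exact permutesLabels_permColumns τ
  · rcases hb with rfl | rfl
    · exact hid
    · rw [operation_transpose, modelSign_transpose]
      exact permutesLabels_transposeBoth
  · rcases hc with rfl | rfl
    · exact hid
    · rw [operation_exchange, modelSign_exchange]
      exact permutesLabels_exchange

/-! ### Labels of multiplicity spaces -/

lemma IsLadder.map {M M' : Type*} [AddCommGroup M] [Module ℂ M] [AddCommGroup M'] [Module ℂ M']
    {α β : Fin 3 → ℤ} {κ : ℂ} {A B : Module.End ℂ M} {v : ℤ → M} (h : IsLadder α β κ A B v)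
    (f : M ≃ₗ[ℂ] M') : IsLadder α β κ (f.conj A) (f.conj B) fun t => f (v t) := by
  refine ⟨h.linearIndependent.map' (f : M →ₗ[ℂ] M') f.ker, ?_, fun t ht => ?_, fun t ht => ?_⟩
  · rw [show (fun t => f (v t)) = f ∘ v from rfl, Set.image_comp]
    change Submodule.span ℂ ((f : M →ₗ[ℂ] M') '' _) = ⊤
    rw [← Submodule.map_span, h.span, Submodule.map_top]
    exact f.range
  · rw [LinearEquiv.conj_apply_apply, f.symm_apply_apply, h.apply_left t ht]
    simp only [map_add, map_smul]
  · rw [LinearEquiv.conj_apply_apply, f.symm_apply_apply, h.apply_right t ht]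
    simp only [map_add, map_smul]

section

variable {V V' : Type*} [AddCommGroup V] [Module ℂ V] [LieRingModule sl3 V] [LieModule ℂ sl3 V]
  [AddCommGroup V'] [Module ℂ V'] [LieRingModule sl3 V'] [LieModule ℂ sl3 V']

lemma exists_equiv_model_multSpace {p q p' q' : ℕ} (hV : IsIrrep (p + 1 : ℕ) (q + 1 : ℕ) V)
    (hV' : IsIrrep (p' + 1 : ℕ) (q' + 1 : ℕ) V') (x y : ℚ) :
    ∃ f : multSpace (Pol.model p q) (Pol.model p' q') x y ≃ₗ[ℂ] multSpace V V' x y,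
      f.conj (physX (Pol.model p q) (Pol.model p' q') x y) = physX V V' x y ∧
      f.conj (physY (Pol.model p q) (Pol.model p' q') x y) = physY V V' x y := by
  obtain ⟨f, hf⟩ := hV.exists_equiv_model
  obtain ⟨f', hf'⟩ := hV'.exists_equiv_model
  obtain ⟨P, h1, h2⟩ := exists_multSpace_equiv f f' hf hf' x y
  refine ⟨P.symm, ?_, ?_⟩
  · rw [← h1]; ext v; simp
  · rw [← h2]; ext v; simp

lemma exists_label {m : Params} (hm : IsDominant m) (hV : IsIrrep (m 0) (m 1) V)
    (hV' : IsIrrep (m 2) (m 3) V') (h : multSpace V V' (m 4) (m 5) ≠ ⊥) :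
    ∃ α β κ, (∀ i, 0 ≤ α i) ∧ (∀ i, 0 ≤ β i) ∧ ∏ s, κ s = 0 ∧ squares m = labelSquares α β κ := by
  obtain ⟨p, q, p', q', P, Q, rfl⟩ := hm.exists_ofNat
  obtain ⟨f, -, -⟩ := exists_equiv_model_multSpace (p := p) (q := q) (p' := p') (q' := q') hV hV'
    ((P + 1 : ℕ) : ℚ) ((Q + 1 : ℕ) : ℚ)
  have h1 : multSpace (Pol.model p q) (Pol.model p' q') (P + 1 : ℕ) (Q + 1 : ℕ) ≠ ⊥ := by
    intro h2
    apply h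
    rw [← Submodule.subsingleton_iff_eq_bot] at h2 ⊢
    exact f.symm.toEquiv.subsingleton
  obtain ⟨a, b, κ₁, κ₂, hl⟩ := Pol.exists_isLabel h1
  have h2 := (isLabel_iff (κ := ![κ₁, κ₂])).1 hl
  exact ⟨_, _, _, fun i => Int.natCast_nonneg _, fun i => Int.natCast_nonneg _, h2.2, h2.1⟩

lemma exists_isLadder_of_label {m : Params} (hm : IsDominant m) (hV : IsIrrep (m 0) (m 1) V)
    (hV' : IsIrrep (m 2) (m 3) V') {α β : Fin 3 → ℤ} {κ : Fin 2 → ℕ} (hκ : ∏ s, κ s = 0)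
    (h : squares m = labelSquares α β κ) :
    ∃ v, IsLadder α β (∑ s, κ s : ℕ) (physX V V' (m 4) (m 5)) (physY V V' (m 4) (m 5)) v := by
  obtain ⟨p, q, p', q', P, Q, rfl⟩ := hm.exists_ofNat
  obtain ⟨f, h1, h2⟩ := exists_equiv_model_multSpace (p := p) (q := q) (p' := p') (q' := q')
    hV hV' ((P + 1 : ℕ) : ℚ) ((Q + 1 : ℕ) : ℚ)
  obtain ⟨v, hv⟩ := Pol.exists_isLadder (isLabel_iff.2 ⟨h, hκ⟩)
  have h3 := hv.map f
  rw [h1, h2] at h3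
  rw [Fin.sum_univ_two]
  exact ⟨_, h3⟩

lemma multSpace_ne_bot_of_label {m : Params} (hm : IsDominant m) (hV : IsIrrep (m 0) (m 1) V)
    (hV' : IsIrrep (m 2) (m 3) V') {α β : Fin 3 → ℤ} {κ : Fin 2 → ℕ} (hα : ∀ i, 0 ≤ α i)
    (hβ : ∀ i, 0 ≤ β i) (hκ : ∏ s, κ s = 0) (h : squares m = labelSquares α β κ) :
    multSpace V V' (m 4) (m 5) ≠ ⊥ := by
  obtain ⟨v, hv⟩ := exists_isLadder_of_label hm hV hV' hκ h
  -- Nonnegativity of the label means that the index `0` lies in the window, and the corresponding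
  -- basis vector is nonzero.
  have h0 : (0 : ℤ) ∈ window α β := fun i => ⟨by simpa using hα i, by simpa using hβ i⟩
  intro h1
  rw [← Submodule.subsingleton_iff_eq_bot] at h1
  exact hv.linearIndependent.ne_zero ⟨0, h0⟩ (Subsingleton.elim _ _)

end

/-- Each entry is a sum of nonnegative integers and `1`, and the parameters are among the entries.
-/
lemma isDominant_of_label {m : Params} {α β : Fin 3 → ℤ} {κ : Fin 2 → ℕ} (hα : ∀ i, 0 ≤ α i)
    (hβ : ∀ i, 0 ≤ β i) (h : squares m = labelSquares α β κ) : IsDominant m := by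
  have key : ∀ s r c, ∃ k : ℕ, 0 < k ∧ squares m s r c = k := by
    intro s r c
    have h1 := hα (c - r)
    have h2 := hβ (c + r)
    refine ⟨(α (c - r) + β (c + r) + 1 + κ s).toNat, by omega, ?_⟩
    rw [h, labelSquares_apply, ← Int.cast_natCast (R := ℚ), Int.toNat_of_nonneg (by omega)]
  intro i
  rw [← readout_squares m]
  fin_cases i
  exacts [key 0 0 0, key 1 2 0, key 0 0 1, key 1 2 1, key 1 2 2, key 0 0 2]

lemma exists_label_operation (a : ModelGroup) {α β : Fin 3 → ℤ} {κ : Fin 2 → ℕ}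
    (hα : ∀ i, 0 ≤ α i) (hβ : ∀ i, 0 ≤ β i) (hκ : ∏ s, κ s = 0) :
    ∃ α' β' κ', (∀ i, 0 ≤ α' i) ∧ (∀ i, 0 ≤ β' i) ∧ ∏ s, κ' s = 0 ∧
      operation a (labelSquares α β κ) = labelSquares α' β' κ' := by
  obtain ⟨σ, τ, ρ, h⟩ := permutesLabels_operation a
  have hρ := (Equiv.prod_comp ρ κ).trans hκ
  rw [h]
  split_ifs
  · exact ⟨_, _, _, fun i => hα _, fun i => hβ _, hρ, rfl⟩
  · exact ⟨_, _, _, fun i => hβ _, fun i => hα _, hρ, rfl⟩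

/-! ### Symmetries of the multiplicity spaces -/

section

variable {V V' W W' : Type*}
  [AddCommGroup V] [Module ℂ V] [LieRingModule sl3 V] [LieModule ℂ sl3 V]
  [AddCommGroup V'] [Module ℂ V'] [LieRingModule sl3 V'] [LieModule ℂ sl3 V']
  [AddCommGroup W] [Module ℂ W] [LieRingModule sl3 W] [LieModule ℂ sl3 W]
  [AddCommGroup W'] [Module ℂ W'] [LieRingModule sl3 W'] [LieModule ℂ sl3 W']

lemma isDominant_transformation (a : ModelGroup) {m : Params} (hm : IsDominant m)
    (hV : IsIrrep (m 0) (m 1) V) (hV' : IsIrrep (m 2) (m 3) V')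
    (h : multSpace V V' (m 4) (m 5) ≠ ⊥) : IsDominant (transformation a m) := by
  obtain ⟨α, β, κ, hα, hβ, hκ, hl⟩ := exists_label hm hV hV' h
  obtain ⟨α', β', κ', hα', hβ', -, hl'⟩ := exists_label_operation a hα hβ hκ
  exact isDominant_of_label hα' hβ' ((squares_transformation a m).trans (by rw [hl, hl']))

lemma multSpace_transformation_ne_bot (a : ModelGroup) {m : Params} (hm : IsDominant m)
    (hV : IsIrrep (m 0) (m 1) V) (hV' : IsIrrep (m 2) (m 3) V') {m' : Params}
    (hm' : IsDominant m') (ha : m' = transformation a m)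
    (hW : IsIrrep (m' 0) (m' 1) W) (hW' : IsIrrep (m' 2) (m' 3) W')
    (h : multSpace V V' (m 4) (m 5) ≠ ⊥) : multSpace W W' (m' 4) (m' 5) ≠ ⊥ := by
  obtain ⟨α, β, κ, hα, hβ, hκ, hl⟩ := exists_label hm hV hV' h
  obtain ⟨α', β', κ', hα', hβ', hκ', hl'⟩ := exists_label_operation a hα hβ hκ
  exact multSpace_ne_bot_of_label hm' hW hW' hα' hβ' hκ'
    (by rw [ha, squares_transformation, hl, hl'])

/-- The label of `m'` is that of `m` with components permuted, and with `α` and `β` exchanged if the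
sign is `-1`. The symmetries of ladders then provide two ladders with identical coefficients. -/
theorem exists_equiv_transformation (a : ModelGroup) {m : Params} (hm : IsDominant m)
    (hV : IsIrrep (m 0) (m 1) V) (hV' : IsIrrep (m 2) (m 3) V') {m' : Params}
    (hm' : IsDominant m') (ha : m' = transformation a m)
    (hW : IsIrrep (m' 0) (m' 1) W) (hW' : IsIrrep (m' 2) (m' 3) W') :
    ∃ P : multSpace V V' (m 4) (m 5) ≃ₗ[ℂ] multSpace W W' (m' 4) (m' 5),
      P.conj (physX V V' (m 4) (m 5)) = ((modelSign a : ℤ) : ℂ) • physX W W' (m' 4) (m' 5) ∧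
      P.conj (physY V V' (m 4) (m 5)) = physY W W' (m' 4) (m' 5) := by
  by_cases h : multSpace V V' (m 4) (m 5) = ⊥
  -- Nonvanishing is preserved by every element, in particular by the inverse. So both spaces vanish
  -- together, and the equivalence is trivial.
  · have h' : multSpace W W' (m' 4) (m' 5) = ⊥ := by
      by_contra h'
      refine multSpace_transformation_ne_bot a⁻¹ hm' hW hW' hm ?_ hV hV' h' h
      rw [ha, ← transformation_mul, inv_mul_cancel, transformation_one]
    have h1 := Submodule.subsingleton_iff_eq_bot.2 h
    have h2 := Submodule.subsingleton_iff_eq_bot.2 h'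
    exact ⟨0, LinearMap.ext fun x => Subsingleton.elim _ _,
      LinearMap.ext fun x => Subsingleton.elim _ _⟩
  · obtain ⟨α, β, κ, hα, hβ, hκ, hl⟩ := exists_label hm hV hV' h
    obtain ⟨v, hv⟩ := exists_isLadder_of_label hm hV hV' hκ hl
    obtain ⟨σ, τ, ρ, hr⟩ := permutesLabels_operation a
    have hprod : ∏ s, κ (ρ s) = 0 := (Equiv.prod_comp ρ κ).trans hκ
    have hsum : ∑ s, κ (ρ s) = ∑ s, κ s := Equiv.sum_comp ρ κ
    have hl' := squares_transformation a m
    rw [← ha, hl, hr] at hl'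
    rcases Int.units_eq_one_or (modelSign a) with hs | hs
    · rw [if_pos hs] at hl'
      obtain ⟨w, hw⟩ := exists_isLadder_of_label hm' hW hW' hprod hl'
      rw [hsum] at hw
      obtain ⟨P, h1, h2⟩ := (hv.comp σ τ).exists_equiv hw
      exact ⟨P, by rw [h1, hs]; simp, h2⟩
    · rw [if_neg (by rw [hs]; decide)] at hl'
      obtain ⟨w, hw⟩ := exists_isLadder_of_label hm' hW hW' hprod hl'
      rw [hsum] at hw
      obtain ⟨P, h1, h2⟩ := (hv.swap.comp σ τ).exists_equiv hw
      refine ⟨P, ?_, h2⟩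
      rw [← h1, hs]
      ext x
      simp [LinearEquiv.conj_apply_apply]

end

end MissingLabel

end

open MissingLabel in
theorem mainTheorem2 :
    -- each operation on the squares defines a transformation of the parameters
    (∀ μ s, IsMove μ s → ∃! φ : Params ≃ₗ[ℚ] Params, Realizes φ μ) ∧
    -- order and structure of the group generated by these transformations
    Nat.card symmetryGroup = 144 ∧
    (∃ Ψ : ModelGroup ≃* symmetryGroup,
      (∀ σ τ : S3, Realizes (Ψ (SemidirectProduct.inl (σ, τ), 1)).1
        (permLines σ ∘ permColumns τ)) ∧
      Realizes (Ψ (SemidirectProduct.inr C2.gen, 1)).1 transposeBoth ∧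
      Realizes (Ψ (1, C2.gen)).1 exchange) ∧
    -- the elements of the group are symmetries of the missing label
    ∃ sgn : symmetryGroup →* ℤˣ,
      (∀ (g : symmetryGroup) (μ : Arrangement → Arrangement) (s : ℤˣ),
        IsMove μ s → Realizes g.1 μ → sgn g = s) ∧
      ∀ (g : symmetryGroup) (m : Params), IsDominant m →
        ∀ (V V' : Type*)
          [AddCommGroup V] [Module ℂ V] [LieRingModule sl3 V] [LieModule ℂ sl3 V]
          [AddCommGroup V'] [Module ℂ V'] [LieRingModule sl3 V'] [LieModule ℂ sl3 V'],
          IsIrrep (m 0) (m 1) V → IsIrrep (m 2) (m 3) V' →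
          (multiplicity V V' (m 4) (m 5) ≠ 0 → IsDominant (g.1 m)) ∧
          (IsDominant (g.1 m) →
            ∀ (W W' : Type*)
              [AddCommGroup W] [Module ℂ W] [LieRingModule sl3 W] [LieModule ℂ sl3 W]
              [AddCommGroup W'] [Module ℂ W'] [LieRingModule sl3 W'] [LieModule ℂ sl3 W'],
              IsIrrep (g.1 m 0) (g.1 m 1) W → IsIrrep (g.1 m 2) (g.1 m 3) W' →
              multiplicity W W' (g.1 m 4) (g.1 m 5) = multiplicity V V' (m 4) (m 5) ∧
              ∃ P : multSpace V V' (m 4) (m 5) ≃ₗ[ℂ] multSpace W W' (g.1 m 4) (g.1 m 5),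
                P.conj (physX V V' (m 4) (m 5))
                  = ((sgn g : ℤ) : ℂ) • physX W W' (g.1 m 4) (g.1 m 5) ∧
                P.conj (physY V V' (m 4) (m 5)) = physY W W' (g.1 m 4) (g.1 m 5)) := by

  refine ⟨fun μ s h => ?_, card_symmetryGroup, ⟨symmetryEquiv, fun σ τ => ?_, ?_, ?_⟩,
    modelSign.comp symmetryEquiv.symm.toMonoidHom, fun g μ s h hg => ?_, fun g m hm V V' => ?_⟩
  · obtain ⟨a, rfl, -⟩ := h.exists_operation
    exact ⟨_, realizes_transformationHom a, fun φ hφ => hφ.unique (realizes_transformationHom a)⟩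
  · rw [← operation_perm]
    exact realizes_transformationHom _
  · rw [← operation_transpose]
    exact realizes_transformationHom _
  · rw [← operation_exchange]
    exact realizes_transformationHom _
  · obtain ⟨a, rfl, rfl⟩ := h.exists_operation
    -- An operation is realised by only one transformation, so the sign computed in the model group
    -- is the prescribed one.
    obtain rfl : symmetryEquiv a = g :=
      Subtype.ext ((realizes_transformationHom a).unique hg)
    change modelSign (symmetryEquiv.symm (symmetryEquiv a)) = modelSign a
    rw [MulEquiv.symm_apply_apply]
  · intro _ _ _ _ _ _ _ _ hV hV'
    obtain ⟨a, rfl⟩ := symmetryEquiv.surjective g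
    have hsgn : (modelSign.comp symmetryEquiv.symm.toMonoidHom) (symmetryEquiv a) = modelSign a :=
      congrArg modelSign (symmetryEquiv.symm_apply_apply a)
    refine ⟨fun h => ?_, fun hm' W W' => ?_⟩
    · refine isDominant_transformation a hm hV hV' fun h0 => h ?_
      change Module.finrank ℂ (multSpace V V' (m 4) (m 5)) = 0
      rw [h0, finrank_bot]
    · intro _ _ _ _ _ _ _ _ hW hW'
      rw [hsgn]
      obtain ⟨P, hP⟩ := exists_equiv_transformation a hm hV hV' hm' rfl hW hW'
      exact ⟨P.finrank_eq.symm, P, hP⟩
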